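/- Let $N\ge 2$, let $\Omega\subset\mathbb R^N$ be a bounded domain with Lipschitz boundary, and let $0<\alpha\le\tilde\beta$. Let $\tilde{\mathcal M}(\alpha,\tilde\beta)$ be the set of $N\times N$ real matrix-valued functions $A$ on $\Omega$ with measurable entries such that, for almost every $x\in\Omega$ and every $\xi\in\mathbb R^N$, $A(x)\xi\cdot\xi\ge\alpha|\xi|^2$ and $A(x)^{-1}\xi\cdot\xi\ge\tilde\beta^{-1}|\xi|^2$. Let $W^{1/2,2}(\partial\Omega)$ be the space of traces of $W^{1,2}(\Omega)$ functions, with norm $\|h\|=\inf\{\|u\|_{W^{1,2}(\Omega)}: u|_{\partial\Omega}=h\}$, let $W^{-1/2,2}(\partial\Omega)$ be its dual, and let $L^2_*(\partial\Omega)$, $W^{1/2,2}_*(\partial\Omega)$ and $W^{-1/2,2}_*(\partial\Omega)$ be the subspaces of the $g\in L^2(\partial\Omega)$ and $g\in W^{1/2,2}(\partial\Omega)$ with $\int_{\partial\Omega}g=0$, and of the $g\in W^{-1/2,2}(\partial\Omega)$ with $\langle g,1\rangle=0$, respectively; $L^2_*(\partial\Omega)\subset W^{-1/2,2}_*(\partial\Omega)$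 through $\langle g,h\rangle=\int_{\partial\Omega}gh$. For $A\in\tilde{\mathcal M}(\alpha,\tilde\beta)$, $F\in(W^{1,2}(\Omega))^*$ and $\varphi\in W^{1,2}(\Omega)$ let $u(A,F,\varphi)$ be the weak solution of $-\mathrm{div}(A\nabla u)=F$ in $\Omega$, $u=\varphi$ on $\partial\Omega$, that is $u-\varphi\in W^{1,2}_0(\Omega)$ and $\int_\Omega A\nabla u\cdot\nabla\psi=\langle F,\psi\rangle$ for all $\psi\in W^{1,2}_0(\Omega)$. For $F=0$ it depends on $\varphi$ only through its trace, and $u(A,0,h)$ is written also for $h\in W^{1/2,2}(\partial\Omega)$. For $g\in W^{-1/2,2}_*(\partial\Omega)$ let $v(A,g)\in W^{1,2}(\Omega)$ be the weak solution of the Neumann problem: $\int_{\partial\Omega}v=0$ and $\int_\Omega A\nabla v\cdot\nabla\psi=\langle g,\psi|_{\partial\Omega}\rangle$ for all $\psi\in W^{1,2}(\Omega)$. The Neumann-to-Dirichlet map $N\text{-}D(A):L^2_*(\partial\Omega)\to L^2_*(\partial\Omega)$ is the bounded linear operator $N\text{-}D(A)[g]=v(A,g)|_{\partial\Omega}$.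 If moreover $A(x)$ is symmetric for almost every $x$ and $\hat\Lambda_N: W^{-1/2,2}_*(\partial\Omega)\to W^{1/2,2}_*(\partial\Omega)$ is a bounded linear operator, then $KN_1(A): L^2_*(\partial\Omega)\to L^2(\Omega,\mathbb R^N)$ is the bounded linear operator $$KN_1(A)[g]=A^{1/2}\big(\nabla u(A,0,\hat\Lambda_N(g))-\nabla v(A,g)\big).$$ Let $A_n$ ($n\in\mathbb N$) and $A$ belong to $\tilde{\mathcal M}(\alpha,\tilde\beta)$ and let $A_n$ $H$-converge to $A$: for every $F\in(W^{1,2}(\Omega))^*$, with $u_n=u(A_n,F,0)$ and $u=u(A,F,0)$, one has $u_n\rightharpoonup u$ weakly in $W^{1,2}_0(\Omega)$ and $A_n\nabla u_n\rightharpoonup A\nabla u$ weakly in $L^2(\Omega,\mathbb R^N)$. Then the trace operator $W^{1,2}(\Omega)\to L^2(\partial\Omega)$ and the maps $N\text{-}D(B)$, $B\in\tilde{\mathcal M}(\alpha,\tilde\beta)$, are well defined, and $$\lim_n\|N\text{-}D(A_n)-N\text{-}D(A)\|_{\mathcal L(L^2_*(\partial\Omega),L^2_*(\partial\Omega))}=0.$$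 If in addition $A_n(x)$ is symmetric for every $n$ and almost every $x\in\Omega$, then $A(x)$ is symmetric for almost every $x\in\Omega$, and for every bounded linear $\hat\Lambda_N: W^{-1/2,2}_*(\partial\Omega)\to W^{1/2,2}_*(\partial\Omega)$ the operators $KN_1(B)$, for $B\in\tilde{\mathcal M}(\alpha,\tilde\beta)$ symmetric almost everywhere, are well defined, and $$\lim_n\|KN_1(A_n)\|_{\mathcal L(L^2_*(\partial\Omega),L^2(\Omega,\mathbb R^N))}=\|KN_1(A)\|_{\mathcal L(L^2_*(\partial\Omega),L^2(\Omega,\mathbb R^N))}.$$ -/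

import Mathlib

open MeasureTheory Filter Topology
open scoped ContDiff MatrixOrder

noncomputable section

namespace HConv

/-- Euclidean space `ℝ^N`. -/
abbrev E (N : ℕ) := EuclideanSpace ℝ (Fin N)

/-! ### Lipschitz domains -/

/-- `Ω` has Lipschitz boundary: near each boundary point there are a unit vector `e` (the vertical
direction of a rigid coordinate system) and a Lipschitz function `γ` of the component orthogonal
to `e`, such that `Ω` is locally the region strictly above the graph of `γ`. -/
def HasLipschitzBoundary {N : ℕ} (Ω : Set (E N)) : Prop :=
  ∀ x₀ ∈ frontier Ω, ∃ (e : E N) (γ : E N → ℝ) (K : NNReal) (r : ℝ),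
    ‖e‖ = 1 ∧ LipschitzWith K γ ∧ 0 < r ∧
      ∀ x ∈ Metric.ball x₀ r,
        (x ∈ Ω ↔ γ (x - inner ℝ x e • e) < inner ℝ x e)

/-- A bounded domain (nonempty connected open set) with Lipschitz boundary. -/
structure IsBoundedLipschitzDomain {N : ℕ} (Ω : Set (E N)) : Prop where
  isOpen : IsOpen Ω
  isConnected : IsConnected Ω
  isBounded : Bornology.IsBounded Ω
  lipschitz : HasLipschitzBoundary Ω

/-! ### Conductivity tensors -/

/-- The action of a matrix on a vector of `ℝ^N`. -/
def act {N : ℕ} (M : Matrix (Fin N) (Fin N) ℝ) (ξ : E N) : E N := Matrix.toEuclideanLin M ξ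

/-- The class `M̃(α, β̃)` on `Ω`: measurable entries and, at almost every point of `Ω`,
`A ξ · ξ ≥ α |ξ|²` and `A⁻¹ ξ · ξ ≥ β̃⁻¹ |ξ|²` for all `ξ`. -/
structure MemTilde {N : ℕ} (Ω : Set (E N)) (α β : ℝ) (A : E N → Matrix (Fin N) (Fin N) ℝ) :
    Prop where
  aemeasurable : ∀ i j, AEMeasurable (fun x => A x i j) (volume.restrict Ω)
  elliptic : ∀ᵐ x ∂(volume.restrict Ω), ∀ ξ : E N, α * ‖ξ‖ ^ 2 ≤ inner ℝ (act (A x) ξ) ξ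
  elliptic_inv : ∀ᵐ x ∂(volume.restrict Ω), ∀ ξ : E N,
    β⁻¹ * ‖ξ‖ ^ 2 ≤ inner ℝ (act (A x)⁻¹ ξ) ξ

/-- `A(x)` is symmetric for almost every `x ∈ Ω`. -/
def IsSymmTensor {N : ℕ} (Ω : Set (E N)) (A : E N → Matrix (Fin N) (Fin N) ℝ) : Prop :=
  ∀ᵐ x ∂(volume.restrict Ω), (A x).IsSymm

/-! ### The Sobolev spaces `W^{1,2}(Ω)` and `W^{1,2}_0(Ω)` -/

/-- `L²(Ω)`. -/
abbrev L2 {N : ℕ} (Ω : Set (E N)) := Lp ℝ 2 (volume.restrict Ω)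

/-- `L²(Ω, ℝ^N)`. -/
abbrev L2Vec {N : ℕ} (Ω : Set (E N)) := Lp (E N) 2 (volume.restrict Ω)

/-- Test functions: smooth functions with compact support contained in `Ω`. -/
structure IsTest {N : ℕ} (Ω : Set (E N)) (φ : E N → ℝ) : Prop where
  smooth : ContDiff ℝ ∞ φ
  compact : HasCompactSupport φ
  subset : tsupport φ ⊆ Ω

/-- `G` is the weak gradient of `u` in `Ω`: `∫_Ω u ∂_e φ = - ∫_Ω (G · e) φ` for every test function
`φ` and every direction `e`. -/
def IsWeakGradient {N : ℕ} (Ω : Set (E N)) (u : L2 Ω) (G : L2Vec Ω) : Prop :=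
  ∀ φ : E N → ℝ, IsTest Ω φ → ∀ e : E N,
    ∫ x in Ω, u x * fderiv ℝ φ x e = - ∫ x in Ω, inner ℝ (G x) e * φ x

lemma IsTest.memLp {N : ℕ} {Ω : Set (E N)} {φ : E N → ℝ} (h : IsTest Ω φ) :
    MemLp φ 2 (volume.restrict Ω) :=
  (h.smooth.continuous.memLp_of_hasCompactSupport h.compact).restrict Ω

lemma IsTest.memLp_fderiv {N : ℕ} {Ω : Set (E N)} {φ : E N → ℝ} (h : IsTest Ω φ) (e : E N) :
    MemLp (fun x => fderiv ℝ φ x e) 2 (volume.restrict Ω) := by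
  have hc : Continuous (fun x => fderiv ℝ φ x e) :=
    (h.smooth.continuous_fderiv (by simp)).clm_apply continuous_const
  exact (hc.memLp_of_hasCompactSupport (h.compact.fderiv_apply ℝ e)).restrict Ω

lemma integrable_left {N : ℕ} {Ω : Set (E N)} {φ : E N → ℝ} (h : IsTest Ω φ) (e : E N)
    (u : L2 Ω) : Integrable (fun x => u x * fderiv ℝ φ x e) (volume.restrict Ω) :=
  (Lp.memLp u).integrable_mul (h.memLp_fderiv e)

lemma integrable_right {N : ℕ} {Ω : Set (E N)} {φ : E N → ℝ} (h : IsTest Ω φ) (e : E N)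
    (G : L2Vec Ω) : Integrable (fun x => inner ℝ (G x) e * φ x) (volume.restrict Ω) :=
  ((Lp.memLp G).inner_const e).integrable_mul h.memLp

/-- `W^{1,2}(Ω)`, as the space of pairs `(u, ∇u)` in `L²(Ω) × L²(Ω, ℝ^N)` with `∇u` the weak
gradient of `u`. The inherited norm is `(‖u‖² + ‖∇u‖²)^{1/2}`. -/
def W12 {N : ℕ} (Ω : Set (E N)) : Submodule ℝ (WithLp 2 (L2 Ω × L2Vec Ω)) where
  carrier := {p | IsWeakGradient Ω p.fst p.snd}
  zero_mem' := by
    intro φ hφ e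
    have h1 : (fun x => ((0 : L2 Ω) : E N → ℝ) x * fderiv ℝ φ x e) =ᵐ[volume.restrict Ω] 0 := by
      filter_upwards [Lp.coeFn_zero ℝ 2 (volume.restrict Ω)] with x hx
      rw [hx]; simp
    have h2 : (fun x => inner ℝ (((0 : L2Vec Ω) : E N → E N) x) e * φ x)
        =ᵐ[volume.restrict Ω] 0 := by
      filter_upwards [Lp.coeFn_zero (E N) 2 (volume.restrict Ω)] with x hx
      rw [hx]; simp
    simp only [WithLp.zero_fst, WithLp.zero_snd]
    rw [integral_congr_ae h1, integral_congr_ae h2]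
    simp
  add_mem' := by
    intro p q hp hq φ hφ e
    have h1 : (fun x => ((p.fst + q.fst : L2 Ω) : E N → ℝ) x * fderiv ℝ φ x e)
        =ᵐ[volume.restrict Ω]
        fun x => p.fst x * fderiv ℝ φ x e + q.fst x * fderiv ℝ φ x e := by
      filter_upwards [Lp.coeFn_add p.fst q.fst] with x hx
      rw [hx, Pi.add_apply, add_mul]
    have h2 : (fun x => inner ℝ (((p.snd + q.snd : L2Vec Ω) : E N → E N) x) e * φ x)
        =ᵐ[volume.restrict Ω]
        fun x => inner ℝ (p.snd x) e * φ x + inner ℝ (q.snd x) e * φ x := by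
      filter_upwards [Lp.coeFn_add p.snd q.snd] with x hx
      rw [hx, Pi.add_apply, inner_add_left, add_mul]
    simp only [WithLp.add_fst, WithLp.add_snd]
    rw [integral_congr_ae h1, integral_congr_ae h2,
      integral_add (integrable_left hφ e _) (integrable_left hφ e _),
      integral_add (integrable_right hφ e _) (integrable_right hφ e _),
      hp φ hφ e, hq φ hφ e]
    ring
  smul_mem' := by
    intro c p hp φ hφ e
    have h1 : (fun x => ((c • p.fst : L2 Ω) : E N → ℝ) x * fderiv ℝ φ x e)
        =ᵐ[volume.restrict Ω] fun x => c * (p.fst x * fderiv ℝ φ x e) := by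
      filter_upwards [Lp.coeFn_smul c p.fst] with x hx
      rw [hx, Pi.smul_apply, smul_eq_mul, mul_assoc]
    have h2 : (fun x => inner ℝ (((c • p.snd : L2Vec Ω) : E N → E N) x) e * φ x)
        =ᵐ[volume.restrict Ω] fun x => c * (inner ℝ (p.snd x) e * φ x) := by
      filter_upwards [Lp.coeFn_smul c p.snd] with x hx
      rw [hx, Pi.smul_apply, real_inner_smul_left, mul_assoc]
    simp only [WithLp.smul_fst, WithLp.smul_snd]
    rw [integral_congr_ae h1, integral_congr_ae h2, integral_const_mul, integral_const_mul,
      hp φ hφ e]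
    ring

/-- The underlying `L²` function of an element of `W^{1,2}(Ω)`. -/
def fn {N : ℕ} {Ω : Set (E N)} (u : W12 Ω) : L2 Ω := (u : WithLp 2 (L2 Ω × L2Vec Ω)).fst

/-- The weak gradient of an element of `W^{1,2}(Ω)`. -/
def grad {N : ℕ} {Ω : Set (E N)} (u : W12 Ω) : L2Vec Ω :=
  (u : WithLp 2 (L2 Ω × L2Vec Ω)).snd

/-- The elements of `W^{1,2}(Ω)` given by test functions. -/
def testSubmodule {N : ℕ} (Ω : Set (E N)) : Submodule ℝ (W12 Ω) where
  carrier := {u | ∃ φ, IsTest Ω φ ∧ fn u =ᵐ[volume.restrict Ω] φ}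
  zero_mem' := by
    refine ⟨0, ⟨contDiff_const, HasCompactSupport.zero, by simp [tsupport]⟩, ?_⟩
    exact Lp.coeFn_zero ℝ 2 (volume.restrict Ω)
  add_mem' := by
    rintro u v ⟨φ, hφ, hu⟩ ⟨ψ, hψ, hv⟩
    refine ⟨φ + ψ, ⟨hφ.smooth.add hψ.smooth, hφ.compact.add hψ.compact,
      (tsupport_add φ ψ).trans (Set.union_subset hφ.subset hψ.subset)⟩, ?_⟩
    exact (Lp.coeFn_add (fn u) (fn v)).trans (hu.add hv)
  smul_mem' := by
    rintro c u ⟨φ, hφ, hu⟩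
    refine ⟨fun x => c * φ x, ⟨contDiff_const.mul hφ.smooth, hφ.compact.mul_left,
      (closure_mono (Function.support_mul_subset_right _ _)).trans hφ.subset⟩, ?_⟩
    filter_upwards [Lp.coeFn_smul c (fn u), hu] with x h1 h2
    have h3 : (fn (c • u) : E N → ℝ) x = (c • (fn u) : L2 Ω) x := rfl
    rw [h3, h1]
    simp [h2]

/-- `W^{1,2}_0(Ω)`: the closure of the test functions in `W^{1,2}(Ω)`. -/
def W012 {N : ℕ} (Ω : Set (E N)) : Submodule ℝ (W12 Ω) := (testSubmodule Ω).topologicalClosure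

/-! ### The boundary spaces -/

/-- The surface measure on `∂Ω`: the `(N-1)`-dimensional Hausdorff measure, normalised so that it
is Lebesgue measure on hyperplanes. -/
def surf {N : ℕ} (Ω : Set (E N)) : Measure (E N) :=
  (Measure.euclideanHausdorffMeasure (N - 1)).restrict (frontier Ω)

/-- `L²(∂Ω)`. -/
abbrev L2Bd {N : ℕ} (Ω : Set (E N)) := Lp ℝ 2 (surf Ω)

/-- `T` is the trace operator `W^{1,2}(Ω) → L²(∂Ω)`: it is linear and bounded and restricts to
`∂Ω` every function that is smooth up to the boundary. -/
def IsTraceOperator {N : ℕ} (Ω : Set (E N)) (T : W12 Ω →L[ℝ] L2Bd Ω) : Prop :=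
  ∀ φ : E N → ℝ, ContDiff ℝ ∞ φ → ∀ u : W12 Ω, fn u =ᵐ[volume.restrict Ω] φ →
    T u =ᵐ[surf Ω] φ

open Classical in
/-- The trace operator (and `0` for a set on which there is none). -/
def trace {N : ℕ} (Ω : Set (E N)) : W12 Ω →L[ℝ] L2Bd Ω :=
  if h : ∃ T, IsTraceOperator Ω T then h.choose else 0

/-- `L²_*(∂Ω)`: the functions in `L²(∂Ω)` with zero mean. -/
def L2Star {N : ℕ} (Ω : Set (E N)) : Submodule ℝ (L2Bd Ω) where
  carrier := {g | Integrable g (surf Ω) ∧ ∫ x, g x ∂(surf Ω) = 0}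
  zero_mem' := by
    have h := Lp.coeFn_zero ℝ 2 (surf Ω)
    refine ⟨(integrable_zero _ _ _).congr h.symm, ?_⟩
    rw [integral_congr_ae h]
    simp
  add_mem' := by
    rintro f g ⟨hf, hf0⟩ ⟨hg, hg0⟩
    have h := Lp.coeFn_add f g
    refine ⟨(hf.add hg).congr h.symm, ?_⟩
    rw [integral_congr_ae h]
    simp only [Pi.add_apply]
    rw [integral_add hf hg, hf0, hg0, add_zero]
  smul_mem' := by
    rintro c f ⟨hf, hf0⟩
    have h := Lp.coeFn_smul c f
    refine ⟨(hf.smul c).congr h.symm, ?_⟩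
    rw [integral_congr_ae h]
    simp only [Pi.smul_apply]
    rw [integral_smul, hf0, smul_zero]

/-- `W^{1/2,2}(∂Ω)`, the space of traces of `W^{1,2}(Ω)` functions: two elements of `W^{1,2}(Ω)`
define the same element when they have the same trace, and the norm of a trace is the infimum of
the `W^{1,2}(Ω)` norms of the functions that have this trace. -/
def W12Bd {N : ℕ} (Ω : Set (E N)) := W12 Ω ⧸ (trace Ω).ker

instance {N : ℕ} (Ω : Set (E N)) : NormedAddCommGroup (W12Bd Ω) :=
  haveI : IsClosed ((trace Ω).ker : Set (W12 Ω)) := (trace Ω).isClosed_ker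
  Submodule.Quotient.normedAddCommGroup (trace Ω).ker

instance {N : ℕ} (Ω : Set (E N)) : NormedSpace ℝ (W12Bd Ω) :=
  Submodule.Quotient.normedSpace (trace Ω).ker ℝ

/-- The element `u|_{∂Ω}` of `W^{1/2,2}(∂Ω)`, for `u ∈ W^{1,2}(Ω)`. -/
def toBd {N : ℕ} {Ω : Set (E N)} (u : W12 Ω) : W12Bd Ω :=
  (Submodule.Quotient.mk u : W12 Ω ⧸ (trace Ω).ker)

/-- The inclusion `W^{1/2,2}(∂Ω) ⊆ L²(∂Ω)`. -/
def bdIncl {N : ℕ} (Ω : Set (E N)) : W12Bd Ω →L[ℝ] L2Bd Ω :=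
  (trace Ω).ker.liftQL (trace Ω) le_rfl

/-- `W^{1/2,2}_*(∂Ω)`: the elements of `W^{1/2,2}(∂Ω)` with zero mean. -/
def W12BdStar {N : ℕ} (Ω : Set (E N)) : Submodule ℝ (W12Bd Ω) :=
  (L2Star Ω).comap (bdIncl Ω).toLinearMap

/-- `W^{-1/2,2}(∂Ω)`: the dual of `W^{1/2,2}(∂Ω)`, with the dual norm. -/
def WmBd {N : ℕ} (Ω : Set (E N)) := StrongDual ℝ (W12Bd Ω)

instance {N : ℕ} (Ω : Set (E N)) : NormedAddCommGroup (WmBd Ω) :=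
  inferInstanceAs (NormedAddCommGroup (StrongDual ℝ (W12Bd Ω)))

instance {N : ℕ} (Ω : Set (E N)) : NormedSpace ℝ (WmBd Ω) :=
  inferInstanceAs (NormedSpace ℝ (StrongDual ℝ (W12Bd Ω)))

/-- The duality pairing `⟨l, h⟩` of `W^{-1/2,2}(∂Ω)` and `W^{1/2,2}(∂Ω)`. -/
def pairing {N : ℕ} {Ω : Set (E N)} (l : WmBd Ω) (h : W12Bd Ω) : ℝ :=
  (show StrongDual ℝ (W12Bd Ω) from l) h

/-- `W^{-1/2,2}_*(∂Ω)`: the elements of `W^{-1/2,2}(∂Ω)` that vanish on (the trace of) the constant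
function `1`. -/
def WmBdStar {N : ℕ} (Ω : Set (E N)) : Submodule ℝ (WmBd Ω) where
  carrier := {l | ∀ c : W12 Ω, fn c =ᵐ[volume.restrict Ω] (fun _ => (1 : ℝ)) →
    pairing l (toBd c) = 0}
  zero_mem' := by intro c _; rfl
  add_mem' := by
    intro l m hl hm c hc
    have h : pairing (l + m) (toBd c) = pairing l (toBd c) + pairing m (toBd c) := rfl
    rw [h, hl c hc, hm c hc, add_zero]
  smul_mem' := by
    intro a l hl c hc
    have h : pairing (a • l) (toBd c) = a * pairing l (toBd c) := rfl
    rw [h, hl c hc, mul_zero]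

lemma bdIncl_toBd {N : ℕ} {Ω : Set (E N)} (u : W12 Ω) : bdIncl Ω (toBd u) = trace Ω u := rfl

/-- The inclusion `L²_*(∂Ω) ⊆ W^{-1/2,2}_*(∂Ω)`: the function `g` acts by
`⟨g, h⟩ = ∫_{∂Ω} g h`. -/
def toDual {N : ℕ} {Ω : Set (E N)} (g : L2Star Ω) : WmBdStar Ω :=
  ⟨(show StrongDual ℝ (W12Bd Ω) from (innerSL ℝ (g : L2Bd Ω)).comp (bdIncl Ω)), by
    intro c hc
    have h0 : pairing (show StrongDual ℝ (W12Bd Ω) from (innerSL ℝ (g : L2Bd Ω)).comp (bdIncl Ω))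
        (toBd c) = inner ℝ (g : L2Bd Ω) (trace Ω c) := rfl
    rw [h0]
    by_cases h : ∃ T, IsTraceOperator Ω T
    · have ht : trace Ω = h.choose := by simp [trace, h]
      have h1 : trace Ω c =ᵐ[surf Ω] fun _ => (1 : ℝ) := by
        rw [ht]; exact h.choose_spec _ contDiff_const c hc
      have h2 : (fun x => inner ℝ ((g : L2Bd Ω) x) (trace Ω c x)) =ᵐ[surf Ω] (g : L2Bd Ω) := by
        filter_upwards [h1] with x hx
        simp [hx]
      rw [MeasureTheory.L2.inner_def, integral_congr_ae h2]
      exact g.2.2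
    · have ht : trace Ω = 0 := by simp [trace, h]
      simp [ht]⟩

/-! ### Boundary value problems and `H`-convergence -/

/-- The bilinear form `∫_Ω A ∇u · ∇ψ`. -/
def form {N : ℕ} {Ω : Set (E N)} (A : E N → Matrix (Fin N) (Fin N) ℝ) (u ψ : W12 Ω) : ℝ :=
  ∫ x in Ω, inner ℝ (act (A x) (grad u x)) (grad ψ x)

/-- `u` is a weak solution of `-div(A∇u) = F` in `Ω`, `u = φ` on `∂Ω`, where
`F ∈ (W^{1,2}(Ω))^*` and `φ ∈ W^{1,2}(Ω)`. -/
structure IsDirichletSol {N : ℕ} (Ω : Set (E N)) (A : E N → Matrix (Fin N) (Fin N) ℝ)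
    (F : StrongDual ℝ (W12 Ω)) (φ u : W12 Ω) : Prop where
  boundary : u - φ ∈ W012 Ω
  weak : ∀ ψ ∈ W012 Ω, form A u ψ = F ψ

/-- `v` is a weak solution of `div(A∇v) = 0` in `Ω`, `A∇v · ν = g` on `∂Ω`, `∫_{∂Ω} v = 0`, where
`g ∈ W^{-1/2,2}_*(∂Ω)`. -/
structure IsNeumannSol {N : ℕ} (Ω : Set (E N)) (A : E N → Matrix (Fin N) (Fin N) ℝ)
    (g : WmBdStar Ω) (v : W12 Ω) : Prop where
  mean_zero : trace Ω v ∈ L2Star Ω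
  weak : ∀ ψ : W12 Ω, form A v ψ = pairing (g : WmBd Ω) (toBd ψ)

/-- `A_n` `H`-converges to `A` in `Ω`: for every `F ∈ (W^{1,2}(Ω))^*` the solutions `u_n`, `u` of
the Dirichlet problems with source `F` and zero boundary values satisfy `u_n ⇀ u` weakly in
`W^{1,2}_0(Ω)` and `A_n ∇u_n ⇀ A ∇u` weakly in `L²(Ω, ℝ^N)`. -/
def HConverges {N : ℕ} (Ω : Set (E N)) (A : ℕ → E N → Matrix (Fin N) (Fin N) ℝ)
    (A' : E N → Matrix (Fin N) (Fin N) ℝ) : Prop :=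
  ∀ (F : StrongDual ℝ (W12 Ω)) (u : ℕ → W012 Ω) (u' : W012 Ω),
    (∀ n, IsDirichletSol Ω (A n) F 0 (u n)) → IsDirichletSol Ω A' F 0 u' →
      (∀ l : StrongDual ℝ (W012 Ω), Tendsto (fun n => l (u n)) atTop (𝓝 (l u'))) ∧
      ∀ H : L2Vec Ω,
        Tendsto (fun n => ∫ x in Ω, inner ℝ (act (A n x) (grad (u n : W12 Ω) x)) (H x)) atTop
          (𝓝 (∫ x in Ω, inner ℝ (act (A' x) (grad (u' : W12 Ω) x)) (H x)))

/-! ### The forward operators -/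

/-- `T` is the Neumann-to-Dirichlet map of `A` on `L²_*(∂Ω)`: a bounded linear operator with
`T g = v|_{∂Ω}`, where `v` solves the Neumann problem with datum `g`. -/
def IsNDMap {N : ℕ} (Ω : Set (E N)) (A : E N → Matrix (Fin N) (Fin N) ℝ)
    (T : L2Star Ω →L[ℝ] L2Star Ω) : Prop :=
  ∀ g : L2Star Ω, ∃ v : W12 Ω, IsNeumannSol Ω A (toDual g) v ∧ trace Ω v = T g

open Classical in
/-- The Neumann-to-Dirichlet map `N-D(A)` on `L²_*(∂Ω)` (and `0` if there is none). -/
def ND {N : ℕ} (Ω : Set (E N)) (A : E N → Matrix (Fin N) (Fin N) ℝ) :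
    L2Star Ω →L[ℝ] L2Star Ω :=
  if h : ∃ T, IsNDMap Ω A T then h.choose else 0

/-- `K` is the operator `KN₁(A)` on `L²_*(∂Ω)`, for the given `Λ = Λ̂_N`:
`K g = A^{1/2} (∇u - ∇v)`, where `u` solves `div(A∇u) = 0` in `Ω` with boundary values `Λ g`
and `v` solves the Neumann problem with datum `g`. -/
def IsKN1Map {N : ℕ} (Ω : Set (E N)) (Λ : WmBdStar Ω →L[ℝ] W12BdStar Ω)
    (A : E N → Matrix (Fin N) (Fin N) ℝ) (K : L2Star Ω →L[ℝ] L2Vec Ω) : Prop :=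
  ∀ g : L2Star Ω, ∃ φ u v : W12 Ω,
    toBd φ = (Λ (toDual g) : W12Bd Ω) ∧ IsDirichletSol Ω A 0 φ u ∧ IsNeumannSol Ω A (toDual g) v ∧
      K g =ᵐ[volume.restrict Ω] fun x => act (CFC.sqrt (A x)) (grad u x - grad v x)

open Classical in
/-- The operator `KN₁(A)` on `L²_*(∂Ω)` (and `0` if there is none). -/
def KN1 {N : ℕ} (Ω : Set (E N)) (Λ : WmBdStar Ω →L[ℝ] W12BdStar Ω)
    (A : E N → Matrix (Fin N) (Fin N) ℝ) : L2Star Ω →L[ℝ] L2Vec Ω :=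
  if h : ∃ K, IsKN1Map Ω Λ A K then h.choose else 0

end HConv

end

/-!
Convergence of Neumann-to-Dirichlet maps and of the functional `KN₁` under `H`-convergence.

**Fluxes.** Tensors act on `L²(Ω, ℝ^N)` as bounded coercive operators commuting with multiplication
by smooth functions (`IsTensorOp`). Let `w_n ⇀ w` in `W^{1,2}(Ω)` with `div(A_n ∇w_n) = 0` and no
condition at the boundary. Then `A_n ∇w_n ⇀ A ∇w` (`HLim.flux_tendsto`): for `z ∈ W^{1,2}_0(Ω)` let
`z_n ∈ W^{1,2}_0(Ω)` solve `div(A_n ∇z_n) = div(A ∇z)`; `H`-convergence says that `z_n ⇀ z` and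
`A_n ∇z_n ⇀ A ∇z`. The div-curl lemma (`div_curl`) passes to the limit in the localized monotonicity
inequality `0 ≤ ∫ ζ² A_n ∇(w_n - z_n) · ∇(w_n - z_n)`, and Minty's argument identifies the weak limit
of `A_n ∇w_n`. The same products, applied to two families of oscillating test functions, show that
the `H`-limit of symmetric tensors is symmetric (`isSymmTensor_limit`).

**Neumann-to-Dirichlet maps.** If `g_n ⇀ g` in `L²_*(∂Ω)`, then `v(A_n, g_n)` is bounded, its weak
limit has flux `A ∇v` and solves the limit problem, so `v(A_n, g_n) ⇀ v(A, g)` (`IsNeu.weakLim`). The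
trace operator is compact (`tendsto_tr`), so the traces converge strongly, and likewise those of
`v(A, g_n)`. Choosing unit data `g_n` that nearly attain `‖N-D(A_n) - N-D(A)‖` gives norm convergence
(`tendsto_ND`). Weakly convergent subsequences are replaced by limits along an ultrafilter.

**The functional `KN₁`.** For symmetric `A` and `u = u(A, 0, φ)`, where `φ` is a lift of `Λ g`,
`‖KN₁(A) g‖² = ∫ A ∇u · ∇φ - 2 ∫_{∂Ω} g φ + ∫_{∂Ω} g v` (`energy_eq`). The inclusion of `L²_*(∂Ω)` in
`W^{-1/2,2}_*(∂Ω)` is compact, so `φ_n → φ` strongly when `g_n ⇀ g`; each term is then a product of a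
weakly and a strongly convergent factor, and `‖KN₁(A_n) g_n‖ → ‖KN₁(A) g‖`
(`tendsto_norm_KN1_apply`). A fixed `g` gives the lower bound for the limit of the norms, nearly
maximizing `g_n` the upper bound.

**Function spaces.** The theory of `W^{1,2}(Ω)` on Lipschitz domains that this uses is developed from
the definitions. The uniform cone property gives density of smooth functions (`smooth_dense`), by
translating along the cone and mollifying, and Rellich's theorem (`rellich`), since translates of
Sobolev functions are controlled by the gradient. Integration along the vertical lines of graph
coordinates gives the trace inequality `t ∫_{∂Ω} φ² ≤ C (∫_Ω φ² + t² ∫_Ω |∇φ|²)` for all small `t`,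
hence the trace operator (`existsUnique_isTraceOperator`) and its compactness, and the converse
estimate of `∫ φ²` over a boundary strip of width `t` by `C (t ∫_{∂Ω} φ² + t² ∫_Ω |∇φ|²)`, hence that
functions with zero trace lie in `W^{1,2}_0(Ω)` (`mem_W0_of_tr_eq_zero`): their products with cut-off
functions of the distance to the boundary stay bounded. Thus the Dirichlet solution depends on its
datum through the trace only.
-/

noncomputable section

namespace HConv

/-! ### Weak convergence in Hilbert spaces -/

section Weak

variable {ι H K : Type*} [NormedAddCommGroup H] [InnerProductSpace ℝ H]
  [NormedAddCommGroup K] [InnerProductSpace ℝ K]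

/-- Weak convergence of `x` to `x'` along the filter `U`, tested with inner products. By the Riesz
theorem these are all the continuous functionals when the space is complete. -/
def WeakLim (U : Filter ι) (x : ι → H) (x' : H) : Prop :=
  ∀ y : H, Tendsto (fun i => inner ℝ (x i) y) U (𝓝 (inner ℝ x' y))

namespace WeakLim

lemma unique {U : Filter ι} [U.NeBot] {x : ι → H} {a b : H} (ha : WeakLim U x a)
    (hb : WeakLim U x b) : a = b :=
  ext_inner_right ℝ fun y => tendsto_nhds_unique (ha y) (hb y)

lemma of_tendsto {U : Filter ι} {x : ι → H} {a : H} (h : Tendsto x U (𝓝 a)) : WeakLim U x a :=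
  fun _ => h.inner tendsto_const_nhds

lemma const (U : Filter ι) (a : H) : WeakLim U (fun _ => a) a := fun _ => tendsto_const_nhds

lemma sub {U : Filter ι} {x y : ι → H} {a b : H} (ha : WeakLim U x a) (hb : WeakLim U y b) :
    WeakLim U (fun i => x i - y i) (a - b) := fun z => by
  simpa only [inner_sub_left] using (ha z).sub (hb z)

lemma mono {U V : Filter ι} {x : ι → H} {a : H} (h : V ≤ U) (ha : WeakLim U x a) :
    WeakLim V x a := fun y => (ha y).mono_left h

lemma clm [CompleteSpace H] {U : Filter ι} {x : ι → H} {a : H} (h : WeakLim U x a) (l : StrongDual ℝ H) :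
    Tendsto (fun i => l (x i)) U (𝓝 (l a)) := by
  have hl : ∀ z, l z = inner ℝ z ((InnerProductSpace.toDual ℝ H).symm l) := fun z => by
    rw [real_inner_comm, InnerProductSpace.toDual_symm_apply]
  simpa only [hl] using h _

lemma map [CompleteSpace H] {U : Filter ι} {x : ι → H} {a : H} (h : WeakLim U x a) (T : H →L[ℝ] K) :
    WeakLim U (fun i => T (x i)) (T a) := fun y => by
  have := h.clm ((innerSL ℝ y).comp T)
  simpa [real_inner_comm] using this

/-- Bounded families have weak limits along ultrafilters. -/
lemma exists_of_bounded [CompleteSpace H] (U : Ultrafilter ι) {x : ι → H} {M : ℝ} (hM : ∀ i, ‖x i‖ ≤ M) :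
    ∃ a, WeakLim (U : Filter ι) x a := by
  have hb : ∀ y i, |inner ℝ (x i) y| ≤ M * ‖y‖ := fun y i =>
    (abs_real_inner_le_norm _ _).trans (by gcongr; exact hM i)
  have hlim : ∀ y, ∃ c : ℝ, Tendsto (fun i => inner ℝ (x i) y) U (𝓝 c) := fun y => by
    obtain ⟨c, -, hc⟩ := (isCompact_Icc (a := -(M * ‖y‖)) (b := M * ‖y‖)).ultrafilter_le_nhds
      (U.map fun i => inner ℝ (x i) y)
      (by
        rw [Ultrafilter.coe_map, le_principal_iff, mem_map]
        exact univ_mem' fun i => abs_le.1 (hb y i))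
    exact ⟨c, hc⟩
  choose f hf using hlim
  let L : H →ₗ[ℝ] ℝ :=
    { toFun := f
      map_add' := fun y z => tendsto_nhds_unique (hf (y + z)) (by
        simpa only [inner_add_right] using (hf y).add (hf z))
      map_smul' := fun c y => tendsto_nhds_unique (hf (c • y)) (by
        simpa only [inner_smul_right, smul_eq_mul, RingHom.id_apply] using (hf y).const_mul c) }
  have hLb : ∀ y, ‖L y‖ ≤ M * ‖y‖ := fun y =>
    le_of_tendsto (hf y).norm (Eventually.of_forall (hb y))
  refine ⟨(InnerProductSpace.toDual ℝ H).symm (L.mkContinuous M hLb), fun y => ?_⟩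
  rw [InnerProductSpace.toDual_symm_apply]
  exact hf y

lemma norm_le {U : Filter ι} [U.NeBot] {x : ι → H} {a : H} (h : WeakLim U x a) {M : ℝ}
    (hM0 : 0 ≤ M) (hM : ∀ i, ‖x i‖ ≤ M) : ‖a‖ ≤ M := by
  have h1 : inner ℝ a a ≤ M * ‖a‖ := le_of_tendsto (h a) (Eventually.of_forall fun i =>
    (real_inner_le_norm _ _).trans (by gcongr; exact hM i))
  rw [real_inner_self_eq_norm_mul_norm] at h1
  by_contra! hlt
  nlinarith

lemma inner_tendsto {U : Filter ι} {x y : ι → H} {a b : H} (h : WeakLim U x a) {M : ℝ}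
    (hM : ∀ i, ‖x i‖ ≤ M) (hy : Tendsto y U (𝓝 b)) :
    Tendsto (fun i => inner ℝ (x i) (y i)) U (𝓝 (inner ℝ a b)) := by
  have h0 : Tendsto (fun i => inner ℝ (x i) (y i - b)) U (𝓝 0) := by
    have h1 : Tendsto (fun i => M * ‖y i - b‖) U (𝓝 0) := by
      simpa using ((hy.sub_const b).norm).const_mul M
    refine squeeze_zero_norm (fun i => ?_) h1
    exact (abs_real_inner_le_norm _ _).trans (by gcongr; exact hM i)
  simpa [inner_sub_right] using h0.add (h b)

lemma mem_closed [CompleteSpace H] {U : Filter ι} [U.NeBot] {x : ι → H} {a : H} (h : WeakLim U x a)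
    {S : Submodule ℝ H} (hS : IsClosed (S : Set H)) (hx : ∀ i, x i ∈ S) : a ∈ S := by
  have : CompleteSpace S := hS.completeSpace_coe
  rw [← Submodule.orthogonal_orthogonal S]
  intro y hy
  have h1 := h y
  have h2 : (fun i => inner ℝ (x i) y) = fun _ => (0 : ℝ) := by
    funext i
    exact (Submodule.mem_orthogonal S y).1 hy _ (hx i)
  rw [h2] at h1
  rw [real_inner_comm]
  exact (tendsto_nhds_unique tendsto_const_nhds h1).symm

end WeakLim

end Weak

/-! ### Multiplication operators on `L²` and conductivity tensors -/

section MulOp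

variable {X F G : Type*} [MeasurableSpace X] {μ : Measure X}
  [NormedAddCommGroup F] [NormedSpace ℝ F] [NormedAddCommGroup G] [NormedSpace ℝ G]

/-- A measurable, essentially bounded field of operators. -/
structure IsBddField (μ : Measure X) (T : X → F →L[ℝ] G) (C : ℝ) : Prop where
  meas : AEStronglyMeasurable T μ
  bdd : ∀ᵐ x ∂μ, ‖T x‖ ≤ C

lemma IsBddField.memLp {T : X → F →L[ℝ] G} {C : ℝ} (h : IsBddField μ T C) (f : Lp F 2 μ) :
    MemLp (fun x => T x (f x)) 2 μ := by
  refine (Lp.memLp f).of_le_mul (c := C) ?_ ?_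
  · exact (ContinuousLinearMap.id ℝ (F →L[ℝ] G)).aestronglyMeasurable_comp₂ h.meas
      (Lp.aestronglyMeasurable f)
  · filter_upwards [h.bdd] with x hx
    exact (T x).le_of_opNorm_le hx _

open Classical in
/-- Pointwise application of a bounded field of operators, as an operator on `L²` (and `0` if the
field is not measurable and bounded). -/
def mulOp (μ : Measure X) (T : X → F →L[ℝ] G) : Lp F 2 μ →L[ℝ] Lp G 2 μ :=
  if h : ∃ C, IsBddField μ T C then
    LinearMap.mkContinuous
      { toFun := fun f => (h.choose_spec.memLp f).toLp _
        map_add' := fun f g => by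
          rw [← MemLp.toLp_add]
          refine MemLp.toLp_congr _ _ ?_
          filter_upwards [Lp.coeFn_add f g] with x hx
          rw [hx, Pi.add_apply, map_add, Pi.add_apply]
        map_smul' := fun c f => by
          rw [RingHom.id_apply, ← MemLp.toLp_const_smul]
          refine MemLp.toLp_congr _ _ ?_
          filter_upwards [Lp.coeFn_smul c f] with x hx
          rw [hx, Pi.smul_apply, map_smul, Pi.smul_apply] }
      h.choose
      (fun f => by
        refine Lp.norm_le_mul_norm_of_ae_le_mul ?_
        filter_upwards [(h.choose_spec.memLp f).coeFn_toLp, h.choose_spec.bdd] with x h1 h2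
        exact h1 ▸ (T x).le_of_opNorm_le h2 _)
  else 0

lemma IsBddField.coeFn {T : X → F →L[ℝ] G} {C : ℝ} (h : IsBddField μ T C) (f : Lp F 2 μ) :
    mulOp μ T f =ᵐ[μ] fun x => T x (f x) := by
  have h' : ∃ C, IsBddField μ T C := ⟨C, h⟩
  have : mulOp μ T f = (h'.choose_spec.memLp f).toLp _ := by
    simp only [mulOp, dif_pos h']; rfl
  rw [this]
  exact MemLp.coeFn_toLp _

lemma IsBddField.norm_le {T : X → F →L[ℝ] G} {C : ℝ} (h : IsBddField μ T C) (f : Lp F 2 μ) :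
    ‖mulOp μ T f‖ ≤ C * ‖f‖ := by
  refine Lp.norm_le_mul_norm_of_ae_le_mul ?_
  filter_upwards [h.coeFn f, h.bdd] with x h1 h2
  exact h1 ▸ (T x).le_of_opNorm_le h2 _

end MulOp

section Tensor

variable {N : ℕ} {Ω : Set (E N)} {α β : ℝ} {A : E N → Matrix (Fin N) (Fin N) ℝ}

/-- The action of a matrix as a continuous linear map. -/
def actC (M : Matrix (Fin N) (Fin N) ℝ) : E N →L[ℝ] E N := Matrix.toEuclideanCLM (𝕜 := ℝ) M

lemma actC_apply (M : Matrix (Fin N) (Fin N) ℝ) (ξ : E N) : actC M ξ = act M ξ := rfl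

lemma act_mul (M M' : Matrix (Fin N) (Fin N) ℝ) (ξ : E N) :
    act (M * M') ξ = act M (act M' ξ) := by
  rw [← actC_apply, ← actC_apply, ← actC_apply, actC, map_mul]; rfl

lemma act_one (ξ : E N) : act (1 : Matrix (Fin N) (Fin N) ℝ) ξ = ξ := by
  rw [← actC_apply, actC, map_one]; rfl

lemma inner_act_left (M : Matrix (Fin N) (Fin N) ℝ) (ξ η : E N) :
    inner ℝ (act M ξ) η = inner ℝ ξ (act M.transpose η) := by
  have : act M.transpose η = ContinuousLinearMap.adjoint (actC M) η := by
    rw [← ContinuousLinearMap.star_eq_adjoint, actC, ← map_star]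
    rfl
  rw [this, ContinuousLinearMap.adjoint_inner_right]; rfl

lemma continuous_actC : Continuous (actC : Matrix (Fin N) (Fin N) ℝ → E N →L[ℝ] E N) := by
  have h : (actC : Matrix (Fin N) (Fin N) ℝ → E N →L[ℝ] E N) =
    ((Matrix.toEuclideanCLM (𝕜 := ℝ) (n := Fin N)).toAlgEquiv.toLinearEquiv.toLinearMap) := rfl
  rw [h]
  exact LinearMap.continuous_of_finiteDimensional _

lemma isUnit_of_elliptic {M : Matrix (Fin N) (Fin N) ℝ} (hα : 0 < α)
    (h : ∀ ξ : E N, α * ‖ξ‖ ^ 2 ≤ inner ℝ (act M ξ) ξ) : IsUnit M := by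
  rw [← Matrix.mulVec_injective_iff_isUnit]
  intro v w hvw
  have h1 : act M (WithLp.toLp 2 (v - w)) = 0 := by
    rw [act, Matrix.toLpLin_apply]
    change M.mulVec v = M.mulVec w at hvw
    simp [Matrix.mulVec_sub, hvw]
  have h2 := h (WithLp.toLp 2 (v - w))
  rw [h1, inner_zero_left] at h2
  have h3 : ‖(WithLp.toLp 2 (v - w) : E N)‖ ^ 2 ≤ 0 := by
    by_contra! hc
    nlinarith
  have h4 : (WithLp.toLp 2 (v - w) : E N) = 0 := by
    rw [← norm_eq_zero]
    exact pow_eq_zero_iff (two_ne_zero) |>.1 (le_antisymm h3 (sq_nonneg _))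
  have h5 : v - w = 0 := congrArg WithLp.ofLp h4
  exact sub_eq_zero.1 h5

/-- The bound on the inverse tensor bounds the tensor itself. -/
lemma norm_act_le {M : Matrix (Fin N) (Fin N) ℝ} (hα : 0 < α) (hβ : 0 < β)
    (h1 : ∀ ξ : E N, α * ‖ξ‖ ^ 2 ≤ inner ℝ (act M ξ) ξ)
    (h2 : ∀ ξ : E N, β⁻¹ * ‖ξ‖ ^ 2 ≤ inner ℝ (act M⁻¹ ξ) ξ) (ξ : E N) :
    ‖act M ξ‖ ≤ β * ‖ξ‖ := by
  have hu := isUnit_of_elliptic hα h1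
  have h3 := h2 (act M ξ)
  rw [← act_mul, Matrix.nonsing_inv_mul M ((Matrix.isUnit_iff_isUnit_det M).1 hu), act_one] at h3
  have h4 := h3.trans (real_inner_le_norm _ _)
  rcases (norm_nonneg (act M ξ)).eq_or_lt with h | h
  · rw [← h]; positivity
  · have h5 : β⁻¹ * ‖act M ξ‖ ≤ ‖ξ‖ := by
      refine le_of_mul_le_mul_right ?_ h
      linarith
    rwa [inv_mul_le_iff₀ hβ] at h5

lemma MemTilde.aestronglyMeasurable (hA : MemTilde Ω α β A) :
    AEStronglyMeasurable A (volume.restrict Ω) := by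
  have h : AEMeasurable (β := Fin N → Fin N → ℝ) A (volume.restrict Ω) :=
    aemeasurable_pi_iff.2 fun i => aemeasurable_pi_iff.2 fun j => hA.aemeasurable i j
  exact h.aestronglyMeasurable

lemma MemTilde.isBddField (hA : MemTilde Ω α β A) (hα : 0 < α) (hαβ : α ≤ β) :
    IsBddField (volume.restrict Ω) (fun x => actC (A x)) β where
  meas := continuous_actC.comp_aestronglyMeasurable hA.aestronglyMeasurable
  bdd := by
    filter_upwards [hA.elliptic, hA.elliptic_inv] with x h1 h2
    exact ContinuousLinearMap.opNorm_le_bound _ (hα.le.trans hαβ)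
      (norm_act_le hα (hα.trans_le hαβ) h1 h2)

/-- Application of the tensor `A` to vector fields in `L²`. -/
def tens (Ω : Set (E N)) (A : E N → Matrix (Fin N) (Fin N) ℝ) : L2Vec Ω →L[ℝ] L2Vec Ω :=
  mulOp (volume.restrict Ω) (fun x => actC (A x))

lemma MemTilde.tens_coeFn (hA : MemTilde Ω α β A) (hα : 0 < α) (hαβ : α ≤ β) (G : L2Vec Ω) :
    tens Ω A G =ᵐ[volume.restrict Ω] fun x => act (A x) (G x) :=
  (hA.isBddField hα hαβ).coeFn G

lemma MemTilde.norm_tens_le (hA : MemTilde Ω α β A) (hα : 0 < α) (hαβ : α ≤ β) (G : L2Vec Ω) :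
    ‖tens Ω A G‖ ≤ β * ‖G‖ :=
  (hA.isBddField hα hαβ).norm_le G

lemma MemTilde.integral_eq (hA : MemTilde Ω α β A) (hα : 0 < α) (hαβ : α ≤ β) (G H : L2Vec Ω) :
    ∫ x in Ω, inner ℝ (act (A x) (G x)) (H x) = inner ℝ (tens Ω A G) H := by
  rw [MeasureTheory.L2.inner_def]
  refine integral_congr_ae ?_
  filter_upwards [hA.tens_coeFn hα hαβ G] with x hx
  rw [hx]

lemma MemTilde.form_eq (hA : MemTilde Ω α β A) (hα : 0 < α) (hαβ : α ≤ β) (u ψ : W12 Ω) :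
    form A u ψ = inner ℝ (tens Ω A (grad u)) (grad ψ) :=
  hA.integral_eq hα hαβ _ _

lemma MemTilde.tens_coercive (hA : MemTilde Ω α β A) (hα : 0 < α) (hαβ : α ≤ β) (G : L2Vec Ω) :
    α * ‖G‖ ^ 2 ≤ inner ℝ (tens Ω A G) G := by
  rw [← real_inner_self_eq_norm_sq, MeasureTheory.L2.inner_def, MeasureTheory.L2.inner_def,
    ← integral_const_mul]
  refine integral_mono_ae ((L2.integrable_inner G G).const_mul α) (L2.integrable_inner _ _) ?_
  filter_upwards [hA.tens_coeFn hα hαβ G, hA.elliptic] with x h1 h2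
  simp only [h1]
  rw [real_inner_self_eq_norm_sq]
  exact h2 _

lemma MemTilde.tens_symm (hA : MemTilde Ω α β A) (hα : 0 < α) (hαβ : α ≤ β)
    (hs : IsSymmTensor Ω A) (G H : L2Vec Ω) :
    inner ℝ (tens Ω A G) H = inner ℝ G (tens Ω A H) := by
  rw [MeasureTheory.L2.inner_def, MeasureTheory.L2.inner_def]
  refine integral_congr_ae ?_
  filter_upwards [hA.tens_coeFn hα hαβ G, hA.tens_coeFn hα hαβ H, hs] with x h1 h2 h3
  rw [h1, h2, inner_act_left, h3.eq]

/-! ### The square root of a symmetric tensor -/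

lemma nonneg_of_elliptic {M : Matrix (Fin N) (Fin N) ℝ} (hα : 0 < α) (hs : M.IsSymm)
    (h1 : ∀ ξ : E N, α * ‖ξ‖ ^ 2 ≤ inner ℝ (act M ξ) ξ) : 0 ≤ M := by
  rw [Matrix.nonneg_iff_posSemidef]
  refine Matrix.PosSemidef.of_dotProduct_mulVec_nonneg ?_ fun v => ?_
  · rw [Matrix.IsHermitian, Matrix.conjTranspose_eq_transpose_of_trivial, hs.eq]
  · have h := h1 (WithLp.toLp 2 v)
    have h2 : inner ℝ (act M (WithLp.toLp 2 v)) (WithLp.toLp 2 v) = star v ⬝ᵥ M.mulVec v := by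
      rw [act, Matrix.toLpLin_apply, EuclideanSpace.inner_toLp_toLp]
      simp
    rw [← h2]
    exact le_trans (by positivity) h

lemma sqrt_isSymm (M : Matrix (Fin N) (Fin N) ℝ) : (CFC.sqrt M).transpose = CFC.sqrt M := by
  have h := (Matrix.nonneg_iff_posSemidef.1 (CFC.sqrt_nonneg M)).1
  rwa [Matrix.IsHermitian, Matrix.conjTranspose_eq_transpose_of_trivial] at h

lemma inner_act_sqrt {M : Matrix (Fin N) (Fin N) ℝ} (hM : 0 ≤ M) (ξ : E N) :
    ‖act (CFC.sqrt M) ξ‖ ^ 2 = inner ℝ (act M ξ) ξ := by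
  rw [← real_inner_self_eq_norm_sq, inner_act_left, sqrt_isSymm, ← act_mul,
    CFC.sqrt_mul_sqrt_self M hM, real_inner_comm]

open scoped Matrix.Norms.L2Operator in
lemma continuousOn_matrix_sqrt :
    ContinuousOn (CFC.sqrt : Matrix (Fin N) (Fin N) ℝ → Matrix (Fin N) (Fin N) ℝ) {M | 0 ≤ M} :=
  CFC.continuousOn_sqrt

lemma isClosed_nonneg_matrix : IsClosed {M : Matrix (Fin N) (Fin N) ℝ | 0 ≤ M} := by
  have h : {M : Matrix (Fin N) (Fin N) ℝ | 0 ≤ M} =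
      {M | M.transpose = M} ∩ ⋂ v : Fin N → ℝ, {M | 0 ≤ v ⬝ᵥ M.mulVec v} := by
    ext M
    simp only [Set.mem_ofPred_eq, Matrix.nonneg_iff_posSemidef, Set.mem_inter_iff, Set.mem_iInter]
    constructor
    · intro h
      refine ⟨by simpa [Matrix.IsHermitian, Matrix.conjTranspose_eq_transpose_of_trivial] using h.1,
        fun v => by simpa using h.dotProduct_mulVec_nonneg v⟩
    · rintro ⟨h1, h2⟩
      refine Matrix.PosSemidef.of_dotProduct_mulVec_nonneg ?_ fun v => by simpa using h2 v
      rw [Matrix.IsHermitian, Matrix.conjTranspose_eq_transpose_of_trivial, h1]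
  rw [h]
  refine (isClosed_eq (by fun_prop) continuous_id).inter (isClosed_iInter fun v => ?_)
  exact isClosed_le continuous_const (by fun_prop)

/-- The field `A^{1/2}` is measurable, because the square root is continuous on the closed set of
positive semidefinite matrices, and it is bounded by `β^{1/2}`. -/
lemma MemTilde.sqrt_isBddField (hA : MemTilde Ω α β A) (hα : 0 < α) (hαβ : α ≤ β)
    (hs : IsSymmTensor Ω A) :
    IsBddField (volume.restrict Ω) (fun x => actC (CFC.sqrt (A x))) (Real.sqrt β) where
  meas := by
    let _ : MeasurableSpace (Matrix (Fin N) (Fin N) ℝ) := borel _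
    have : TopologicalSpace.PseudoMetrizableSpace (Matrix (Fin N) (Fin N) ℝ) :=
      inferInstanceAs (TopologicalSpace.PseudoMetrizableSpace (Fin N → Fin N → ℝ))
    have : BorelSpace (Matrix (Fin N) (Fin N) ℝ) := ⟨rfl⟩
    have h : AEMeasurable A (volume.restrict Ω) := hA.aestronglyMeasurable.aemeasurable
    classical
    have hm : Measurable (Set.piecewise {M : Matrix (Fin N) (Fin N) ℝ | 0 ≤ M}
        (CFC.sqrt : Matrix (Fin N) (Fin N) ℝ → Matrix (Fin N) (Fin N) ℝ) (fun _ => 0)) := by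
      refine ContinuousOn.measurable_piecewise continuousOn_matrix_sqrt continuousOn_const
        isClosed_nonneg_matrix.measurableSet
    have h2 : AEMeasurable (fun x => CFC.sqrt (A x)) (volume.restrict Ω) := by
      refine (hm.comp_aemeasurable h).congr ?_
      filter_upwards [hs, hA.elliptic] with x h1 h2
      exact Set.piecewise_eq_of_mem _ _ _ (nonneg_of_elliptic hα h1 h2)
    have : SecondCountableTopology (Matrix (Fin N) (Fin N) ℝ) :=
      inferInstanceAs (SecondCountableTopology (Fin N → Fin N → ℝ))
    exact continuous_actC.comp_aestronglyMeasurable h2.aestronglyMeasurable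
  bdd := by
    filter_upwards [hA.elliptic, hA.elliptic_inv, hs] with x h1 h2 h3
    refine ContinuousLinearMap.opNorm_le_bound _ (Real.sqrt_nonneg _) fun ξ => ?_
    rw [actC_apply]
    refine abs_le_of_sq_le_sq' ?_ (by positivity) |>.2
    rw [inner_act_sqrt (nonneg_of_elliptic hα h3 h1), mul_pow,
      Real.sq_sqrt (hα.le.trans hαβ)]
    refine (real_inner_le_norm _ _).trans ?_
    have := norm_act_le hα (hα.trans_le hαβ) h1 h2 ξ
    nlinarith [norm_nonneg ξ]

/-- Application of `A^{1/2}` to vector fields in `L²`. -/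
def sqrtTens (Ω : Set (E N)) (A : E N → Matrix (Fin N) (Fin N) ℝ) : L2Vec Ω →L[ℝ] L2Vec Ω :=
  mulOp (volume.restrict Ω) (fun x => actC (CFC.sqrt (A x)))

lemma MemTilde.sqrtTens_coeFn (hA : MemTilde Ω α β A) (hα : 0 < α) (hαβ : α ≤ β)
    (hs : IsSymmTensor Ω A) (G : L2Vec Ω) :
    sqrtTens Ω A G =ᵐ[volume.restrict Ω] fun x => act (CFC.sqrt (A x)) (G x) :=
  (hA.sqrt_isBddField hα hαβ hs).coeFn G

lemma MemTilde.norm_sqrtTens_sq (hA : MemTilde Ω α β A) (hα : 0 < α) (hαβ : α ≤ β)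
    (hs : IsSymmTensor Ω A) (G : L2Vec Ω) :
    ‖sqrtTens Ω A G‖ ^ 2 = inner ℝ (tens Ω A G) G := by
  rw [← real_inner_self_eq_norm_sq, MeasureTheory.L2.inner_def, MeasureTheory.L2.inner_def]
  refine integral_congr_ae ?_
  filter_upwards [hA.tens_coeFn hα hαβ G, hA.sqrtTens_coeFn hα hαβ hs G, hs, hA.elliptic]
    with x h1 h2 h3 h4
  rw [h1, h2, real_inner_self_eq_norm_sq, inner_act_sqrt (nonneg_of_elliptic hα h3 h4)]

end Tensor

/-! ### Basic properties of `W^{1,2}(Ω)` -/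

section Sobolev

variable {N : ℕ} {Ω : Set (E N)}

lemma integral_mul_eq_inner {μ : Measure (E N)} (u : Lp ℝ 2 μ) {f : E N → ℝ} (hf : MemLp f 2 μ) :
    ∫ x, u x * f x ∂μ = inner ℝ (hf.toLp f) u := by
  rw [MeasureTheory.L2.inner_def]
  refine integral_congr_ae ?_
  filter_upwards [hf.coeFn_toLp] with x hx
  rw [hx]; rfl

lemma IsTest.memLp_smul {φ : E N → ℝ} (h : IsTest Ω φ) (e : E N) :
    MemLp (fun x => φ x • e) 2 (volume.restrict Ω) :=
  (h.memLp.norm.of_le_mul (c := ‖e‖) (h.memLp.aestronglyMeasurable.smul_const e)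
    (Eventually.of_forall fun x => by simp [norm_smul, mul_comm]))

lemma integral_inner_mul_eq_inner (G : L2Vec Ω) {φ : E N → ℝ} (hφ : IsTest Ω φ) (e : E N) :
    ∫ x in Ω, inner ℝ (G x) e * φ x = inner ℝ ((hφ.memLp_smul e).toLp _) G := by
  rw [MeasureTheory.L2.inner_def]
  refine integral_congr_ae ?_
  filter_upwards [(hφ.memLp_smul e).coeFn_toLp] with x hx
  rw [hx, real_inner_smul_left, real_inner_comm, mul_comm]

lemma isClosed_W12 : IsClosed (W12 Ω : Set (WithLp 2 (L2 Ω × L2Vec Ω))) := by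
  have h : (W12 Ω : Set (WithLp 2 (L2 Ω × L2Vec Ω))) =
      ⋂ (φ : E N → ℝ) (hφ : IsTest Ω φ) (e : E N),
        {p | inner ℝ ((hφ.memLp_fderiv e).toLp _) p.fst
          = - inner ℝ ((hφ.memLp_smul e).toLp _) p.snd} := by
    ext p
    simp only [Set.mem_iInter, Set.mem_ofPred_eq, SetLike.mem_coe]
    refine forall_congr' fun φ => forall_congr' fun hφ => forall_congr' fun e => ?_
    rw [integral_mul_eq_inner, integral_inner_mul_eq_inner _ hφ]
  rw [h]
  refine isClosed_iInter fun φ => isClosed_iInter fun hφ => isClosed_iInter fun e => ?_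
  have h1 : Continuous fun p : WithLp 2 (L2 Ω × L2Vec Ω) => p.fst :=
    (ContinuousLinearMap.fst ℝ _ _).continuous.comp
      (WithLp.prodContinuousLinearEquiv 2 ℝ (L2 Ω) (L2Vec Ω)).continuous
  have h2 : Continuous fun p : WithLp 2 (L2 Ω × L2Vec Ω) => p.snd :=
    (ContinuousLinearMap.snd ℝ _ _).continuous.comp
      (WithLp.prodContinuousLinearEquiv 2 ℝ (L2 Ω) (L2Vec Ω)).continuous
  exact isClosed_eq (continuous_const.inner h1) (continuous_const.inner h2).neg

instance : CompleteSpace (W12 Ω) := isClosed_W12.completeSpace_coe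

/-- The Hilbert space `W^{1,2}(Ω)`, as a type synonym that hides its construction as a subspace of
a product of `L²` spaces: elaboration then never has to look into that construction. -/
def WS (Ω : Set (E N)) : Type := W12 Ω

instance : NormedAddCommGroup (WS Ω) := inferInstanceAs (NormedAddCommGroup (W12 Ω))
instance : InnerProductSpace ℝ (WS Ω) := inferInstanceAs (InnerProductSpace ℝ (W12 Ω))
instance : CompleteSpace (WS Ω) := inferInstanceAs (CompleteSpace (W12 Ω))

/-- The identity map between the two copies of `W^{1,2}(Ω)`. -/
def eqv (Ω : Set (E N)) : WS Ω ≃ₗᵢ[ℝ] W12 Ω where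
  toFun u := u
  invFun u := u
  map_add' _ _ := rfl
  map_smul' _ _ := rfl
  left_inv _ := rfl
  right_inv _ := rfl
  norm_map' _ := rfl

/-- The inclusion `W^{1,2}(Ω) → L²(Ω)`. -/
def fnL : WS Ω →L[ℝ] L2 Ω :=
  (ContinuousLinearMap.fst ℝ _ _).comp
    ((WithLp.prodContinuousLinearEquiv 2 ℝ (L2 Ω) (L2Vec Ω)).toContinuousLinearMap.comp
      ((W12 Ω).subtypeL.comp (eqv Ω).toContinuousLinearEquiv.toContinuousLinearMap))

/-- The gradient as a bounded operator `W^{1,2}(Ω) → L²(Ω, ℝ^N)`. -/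
def gradL : WS Ω →L[ℝ] L2Vec Ω :=
  (ContinuousLinearMap.snd ℝ _ _).comp
    ((WithLp.prodContinuousLinearEquiv 2 ℝ (L2 Ω) (L2Vec Ω)).toContinuousLinearMap.comp
      ((W12 Ω).subtypeL.comp (eqv Ω).toContinuousLinearEquiv.toContinuousLinearMap))

lemma fn_eqv (u : WS Ω) : fn (eqv Ω u) = fnL u := rfl

lemma grad_eqv (u : WS Ω) : grad (eqv Ω u) = gradL u := rfl

lemma inner_WS (u v : WS Ω) :
    inner ℝ u v = inner ℝ (fnL u) (fnL v) + inner ℝ (gradL u) (gradL v) := rfl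

lemma norm_sq_WS (u : WS Ω) : ‖u‖ ^ 2 = ‖fnL u‖ ^ 2 + ‖gradL u‖ ^ 2 := by
  rw [← real_inner_self_eq_norm_sq, inner_WS, real_inner_self_eq_norm_sq,
    real_inner_self_eq_norm_sq]

lemma norm_fnL_le (u : WS Ω) : ‖fnL u‖ ≤ ‖u‖ :=
  abs_le_of_sq_le_sq' (by rw [norm_sq_WS]; nlinarith [sq_nonneg ‖gradL u‖]) (norm_nonneg _) |>.2

lemma norm_gradL_le (u : WS Ω) : ‖gradL u‖ ≤ ‖u‖ :=
  abs_le_of_sq_le_sq' (by rw [norm_sq_WS]; nlinarith [sq_nonneg ‖fnL u‖]) (norm_nonneg _) |>.2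

lemma norm_WS_le (u : WS Ω) : ‖u‖ ≤ ‖fnL u‖ + ‖gradL u‖ := by
  refine abs_le_of_sq_le_sq' ?_ (by positivity) |>.2
  rw [norm_sq_WS]; nlinarith [norm_nonneg (fnL u), norm_nonneg (gradL u)]

/-- The element of `W^{1,2}(Ω)` with a given function and weak gradient. -/
def mkW (u : L2 Ω) (G : L2Vec Ω) (h : IsWeakGradient Ω u G) : WS Ω :=
  (⟨WithLp.toLp 2 (u, G), h⟩ : W12 Ω)

@[simp] lemma fn_mkW (u : L2 Ω) (G : L2Vec Ω) (h : IsWeakGradient Ω u G) :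
    fnL (mkW u G h) = u := rfl

@[simp] lemma grad_mkW (u : L2 Ω) (G : L2Vec Ω) (h : IsWeakGradient Ω u G) :
    gradL (mkW u G h) = G := rfl

lemma isWeakGradient_fn_grad (u : WS Ω) : IsWeakGradient Ω (fnL u) (gradL u) := (eqv Ω u).2

/-- `W^{1,2}_0(Ω)` inside the synonym `WS Ω`. -/
def W0 (Ω : Set (E N)) : Submodule ℝ (WS Ω) :=
  (W012 Ω).comap (eqv Ω).toLinearEquiv.toLinearMap

lemma mem_W0 {u : WS Ω} : u ∈ W0 Ω ↔ eqv Ω u ∈ W012 Ω := Iff.rfl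

lemma isClosed_W0 : IsClosed (W0 Ω : Set (WS Ω)) :=
  (Submodule.isClosed_topologicalClosure (testSubmodule Ω)).preimage (eqv Ω).continuous

instance : CompleteSpace (W0 Ω) := isClosed_W0.completeSpace_coe

/-- Fundamental lemma of the calculus of variations for test functions on `Ω`. -/
lemma ae_eq_zero_of_test {f : E N → ℝ} (ho : IsOpen Ω) (hf : Integrable f (volume.restrict Ω))
    (h : ∀ φ, IsTest Ω φ → ∫ x in Ω, f x * φ x = 0) : f =ᵐ[volume.restrict Ω] 0 := by
  have h1 : ∀ᵐ x, x ∈ Ω → f x = 0 := by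
    refine ho.ae_eq_zero_of_integral_contDiff_smul_eq_zero
      (μ := volume) (IntegrableOn.locallyIntegrableOn hf) fun g hg hc hs => ?_
    rw [← h g ⟨hg, hc, hs⟩, setIntegral_eq_integral_of_forall_compl_eq_zero]
    · simp [mul_comm]
    · intro x hx
      rw [image_eq_zero_of_notMem_tsupport fun hx' => hx (hs hx'), mul_zero]
  exact (ae_restrict_iff' ho.measurableSet).2 h1

lemma vec_ae_eq_zero_of_test {G : E N → E N} (ho : IsOpen Ω)
    (hG : Integrable G (volume.restrict Ω))
    (h : ∀ φ, IsTest Ω φ → ∀ e : E N, ∫ x in Ω, inner ℝ (G x) e * φ x = 0) :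
    G =ᵐ[volume.restrict Ω] 0 := by
  have h1 : ∀ i, ∀ᵐ x ∂(volume.restrict Ω), inner ℝ (G x) (EuclideanSpace.single i (1 : ℝ)) = 0 :=
    fun i => ae_eq_zero_of_test ho (hG.inner_const _) fun φ hφ => h φ hφ _
  filter_upwards [ae_all_iff.2 h1] with x hx
  ext i
  have := hx i
  rw [EuclideanSpace.inner_single_right] at this
  simpa using this

lemma finite_restrict (hb : Bornology.IsBounded Ω) : IsFiniteMeasure (volume.restrict Ω) :=
  ⟨by rw [Measure.restrict_apply_univ]; exact hb.measure_lt_top⟩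

lemma integrable_L2 {F : Type*} [NormedAddCommGroup F] (hb : Bornology.IsBounded Ω)
    (G : Lp F 2 (volume.restrict Ω)) : Integrable G (volume.restrict Ω) :=
  have := finite_restrict hb
  (Lp.memLp G).integrable (by norm_num)

/-- Weak gradients are unique. -/
lemma grad_unique (ho : IsOpen Ω) (hb : Bornology.IsBounded Ω) {u : L2 Ω} {G H : L2Vec Ω}
    (hG : IsWeakGradient Ω u G) (hH : IsWeakGradient Ω u H) : G = H := by
  have h : (G - H : L2Vec Ω) =ᵐ[volume.restrict Ω] (0 : E N → E N) := by
    refine vec_ae_eq_zero_of_test ho (integrable_L2 hb _) fun φ hφ e => ?_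
    have h1 := hG φ hφ e
    rw [hH φ hφ e, neg_inj, integral_inner_mul_eq_inner _ hφ,
      integral_inner_mul_eq_inner _ hφ] at h1
    rw [integral_inner_mul_eq_inner _ hφ, inner_sub_right, ← h1, sub_self]
  rw [← sub_eq_zero]
  exact Lp.ext (h.trans (Lp.coeFn_zero _ _ _).symm)

lemma WS_ext (ho : IsOpen Ω) (hb : Bornology.IsBounded Ω) {u v : WS Ω} (h : fnL u = fnL v) :
    u = v := by
  have hg : gradL u = gradL v :=
    grad_unique ho hb (isWeakGradient_fn_grad u) (h ▸ isWeakGradient_fn_grad v)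
  rw [← sub_eq_zero, ← norm_eq_zero, ← pow_eq_zero_iff two_ne_zero, norm_sq_WS]
  simp [h, hg]

lemma inner_gradient (φ : E N → ℝ) (x e : E N) : inner ℝ (gradient φ x) e = fderiv ℝ φ x e := by
  rw [gradient, InnerProductSpace.toDual_symm_apply]

lemma continuous_gradient {φ : E N → ℝ} (hφ : ContDiff ℝ ∞ φ) : Continuous (gradient φ) :=
  (InnerProductSpace.toDual ℝ (E N)).symm.continuous.comp (hφ.continuous_fderiv (by simp))

lemma exists_bound_of_continuous {F : Type*} [NormedAddCommGroup F] (hb : Bornology.IsBounded Ω)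
    {f : E N → F} (hf : Continuous f) : ∃ C, ∀ x ∈ Ω, ‖f x‖ ≤ C := by
  obtain ⟨C, hC⟩ := hb.isCompact_closure.exists_bound_of_continuousOn hf.continuousOn
  exact ⟨C, fun x hx => hC x (subset_closure hx)⟩

lemma memLp_of_continuous {F : Type*} [NormedAddCommGroup F] [SecondCountableTopology F]
    (ho : IsOpen Ω) (hb : Bornology.IsBounded Ω)
    {f : E N → F} (hf : Continuous f) : MemLp f 2 (volume.restrict Ω) := by
  have := finite_restrict hb
  obtain ⟨C, hC⟩ := exists_bound_of_continuous hb hf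
  exact MemLp.of_bound hf.aestronglyMeasurable C
    ((ae_restrict_iff' ho.measurableSet).2 (Eventually.of_forall hC))

lemma isBddField_of_continuous {F G : Type*} [NormedAddCommGroup F] [NormedSpace ℝ F]
    [NormedAddCommGroup G] [NormedSpace ℝ G] [SecondCountableTopology (F →L[ℝ] G)]
    (ho : IsOpen Ω) (hb : Bornology.IsBounded Ω)
    {T : E N → F →L[ℝ] G} (hT : Continuous T) : ∃ C, IsBddField (volume.restrict Ω) T C := by
  obtain ⟨C, hC⟩ := exists_bound_of_continuous hb hT
  exact ⟨C, hT.aestronglyMeasurable,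
    (ae_restrict_iff' ho.measurableSet).2 (Eventually.of_forall hC)⟩

lemma integral_parts {f ψ : E N → ℝ} (hf : ContDiff ℝ ∞ f) (hψ : IsTest Ω ψ) (e : E N) :
    ∫ x in Ω, f x * fderiv ℝ ψ x e = - ∫ x in Ω, fderiv ℝ f x e * ψ x := by
  have hd : ∀ x, x ∉ Ω → fderiv ℝ ψ x e = 0 := fun x hx => by
    have := image_eq_zero_of_notMem_tsupport
      (fun h => hx (hψ.subset (tsupport_fderiv_subset ℝ h)) : x ∉ tsupport (fderiv ℝ ψ))
    rw [this]; rfl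
  rw [setIntegral_eq_integral_of_forall_compl_eq_zero,
    setIntegral_eq_integral_of_forall_compl_eq_zero]
  · have c1 : Continuous fun x => fderiv ℝ f x e :=
      (hf.continuous_fderiv (by simp)).clm_apply continuous_const
    have c2 : Continuous fun x => fderiv ℝ ψ x e :=
      (hψ.smooth.continuous_fderiv (by simp)).clm_apply continuous_const
    refine integral_mul_fderiv_eq_neg_fderiv_mul_of_integrable ?_ ?_ ?_
      (fun x _ => hf.differentiable (by simp) x)
      (fun x _ => hψ.smooth.differentiable (by simp) x)
    · exact (c1.mul hψ.smooth.continuous).integrable_of_hasCompactSupport hψ.compact.mul_left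
    · exact (hf.continuous.mul c2).integrable_of_hasCompactSupport
        (hψ.compact.fderiv_apply ℝ e).mul_left
    · exact (hf.continuous.mul hψ.smooth.continuous).integrable_of_hasCompactSupport
        hψ.compact.mul_left
  · intro x hx
    rw [image_eq_zero_of_notMem_tsupport fun h => hx (hψ.subset h), mul_zero]
  · intro x hx
    rw [hd x hx, mul_zero]

/-- A smooth function on `ℝ^N`, restricted to the bounded open set `Ω`, as an element of
`W^{1,2}(Ω)`. -/
def smoothW (ho : IsOpen Ω) (hb : Bornology.IsBounded Ω) {φ : E N → ℝ} (hφ : ContDiff ℝ ∞ φ) :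
    WS Ω :=
  mkW ((memLp_of_continuous ho hb hφ.continuous).toLp φ)
    ((memLp_of_continuous ho hb (continuous_gradient hφ)).toLp _) (by
      intro ψ hψ e
      have h1 := (memLp_of_continuous ho hb hφ.continuous).coeFn_toLp
      have h2 := (memLp_of_continuous ho hb (continuous_gradient hφ)).coeFn_toLp
      have e1 : ∫ x in Ω, (memLp_of_continuous ho hb hφ.continuous).toLp φ x * fderiv ℝ ψ x e =
          ∫ x in Ω, φ x * fderiv ℝ ψ x e :=
        integral_congr_ae (by filter_upwards [h1] with x hx; rw [hx])
      have e2 : ∫ x in Ω, inner ℝ ((memLp_of_continuous ho hb (continuous_gradient hφ)).toLp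
          (gradient φ) x) e * ψ x = ∫ x in Ω, fderiv ℝ φ x e * ψ x :=
        integral_congr_ae (by filter_upwards [h2] with x hx; rw [hx, inner_gradient])
      rw [e1, e2, integral_parts hφ hψ])

lemma fn_smoothW (ho : IsOpen Ω) (hb : Bornology.IsBounded Ω) {φ : E N → ℝ}
    (hφ : ContDiff ℝ ∞ φ) : fnL (smoothW ho hb hφ) =ᵐ[volume.restrict Ω] φ :=
  (memLp_of_continuous ho hb hφ.continuous).coeFn_toLp

lemma grad_smoothW (ho : IsOpen Ω) (hb : Bornology.IsBounded Ω) {φ : E N → ℝ}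
    (hφ : ContDiff ℝ ∞ φ) : gradL (smoothW ho hb hφ) =ᵐ[volume.restrict Ω] gradient φ :=
  (memLp_of_continuous ho hb (continuous_gradient hφ)).coeFn_toLp

lemma eq_smoothW (ho : IsOpen Ω) (hb : Bornology.IsBounded Ω) {φ : E N → ℝ}
    (hφ : ContDiff ℝ ∞ φ) {u : WS Ω} (hu : fnL u =ᵐ[volume.restrict Ω] φ) :
    u = smoothW ho hb hφ :=
  WS_ext ho hb (Lp.ext (hu.trans (fn_smoothW ho hb hφ).symm))

/-- Pointwise multiplication by a scalar function. -/
def sField {F : Type*} [NormedAddCommGroup F] [NormedSpace ℝ F] (ζ : E N → ℝ) (x : E N) :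
    F →L[ℝ] F := ζ x • ContinuousLinearMap.id ℝ F

/-- The field of operators `c ↦ c ∇ζ(x)`. -/
def gField (ζ : E N → ℝ) (x : E N) : ℝ →L[ℝ] E N :=
  (ContinuousLinearMap.id ℝ ℝ).smulRight (gradient ζ x)

lemma continuous_sField {F : Type*} [NormedAddCommGroup F] [NormedSpace ℝ F] {ζ : E N → ℝ}
    (hζ : Continuous ζ) : Continuous (sField (F := F) ζ) := hζ.smul continuous_const

lemma continuous_gField {ζ : E N → ℝ} (hζ : ContDiff ℝ ∞ ζ) : Continuous (gField ζ) :=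
  (ContinuousLinearMap.smulRightL ℝ ℝ (E N) (ContinuousLinearMap.id ℝ ℝ)).continuous.comp
    (continuous_gradient hζ)

lemma sField_coeFn {F : Type*} [NormedAddCommGroup F] [NormedSpace ℝ F]
    [SecondCountableTopology (F →L[ℝ] F)] (ho : IsOpen Ω) (hb : Bornology.IsBounded Ω)
    {ζ : E N → ℝ} (hζ : Continuous ζ) (u : Lp F 2 (volume.restrict Ω)) :
    mulOp (volume.restrict Ω) (sField ζ) u =ᵐ[volume.restrict Ω] fun x => ζ x • u x := by
  obtain ⟨C, hC⟩ := isBddField_of_continuous ho hb (continuous_sField (F := F) hζ)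
  exact hC.coeFn u

lemma gField_coeFn (ho : IsOpen Ω) (hb : Bornology.IsBounded Ω)
    {ζ : E N → ℝ} (hζ : ContDiff ℝ ∞ ζ) (u : L2 Ω) :
    mulOp (volume.restrict Ω) (gField ζ) u =ᵐ[volume.restrict Ω] fun x => u x • gradient ζ x := by
  obtain ⟨C, hC⟩ := isBddField_of_continuous ho hb (continuous_gField hζ)
  exact hC.coeFn u

lemma IsTest.mul {ζ ψ : E N → ℝ} (hζ : ContDiff ℝ ∞ ζ) (hψ : IsTest Ω ψ) :
    IsTest Ω (fun x => ζ x * ψ x) :=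
  ⟨hζ.mul hψ.smooth, hψ.compact.mul_left,
    (closure_mono (Function.support_mul_subset_right _ _)).trans hψ.subset⟩

/-- The product rule for a Sobolev function and a smooth function. -/
lemma isWeakGradient_mul (ho : IsOpen Ω) (hb : Bornology.IsBounded Ω) {ζ : E N → ℝ}
    (hζ : ContDiff ℝ ∞ ζ) {u : L2 Ω} {G : L2Vec Ω} (h : IsWeakGradient Ω u G) :
    IsWeakGradient Ω (mulOp (volume.restrict Ω) (sField ζ) u)
      (mulOp (volume.restrict Ω) (sField ζ) G + mulOp (volume.restrict Ω) (gField ζ) u) := by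
  intro ψ hψ e
  have hm := IsTest.mul hζ hψ
  have h0 := h _ hm e
  have hd : ∀ x, fderiv ℝ (fun x => ζ x * ψ x) x e
      = ζ x * fderiv ℝ ψ x e + ψ x * fderiv ℝ ζ x e := fun x => by
    rw [fderiv_fun_mul (hζ.differentiable (by simp) x) (hψ.smooth.differentiable (by simp) x)]
    simp
  have i1 := integrable_left hψ e (mulOp (volume.restrict Ω) (sField ζ) u)
  have i2 : Integrable (fun x => inner ℝ (mulOp (volume.restrict Ω) (gField ζ) u x) e * ψ x)
      (volume.restrict Ω) := integrable_right hψ e _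
  have i3 : Integrable (fun x => inner ℝ (mulOp (volume.restrict Ω) (sField ζ) G x) e * ψ x)
      (volume.restrict Ω) := integrable_right hψ e _
  have e1 := sField_coeFn ho hb hζ.continuous u
  have e2 := sField_coeFn ho hb hζ.continuous G
  have e3 := gField_coeFn ho hb hζ u
  have s1 : ∫ x in Ω, u x * fderiv ℝ (fun x => ζ x * ψ x) x e =
      ∫ x in Ω, (mulOp (volume.restrict Ω) (sField ζ) u x * fderiv ℝ ψ x e +
        inner ℝ (mulOp (volume.restrict Ω) (gField ζ) u x) e * ψ x) := by
    refine integral_congr_ae ?_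
    filter_upwards [e1, e3] with x h1 h3
    rw [hd, h1, h3, real_inner_smul_left, inner_gradient, smul_eq_mul]
    ring
  have s2 : ∫ x in Ω, inner ℝ (G x) e * (ζ x * ψ x) =
      ∫ x in Ω, inner ℝ (mulOp (volume.restrict Ω) (sField ζ) G x) e * ψ x := by
    refine integral_congr_ae ?_
    filter_upwards [e2] with x h2
    rw [h2, real_inner_smul_left]
    ring
  have s3 : ∫ x in Ω, inner ℝ ((mulOp (volume.restrict Ω) (sField ζ) G +
        mulOp (volume.restrict Ω) (gField ζ) u : L2Vec Ω) x) e * ψ x =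
      ∫ x in Ω, (inner ℝ (mulOp (volume.restrict Ω) (sField ζ) G x) e * ψ x +
        inner ℝ (mulOp (volume.restrict Ω) (gField ζ) u x) e * ψ x) := by
    refine integral_congr_ae ?_
    filter_upwards [Lp.coeFn_add (mulOp (volume.restrict Ω) (sField ζ) G)
      (mulOp (volume.restrict Ω) (gField ζ) u)] with x hx
    rw [hx, Pi.add_apply, inner_add_left, add_mul]
  rw [s1, s2, integral_add i1 i2] at h0
  rw [s3, integral_add i3 i2]
  linarith

/-- Multiplication by a smooth function, as a bounded operator on `W^{1,2}(Ω)`. -/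
def mulW (ho : IsOpen Ω) (hb : Bornology.IsBounded Ω) {ζ : E N → ℝ} (hζ : ContDiff ℝ ∞ ζ) :
    WS Ω →L[ℝ] WS Ω :=
  LinearMap.mkContinuous
    { toFun := fun u => mkW (mulOp (volume.restrict Ω) (sField ζ) (fnL u))
        (mulOp (volume.restrict Ω) (sField ζ) (gradL u) +
          mulOp (volume.restrict Ω) (gField ζ) (fnL u))
        (isWeakGradient_mul ho hb hζ (isWeakGradient_fn_grad u))
      map_add' := fun u v => WS_ext ho hb (by simp only [fn_mkW, map_add])
      map_smul' := fun c u => WS_ext ho hb (by simp only [fn_mkW, map_smul, RingHom.id_apply]) }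
    (‖mulOp (volume.restrict Ω) (sField (F := ℝ) ζ)‖ +
      (‖mulOp (volume.restrict Ω) (sField (F := E N) ζ)‖ + ‖mulOp (volume.restrict Ω) (gField ζ)‖))
    (fun u => by
      refine (norm_WS_le _).trans ?_
      rw [LinearMap.coe_mk, AddHom.coe_mk, fn_mkW, grad_mkW, add_mul, add_mul]
      refine add_le_add ?_ ((norm_add_le _ _).trans (add_le_add ?_ ?_)) <;>
        refine (ContinuousLinearMap.le_opNorm _ _).trans ?_ <;> gcongr
      · exact norm_fnL_le u
      · exact norm_gradL_le u
      · exact norm_fnL_le u)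

lemma fn_mulW (ho : IsOpen Ω) (hb : Bornology.IsBounded Ω) {ζ : E N → ℝ} (hζ : ContDiff ℝ ∞ ζ)
    (u : WS Ω) : fnL (mulW ho hb hζ u) = mulOp (volume.restrict Ω) (sField ζ) (fnL u) := rfl

lemma grad_mulW (ho : IsOpen Ω) (hb : Bornology.IsBounded Ω) {ζ : E N → ℝ} (hζ : ContDiff ℝ ∞ ζ)
    (u : WS Ω) : gradL (mulW ho hb hζ u) = mulOp (volume.restrict Ω) (sField ζ) (gradL u) +
      mulOp (volume.restrict Ω) (gField ζ) (fnL u) := rfl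

lemma fn_mulW_ae (ho : IsOpen Ω) (hb : Bornology.IsBounded Ω) {ζ : E N → ℝ}
    (hζ : ContDiff ℝ ∞ ζ) (u : WS Ω) :
    fnL (mulW ho hb hζ u) =ᵐ[volume.restrict Ω] fun x => ζ x * fnL u x :=
  sField_coeFn ho hb hζ.continuous (fnL u)

lemma grad_mulW_ae (ho : IsOpen Ω) (hb : Bornology.IsBounded Ω) {ζ : E N → ℝ}
    (hζ : ContDiff ℝ ∞ ζ) (u : WS Ω) : gradL (mulW ho hb hζ u) =ᵐ[volume.restrict Ω]
      fun x => ζ x • gradL u x + fnL u x • gradient ζ x := by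
  rw [grad_mulW]
  filter_upwards [Lp.coeFn_add (mulOp (volume.restrict Ω) (sField ζ) (gradL u))
      (mulOp (volume.restrict Ω) (gField ζ) (fnL u)), sField_coeFn ho hb hζ.continuous (gradL u),
      gField_coeFn ho hb hζ (fnL u)] with x h1 h2 h3
  rw [h1, Pi.add_apply, h2, h3]

lemma mulW_smoothW (ho : IsOpen Ω) (hb : Bornology.IsBounded Ω) {ζ φ : E N → ℝ}
    (hζ : ContDiff ℝ ∞ ζ) (hφ : ContDiff ℝ ∞ φ) :
    mulW ho hb hζ (smoothW ho hb hφ) = smoothW ho hb (hζ.mul hφ) := by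
  refine eq_smoothW ho hb _ ?_
  filter_upwards [fn_mulW_ae ho hb hζ (smoothW ho hb hφ), fn_smoothW ho hb hφ] with x h1 h2
  rw [h1, h2]

lemma test_mem_W0 (ho : IsOpen Ω) (hb : Bornology.IsBounded Ω) {φ : E N → ℝ}
    (hφ : IsTest Ω φ) : smoothW ho hb hφ.smooth ∈ W0 Ω :=
  mem_W0.2 <| Submodule.le_topologicalClosure (testSubmodule Ω) ⟨φ, hφ, fn_smoothW ho hb hφ.smooth⟩

end Sobolev

/-! ### The uniform cone property of Lipschitz domains -/

section Cone

variable {N : ℕ} {Ω : Set (E N)}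

/-- On `B`, the closure of `Ω` satisfies a uniform cone condition: the truncated cone around the
direction `e`, of aperture `η` and height `t₀`, placed at a point of `closure Ω ∩ B`, lies in `Ω`.
Interior points are covered by taking `e = 0`, for which the cone is a ball. -/
structure IsConePatch (Ω B : Set (E N)) (e : E N) (η t₀ : ℝ) : Prop where
  eta_pos : 0 < η
  height_pos : 0 < t₀
  mem : ∀ x ∈ closure Ω ∩ B, ∀ t : ℝ, 0 < t → t < t₀ → ∀ z : E N, ‖z‖ ≤ η * t → x + t • e + z ∈ Ω

/-- In the ball of a graph representation, the closure of `Ω` lies weakly above the graph. -/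
lemma graph_le_of_mem_closure {x₀ e : E N} {γ : E N → ℝ} {r : ℝ} (hγ : Continuous γ)
    (h : ∀ x ∈ Metric.ball x₀ r, (x ∈ Ω ↔ γ (x - inner ℝ x e • e) < inner ℝ x e))
    {x : E N} (hx : x ∈ closure Ω) (hxr : x ∈ Metric.ball x₀ r) :
    γ (x - inner ℝ x e • e) ≤ inner ℝ x e := by
  have h1 : x ∈ closure (Metric.ball x₀ r ∩ Ω) := Metric.isOpen_ball.inter_closure ⟨hxr, hx⟩
  have h2 : IsClosed {y : E N | γ (y - inner ℝ y e • e) ≤ inner ℝ y e} :=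
    isClosed_le (by fun_prop) (by fun_prop)
  exact closure_minimal (fun y hy => ((h y hy.1).1 hy.2).le) h2 h1

lemma exists_conePatch (hΩ : IsBoundedLipschitzDomain Ω) {x₀ : E N} (hx₀ : x₀ ∈ closure Ω) :
    ∃ r > 0, ∃ (e : E N) (η t₀ : ℝ), IsConePatch Ω (Metric.ball x₀ r) e η t₀ := by
  by_cases hf : x₀ ∈ frontier Ω
  · obtain ⟨e, γ, K, r, he, hγ, hr, h⟩ := hΩ.lipschitz x₀ hf
    have hK : (0 : ℝ) ≤ K := K.2
    have hη : (0 : ℝ) < 1 / (2 * K + 2) := by positivity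
    have hη2 : (1 : ℝ) / (2 * K + 2) ≤ 1 / 2 := by
      apply one_div_le_one_div_of_le <;> linarith
    refine ⟨r / 2, by positivity, e, 1 / (2 * K + 2), r / 4, hη, by positivity, ?_⟩
    rintro x ⟨hx, hxb⟩ t ht htr z hz
    rw [Metric.mem_ball, dist_eq_norm] at hxb
    have hzt : ‖z‖ ≤ t / 2 := hz.trans (by nlinarith)
    have hb : x + t • e + z ∈ Metric.ball x₀ r := by
      rw [Metric.mem_ball, dist_eq_norm]
      calc ‖x + t • e + z - x₀‖ = ‖(x - x₀) + t • e + z‖ := by congr 1; abel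
        _ ≤ ‖x - x₀‖ + ‖t • e‖ + ‖z‖ := norm_add₃_le
        _ < r := by
          rw [norm_smul, he, Real.norm_eq_abs, abs_of_pos ht]
          linarith
    rw [h _ hb]
    have hxγ := graph_le_of_mem_closure hγ.continuous h hx
      (by rw [Metric.mem_ball, dist_eq_norm]; linarith)
    have hee : inner ℝ e e = (1 : ℝ) := by rw [real_inner_self_eq_norm_sq, he]; norm_num
    have hin : inner ℝ (x + t • e + z) e = inner ℝ x e + t + inner ℝ z e := by
      rw [inner_add_left, inner_add_left, real_inner_smul_left, hee, mul_one]
    have hze : |inner ℝ z e| ≤ ‖z‖ := by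
      simpa [he] using abs_real_inner_le_norm z e
    have hP : ‖(x + t • e + z - inner ℝ (x + t • e + z) e • e) - (x - inner ℝ x e • e)‖
        ≤ 2 * ‖z‖ := by
      have : (x + t • e + z - inner ℝ (x + t • e + z) e • e) - (x - inner ℝ x e • e)
          = z - inner ℝ z e • e := by
        rw [hin, add_smul, add_smul]; abel
      rw [this]
      refine (norm_sub_le _ _).trans ?_
      rw [norm_smul, he, mul_one, Real.norm_eq_abs]
      linarith
    have hL := hγ.dist_le_mul (x + t • e + z - inner ℝ (x + t • e + z) e • e)
      (x - inner ℝ x e • e)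
    rw [Real.dist_eq, dist_eq_norm] at hL
    have hL2 := (le_abs_self _).trans (hL.trans (mul_le_mul_of_nonneg_left hP hK))
    rw [hin]
    have h3 : (2 * K + 1) * ‖z‖ < t := by
      have h4 : (2 * (K : ℝ) + 2) * ‖z‖ ≤ t := by
        calc (2 * (K : ℝ) + 2) * ‖z‖ ≤ (2 * K + 2) * (1 / (2 * K + 2) * t) := by gcongr
          _ = t := by field_simp
      rcases (norm_nonneg z).eq_or_lt with h0 | h0
      · rw [← h0]; simpa using ht
      · nlinarith
    have h5 := (abs_le.1 hze).1
    rw [hin] at hL2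
    linarith
  · have hxi : x₀ ∈ Ω := by
      by_contra hc
      exact hf ⟨hx₀, by rwa [hΩ.isOpen.interior_eq]⟩
    obtain ⟨ε, hε, hball⟩ := Metric.isOpen_iff.1 hΩ.isOpen x₀ hxi
    refine ⟨ε / 2, by positivity, 0, 1, ε / 2, one_pos, by positivity, ?_⟩
    rintro x ⟨-, hxb⟩ t ht htr z hz
    refine hball ?_
    rw [Metric.mem_ball, dist_eq_norm] at hxb ⊢
    calc ‖x + t • (0 : E N) + z - x₀‖ = ‖(x - x₀) + z‖ := by congr 1; rw [smul_zero]; abel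
      _ ≤ ‖x - x₀‖ + ‖z‖ := norm_add_le _ _
      _ < ε := by linarith

/-- Segments in the directions of the cone stay in `Ω`. -/
lemma IsConePatch.segment_mem {B : Set (E N)} {e : E N} {η t₀ : ℝ} (h : IsConePatch Ω B e η t₀)
    {x : E N} (hx : x ∈ Ω ∩ B) {t : ℝ} (ht : 0 < t) (ht₀ : t < t₀) {z : E N} (hz : ‖z‖ ≤ η * t)
    {s : ℝ} (hs : s ∈ Set.Icc (0 : ℝ) 1) : x + s • (t • e + z) ∈ Ω := by
  rcases hs.1.eq_or_lt with h0 | h0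
  · rw [← h0, zero_smul, add_zero]; exact hx.1
  · have := h.mem x ⟨subset_closure hx.1, hx.2⟩ (s * t) (by positivity)
      (lt_of_le_of_lt (by nlinarith [hs.2]) ht₀) (s • z) (by
        rw [norm_smul, Real.norm_eq_abs, abs_of_pos h0]
        nlinarith)
    rwa [smul_add, smul_smul, ← add_assoc]

end Cone

/-! ### Mollification -/

section Moll

variable {N : ℕ} {F : Type*} [NormedAddCommGroup F]

/-- A smooth probability density supported in the ball of radius `ε`. -/
structure IsMollifier (ρ : E N → ℝ) (ε : ℝ) : Prop where
  smooth : ContDiff ℝ ∞ ρ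
  nonneg : ∀ x, 0 ≤ ρ x
  integral_eq : ∫ x, ρ x = 1
  tsupport_subset : tsupport ρ ⊆ Metric.closedBall 0 ε

lemma exists_isMollifier (N : ℕ) {ε : ℝ} (hε : 0 < ε) : ∃ ρ : E N → ℝ, IsMollifier ρ ε := by
  let f : ContDiffBump (0 : E N) := ⟨ε / 2, ε, by positivity, by linarith⟩
  exact ⟨f.normed volume, f.contDiff_normed, f.nonneg_normed, f.integral_normed,
    f.tsupport_normed_eq.subset⟩

namespace IsMollifier

variable {ρ : E N → ℝ} {ε : ℝ}

lemma compact (h : IsMollifier ρ ε) : HasCompactSupport ρ :=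
  HasCompactSupport.of_support_subset_isCompact (isCompact_closedBall 0 ε)
    ((subset_tsupport _).trans h.tsupport_subset)

lemma eq_zero (h : IsMollifier ρ ε) {z : E N} (hz : ε < ‖z‖) : ρ z = 0 :=
  image_eq_zero_of_notMem_tsupport fun hc => by
    have := h.tsupport_subset hc
    rw [mem_closedBall_zero_iff] at this
    linarith

lemma integrable (h : IsMollifier ρ ε) : Integrable ρ :=
  h.smooth.continuous.integrable_of_hasCompactSupport h.compact

end IsMollifier

/-- The mollification of `f` with the kernel `ρ`. -/
def moll [NormedSpace ℝ F] (ρ : E N → ℝ) (f : E N → F) (y : E N) : F := ∫ w, ρ (y - w) • f w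

lemma moll_eq [NormedSpace ℝ F] (ρ : E N → ℝ) (f : E N → F) (y : E N) : moll ρ f y = ∫ z, ρ z • f (y - z) := by
  rw [moll, ← integral_sub_left_eq_self _ volume y]
  simp

lemma contDiff_moll {ρ : E N → ℝ} {ε : ℝ} (hρ : IsMollifier ρ ε) {f : E N → ℝ}
    (hf : LocallyIntegrable f) : ContDiff ℝ ∞ (moll ρ f) := by
  have h : moll ρ f = convolution f ρ (ContinuousLinearMap.lsmul ℝ ℝ) volume := by
    funext y
    rw [moll, convolution]
    simp [mul_comm]
  rw [h]
  exact hρ.compact.contDiff_convolution_right _ hf hρ.smooth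

lemma fderiv_moll {ρ : E N → ℝ} {ε : ℝ} (hρ : IsMollifier ρ ε) {f : E N → ℝ}
    (hf : LocallyIntegrable f) (y e : E N) :
    fderiv ℝ (moll ρ f) y e = ∫ w, f w * fderiv ℝ ρ (y - w) e := by
  have h : moll ρ f = convolution f ρ (ContinuousLinearMap.lsmul ℝ ℝ) volume := by
    funext y
    rw [moll, convolution]
    simp [mul_comm]
  rw [h, (hρ.compact.hasFDerivAt_convolution_right _ hf
    (hρ.smooth.of_le (by simp)) y).fderiv, convolution_precompR_apply _ hf (hρ.compact.fderiv ℝ)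
    (hρ.smooth.continuous_fderiv (by simp))]
  rfl

/-- Mollification is controlled by the oscillation under small translations: Jensen's inequality
for the probability density `ρ`, followed by Tonelli. -/
lemma eLpNorm_moll_sub_le [NormedSpace ℝ F] [CompleteSpace F] {ρ : E N → ℝ} {ε : ℝ} (hρ : IsMollifier ρ ε)
    {f : E N → F}
    (hf : StronglyMeasurable f) (hf2 : MemLp f 2 volume) (D : Set (E N)) (h : E N)
    {C : ENNReal} (hC : ∀ z : E N, ‖z‖ ≤ ε →
      eLpNorm (fun x => f (x + h - z) - f x) 2 (volume.restrict D) ≤ C) :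
    eLpNorm (fun x => moll ρ f (x + h) - f x) 2 (volume.restrict D) ≤ C := by
  set ν : Measure (E N) := volume.withDensity (fun z => ENNReal.ofReal (ρ z)) with hν
  have hρm : Measurable (fun z => ENNReal.ofReal (ρ z)) :=
    ENNReal.measurable_ofReal.comp hρ.smooth.continuous.measurable
  have hρm' : Measurable (fun z => (ρ z).toNNReal) :=
    hρ.smooth.continuous.measurable.real_toNNReal
  have hνp : IsProbabilityMeasure ν := ⟨by
    rw [hν, withDensity_apply _ MeasurableSet.univ, Measure.restrict_univ,
      ← ofReal_integral_eq_lintegral_ofReal hρ.integrable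
        (Eventually.of_forall hρ.nonneg), hρ.integral_eq, ENNReal.ofReal_one]⟩
  have hint : ∀ g : E N → F, ∫ z, ρ z • g z = ∫ z, g z ∂ν := fun g => by
    rw [hν]
    have : (fun z => ENNReal.ofReal (ρ z)) = fun z => (((ρ z).toNNReal : NNReal) : ENNReal) := rfl
    rw [this, integral_withDensity_eq_integral_smul hρm']
    refine integral_congr_ae (Eventually.of_forall fun z => ?_)
    simp only [NNReal.smul_def, Real.coe_toNNReal _ (hρ.nonneg z)]
  have hfl : LocallyIntegrable f := hf2.locallyIntegrable (by norm_num)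
  have hintg : ∀ y, Integrable (fun z => f (y - z)) ν := fun y => by
    rw [hν]
    have : (fun z => ENNReal.ofReal (ρ z)) = fun z => (((ρ z).toNNReal : NNReal) : ENNReal) := rfl
    rw [this, integrable_withDensity_iff_integrable_smul hρm']
    have h1 : LocallyIntegrable (fun z => f (y - z)) :=
      (hf2.comp_measurePreserving (Measure.measurePreserving_sub_left volume y)).locallyIntegrable
        (by norm_num)
    refine (h1.integrable_smul_left_of_hasCompactSupport hρ.smooth.continuous hρ.compact).congr
      (Eventually.of_forall fun z => ?_)
    simp only [NNReal.smul_def, Real.coe_toNNReal _ (hρ.nonneg z)]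
  have hpt : ∀ x, ‖moll ρ f (x + h) - f x‖ₑ ^ (2 : ℝ) ≤
      ∫⁻ z, ‖f (x + h - z) - f x‖ₑ ^ (2 : ℝ) ∂ν := fun x => by
    have h1 : moll ρ f (x + h) - f x = ∫ z, (f (x + h - z) - f x) ∂ν := by
      rw [integral_sub (hintg _) (integrable_const _), moll_eq, hint]
      simp
    have hm : AEStronglyMeasurable (fun z => f (x + h - z) - f x) ν :=
      ((hf.comp_measurable (measurable_const.sub measurable_id)).sub
        stronglyMeasurable_const).aestronglyMeasurable
    have h2 := eLpNorm_le_eLpNorm_of_exponent_le (p := 1) (q := 2) (by norm_num) hm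
    rw [eLpNorm_one_eq_lintegral_enorm, eLpNorm_eq_lintegral_rpow_enorm_toReal
      (by norm_num) (by norm_num)] at h2
    simp only [ENNReal.toReal_ofNat] at h2
    have h3 : ‖moll ρ f (x + h) - f x‖ₑ ≤
        (∫⁻ z, ‖f (x + h - z) - f x‖ₑ ^ (2 : ℝ) ∂ν) ^ ((1 : ℝ) / 2) := by
      rw [h1]
      exact (enorm_integral_le_lintegral_enorm _).trans h2
    calc _ ≤ ((∫⁻ z, ‖f (x + h - z) - f x‖ₑ ^ (2 : ℝ) ∂ν) ^ ((1 : ℝ) / 2)) ^ (2 : ℝ) := by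
          gcongr
      _ = _ := by rw [← ENNReal.rpow_mul]; norm_num
  have hC' : ∀ z : E N, ‖z‖ ≤ ε →
      ∫⁻ x in D, ‖f (x + h - z) - f x‖ₑ ^ (2 : ℝ) ≤ C ^ (2 : ℝ) := fun z hz => by
    have := hC z hz
    rw [eLpNorm_eq_lintegral_rpow_enorm_toReal (by norm_num) (by norm_num)] at this
    simp only [ENNReal.toReal_ofNat] at this
    calc _ = ((∫⁻ x in D, ‖f (x + h - z) - f x‖ₑ ^ (2 : ℝ)) ^ ((1 : ℝ) / 2)) ^ (2 : ℝ) := by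
          rw [← ENNReal.rpow_mul]; norm_num
      _ ≤ _ := by gcongr
  have hae : ∀ᵐ z ∂ν, ‖z‖ ≤ ε := by
    rw [hν, ae_withDensity_iff hρm]
    refine Eventually.of_forall fun z hz => ?_
    by_contra hc
    exact hz (by rw [hρ.eq_zero (not_le.1 hc), ENNReal.ofReal_zero])
  have hmeas : Measurable (fun p : E N × E N => ‖f (p.1 + h - p.2) - f p.1‖ₑ ^ (2 : ℝ)) := by
    have := (hf.comp_measurable (g := fun p : E N × E N => p.1 + h - p.2) (by fun_prop)).sub
      (hf.comp_measurable measurable_fst)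
    exact this.enorm.pow_const _
  have key : ∫⁻ x in D, ‖moll ρ f (x + h) - f x‖ₑ ^ (2 : ℝ) ≤ C ^ (2 : ℝ) :=
    calc ∫⁻ x in D, ‖moll ρ f (x + h) - f x‖ₑ ^ (2 : ℝ)
        ≤ ∫⁻ x in D, ∫⁻ z, ‖f (x + h - z) - f x‖ₑ ^ (2 : ℝ) ∂ν := lintegral_mono hpt
      _ = ∫⁻ z, (∫⁻ x in D, ‖f (x + h - z) - f x‖ₑ ^ (2 : ℝ)) ∂ν :=
          lintegral_lintegral_swap hmeas.aemeasurable
      _ ≤ ∫⁻ z, C ^ (2 : ℝ) ∂ν := lintegral_mono_ae (hae.mono fun z hz => hC' z hz)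
      _ = C ^ (2 : ℝ) := by simp
  rw [eLpNorm_eq_lintegral_rpow_enorm_toReal (by norm_num) (by norm_num)]
  simp only [ENNReal.toReal_ofNat]
  calc _ ≤ (C ^ (2 : ℝ)) ^ ((1 : ℝ) / 2) := by gcongr
    _ = C := by rw [← ENNReal.rpow_mul]; norm_num

/-- Translations are continuous in `L²`. -/
lemma exists_translation_le {f : E N → F} (hf : MemLp f 2 volume) {ε : ℝ} (hε : 0 < ε) :
    ∃ δ > 0, ∀ h : E N, ‖h‖ < δ →
      eLpNorm (fun x => f (x + h) - f x) 2 volume ≤ ENNReal.ofReal ε := by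
  let g : E N → C(E N, E N) := fun h => ⟨fun x => x + h, by fun_prop⟩
  have hg : Continuous g :=
    (ContinuousMap.curry ⟨fun p : E N × E N => p.2 + p.1, by fun_prop⟩).continuous
  have hm : ∀ h, MeasurePreserving (g h) (volume : Measure (E N)) volume :=
    fun h => measurePreserving_add_right volume h
  have hc := (continuous_const (y := hf.toLp f)).compMeasurePreservingLp hg hm
    (by norm_num : (2 : ENNReal) ≠ ⊤)
  have h0 := Metric.continuous_iff.1 hc 0 ε hε
  obtain ⟨δ, hδ, h1⟩ := h0
  refine ⟨δ, hδ, fun h hh => ?_⟩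
  have h2 := (h1 h (by rwa [dist_zero_right])).le
  rw [dist_eq_norm, Lp.norm_def] at h2
  have h3 : ((Lp.compMeasurePreserving (g h) (hm h) (hf.toLp f) -
      Lp.compMeasurePreserving (g 0) (hm 0) (hf.toLp f) : Lp F 2 volume) : E N → F)
      =ᵐ[volume] fun x => f (x + h) - f x := by
    filter_upwards [Lp.coeFn_sub (Lp.compMeasurePreserving (g h) (hm h) (hf.toLp f))
      (Lp.compMeasurePreserving (g 0) (hm 0) (hf.toLp f)),
      Lp.coeFn_compMeasurePreserving (hf.toLp f) (hm h),
      Lp.coeFn_compMeasurePreserving (hf.toLp f) (hm 0),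
      (hm h).quasiMeasurePreserving.ae (hf.coeFn_toLp),
      (hm 0).quasiMeasurePreserving.ae (hf.coeFn_toLp)] with x a1 a2 a3 a4 a5
    rw [a1, Pi.sub_apply, a2, a3, Function.comp_apply, Function.comp_apply, a4, a5]
    simp [g]
  rw [eLpNorm_congr_ae h3] at h2
  exact ENNReal.le_ofReal_iff_toReal_le (by
    rw [← eLpNorm_congr_ae h3]; exact (Lp.memLp _).eLpNorm_ne_top) hε.le |>.2 h2

end Moll

/-! ### Density of smooth functions -/

section Density

variable {N : ℕ} {Ω : Set (E N)} {F : Type*} [NormedAddCommGroup F]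

/-- Extension by zero of a function on `Ω`. -/
def ext0 (u : Lp F 2 (volume.restrict Ω)) : E N → F := Ω.indicator u

lemma ext0_stronglyMeasurable (ho : IsOpen Ω) (u : Lp F 2 (volume.restrict Ω)) :
    StronglyMeasurable (ext0 u) :=
  (Lp.stronglyMeasurable u).indicator ho.measurableSet

lemma ext0_memLp (ho : IsOpen Ω) (u : Lp F 2 (volume.restrict Ω)) : MemLp (ext0 u) 2 volume :=
  (memLp_indicator_iff_restrict ho.measurableSet).2 (Lp.memLp u)

lemma ext0_locallyIntegrable (ho : IsOpen Ω) (u : Lp F 2 (volume.restrict Ω)) :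
    LocallyIntegrable (ext0 u) :=
  (ext0_memLp ho u).locallyIntegrable (by norm_num)

lemma ext0_eq (u : Lp F 2 (volume.restrict Ω)) {x : E N} (hx : x ∈ Ω) : ext0 u x = u x :=
  Set.indicator_of_mem hx _

lemma ext0_ae_eq (ho : IsOpen Ω) (u : Lp F 2 (volume.restrict Ω)) :
    ext0 u =ᵐ[volume.restrict Ω] u :=
  (ae_restrict_iff' ho.measurableSet).2 (Eventually.of_forall fun _ hx => ext0_eq u hx)

lemma continuous_moll [NormedSpace ℝ F] {ρ : E N → ℝ} {ε : ℝ} (hρ : IsMollifier ρ ε)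
    {f : E N → F} (hf : LocallyIntegrable f) : Continuous (moll ρ f) := by
  have h : moll ρ f = convolution ρ f (ContinuousLinearMap.lsmul ℝ ℝ) volume := by
    funext y
    rw [moll_eq, convolution]
    simp
  rw [h]
  exact hρ.compact.continuous_convolution_left _ hρ.smooth.continuous hf

/-- At points whose `ε`-ball lies in `Ω`, the gradient of the mollification is the mollification
of the weak gradient. -/
lemma fderiv_moll_ext0 (ho : IsOpen Ω) {ρ : E N → ℝ} {ε : ℝ} (hρ : IsMollifier ρ ε)
    (u : WS Ω) {y : E N} (hy : Metric.closedBall y ε ⊆ Ω) (e : E N) :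
    fderiv ℝ (moll ρ (ext0 (fnL u))) y e = inner ℝ (moll ρ (ext0 (gradL u)) y) e := by
  have hsm : ContDiff ℝ ∞ (fun w => ρ (y - w)) := hρ.smooth.comp (contDiff_const.sub contDiff_id)
  have hsupp : tsupport (fun w => ρ (y - w)) ⊆ Metric.closedBall y ε := by
    refine closure_minimal (fun w hw => ?_) Metric.isClosed_closedBall
    by_contra hc
    refine hw (hρ.eq_zero ?_)
    rwa [Metric.mem_closedBall, not_le, dist_comm, dist_eq_norm] at hc
  have htest : IsTest Ω (fun w => ρ (y - w)) :=
    ⟨hsm, HasCompactSupport.of_support_subset_isCompact (isCompact_closedBall y ε)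
      ((subset_tsupport _).trans hsupp), hsupp.trans hy⟩
  have hd : ∀ w, fderiv ℝ (fun w => ρ (y - w)) w e = - fderiv ℝ ρ (y - w) e := fun w => by
    have h1 : HasFDerivAt (fun w => ρ (y - w))
        ((fderiv ℝ ρ (y - w)).comp (-ContinuousLinearMap.id ℝ (E N))) w :=
      (hρ.smooth.differentiable (by simp) (y - w)).hasFDerivAt.comp w
        ((hasFDerivAt_id w).const_sub y)
    rw [h1.fderiv]
    simp
  have h := isWeakGradient_fn_grad u _ htest e
  rw [fderiv_moll hρ (ext0_locallyIntegrable ho _)]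
  have e1 : ∫ w, ext0 (fnL u) w * fderiv ℝ ρ (y - w) e =
      - ∫ w in Ω, fnL u w * fderiv ℝ (fun w => ρ (y - w)) w e := by
    rw [← integral_neg, ← integral_indicator ho.measurableSet]
    refine integral_congr_ae (Eventually.of_forall fun w => ?_)
    by_cases hw : w ∈ Ω
    · simp only [ext0, Set.indicator_of_mem hw, hd]; ring
    · simp only [ext0, Set.indicator_of_notMem hw, zero_mul]
  have hi : Integrable (fun w => ρ (y - w) • ext0 (gradL u) w) := by
    refine ((ext0_locallyIntegrable ho (gradL u)).integrable_smul_left_of_hasCompactSupport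
      hsm.continuous htest.compact)
  have e2 : inner ℝ (moll ρ (ext0 (gradL u)) y) e =
      ∫ w in Ω, inner ℝ (gradL u w) e * ρ (y - w) := by
    rw [moll, real_inner_comm, ← integral_inner hi, ← integral_indicator ho.measurableSet]
    refine integral_congr_ae (Eventually.of_forall fun w => ?_)
    by_cases hw : w ∈ Ω
    · simp only [ext0, Set.indicator_of_mem hw, real_inner_smul_right]
      rw [real_inner_comm, mul_comm]
    · simp only [ext0, Set.indicator_of_notMem hw, smul_zero, inner_zero_right]
  rw [e1, h, e2, neg_neg]

/-- The elements of `W^{1,2}(Ω)` given by functions that are smooth on `ℝ^N`. -/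
def smoothSubmodule (Ω : Set (E N)) : Submodule ℝ (WS Ω) where
  carrier := {u | ∃ φ : E N → ℝ, ContDiff ℝ ∞ φ ∧ fnL u =ᵐ[volume.restrict Ω] φ}
  zero_mem' := ⟨0, contDiff_const, Lp.coeFn_zero ℝ 2 (volume.restrict Ω)⟩
  add_mem' := by
    rintro u v ⟨φ, hφ, hu⟩ ⟨ψ, hψ, hv⟩
    exact ⟨φ + ψ, hφ.add hψ, (Lp.coeFn_add (fnL u) (fnL v)).trans (hu.add hv)⟩
  smul_mem' := by
    rintro c u ⟨φ, hφ, hu⟩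
    refine ⟨fun x => c * φ x, contDiff_const.mul hφ, ?_⟩
    filter_upwards [Lp.coeFn_smul c (fnL u), hu] with x h1 h2
    have h3 : (fnL (c • u) : E N → ℝ) x = (c • (fnL u) : L2 Ω) x := rfl
    rw [h3, h1]
    simp [h2]

lemma smoothW_mem (ho : IsOpen Ω) (hb : Bornology.IsBounded Ω) {φ : E N → ℝ}
    (hφ : ContDiff ℝ ∞ φ) : smoothW ho hb hφ ∈ smoothSubmodule Ω :=
  ⟨φ, hφ, fn_smoothW ho hb hφ⟩

/-- The distance in `L²(Ω)` of a translated mollification, bounded by the modulus of continuity of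
translations. -/
lemma norm_toLp_moll_sub_le [NormedSpace ℝ F] [CompleteSpace F] (ho : IsOpen Ω)
    {ρ : E N → ℝ} {ε : ℝ} (hρ : IsMollifier ρ ε)
    (u : Lp F 2 (volume.restrict Ω)) (h : E N)
    (hm : MemLp (fun x => moll ρ (ext0 u) (x + h)) 2 (volume.restrict Ω)) {δ c : ℝ} (hc : 0 ≤ c)
    (hδ : ∀ w : E N, ‖w‖ < δ →
      eLpNorm (fun x => ext0 u (x + w) - ext0 u x) 2 volume ≤ ENNReal.ofReal c)
    (hsmall : ‖h‖ + ε < δ) : ‖hm.toLp _ - u‖ ≤ c := by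
  rw [Lp.norm_def]
  refine ENNReal.toReal_le_of_le_ofReal hc ?_
  have h1 : ((hm.toLp _ - u : Lp F 2 (volume.restrict Ω)) : E N → F) =ᵐ[volume.restrict Ω]
      fun x => moll ρ (ext0 u) (x + h) - ext0 u x := by
    filter_upwards [Lp.coeFn_sub (hm.toLp _) u, hm.coeFn_toLp, ext0_ae_eq ho u] with x a1 a2 a3
    rw [a1, Pi.sub_apply, a2, a3]
  rw [eLpNorm_congr_ae h1]
  refine eLpNorm_moll_sub_le hρ (ext0_stronglyMeasurable ho u) (ext0_memLp ho u) Ω h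
    fun z hz => ?_
  refine (eLpNorm_mono_measure _ Measure.restrict_le_self).trans ?_
  have h2 := hδ (h - z) (lt_of_le_of_lt ((norm_sub_le _ _).trans (by linarith)) hsmall)
  simpa only [add_sub_assoc] using h2

/-- Near the boundary, translating along the cone direction and mollifying gives smooth
approximations. -/
lemma exists_smooth_approx (ho : IsOpen Ω) (hb : Bornology.IsBounded Ω) {B : Set (E N)}
    {e : E N} {η t₀ : ℝ} (hp : IsConePatch Ω B e η t₀) {ζ : E N → ℝ} (hζ : ContDiff ℝ ∞ ζ)
    (hB : tsupport ζ ⊆ B) (u : WS Ω) {ε : ℝ} (hε : 0 < ε) :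
    ∃ (m : E N → ℝ) (hm : ContDiff ℝ ∞ m), ‖mulW ho hb hζ (smoothW ho hb hm - u)‖ < ε := by
  obtain ⟨S₁, S₂, S₃, h₁, h₂, h₃⟩ : ∃ (S₁ : L2 Ω →L[ℝ] L2 Ω) (S₂ : L2Vec Ω →L[ℝ] L2Vec Ω)
      (S₃ : L2 Ω →L[ℝ] L2Vec Ω), (∀ v, fnL (mulW ho hb hζ v) = S₁ (fnL v)) ∧
      (∀ v, gradL (mulW ho hb hζ v) = S₂ (gradL v) + S₃ (fnL v)) ∧
      ∀ G, S₂ G =ᵐ[volume.restrict Ω] fun x => ζ x • G x :=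
    ⟨_, _, _, fn_mulW ho hb hζ, grad_mulW ho hb hζ, sField_coeFn ho hb hζ.continuous⟩
  obtain ⟨K, hK⟩ : ∃ K, K = ‖S₁‖ + ‖S₂‖ + ‖S₃‖ + 1 := ⟨_, rfl⟩
  have hK0 : 0 < K := by rw [hK]; positivity
  obtain ⟨c, hc⟩ : ∃ c, c = ε / (2 * K) := ⟨_, rfl⟩
  have hc0 : 0 < c := by rw [hc]; positivity
  obtain ⟨δ₁, hδ₁, H₁⟩ := exists_translation_le (ext0_memLp ho (fnL u)) hc0
  obtain ⟨δ₂, hδ₂, H₂⟩ := exists_translation_le (ext0_memLp ho (gradL u)) hc0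
  obtain ⟨t, ht0, ht1, ht2⟩ : ∃ t : ℝ, 0 < t ∧ t < t₀ ∧ t * (‖e‖ + η) < min δ₁ δ₂ := by
    have hη := hp.eta_pos
    have hd : 0 < min δ₁ δ₂ := lt_min hδ₁ hδ₂
    have hq : 0 < ‖e‖ + η := by positivity
    refine ⟨min (t₀ / 2) (min δ₁ δ₂ / (2 * (‖e‖ + η))), ?_, ?_, ?_⟩
    · exact lt_min (half_pos hp.height_pos) (by positivity)
    · exact (min_le_left _ _).trans_lt (half_lt_self hp.height_pos)
    · calc _ ≤ min δ₁ δ₂ / (2 * (‖e‖ + η)) * (‖e‖ + η) := by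
            gcongr; exact min_le_right _ _
        _ = min δ₁ δ₂ / 2 := by field_simp
        _ < _ := half_lt_self hd
  have hηt : 0 < η * t := mul_pos hp.eta_pos ht0
  obtain ⟨ρ, hρ⟩ := exists_isMollifier N hηt
  obtain ⟨h, hh⟩ : ∃ h, h = t • e := ⟨_, rfl⟩
  have hnh : ‖h‖ + η * t < min δ₁ δ₂ := by
    rw [hh, norm_smul, Real.norm_eq_abs, abs_of_pos ht0]
    linarith
  obtain ⟨m, hm⟩ : ∃ m : E N → ℝ, m = fun x => moll ρ (ext0 (fnL u)) (x + h) := ⟨_, rfl⟩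
  have hms : ContDiff ℝ ∞ m := by
    rw [hm]
    exact (contDiff_moll hρ (ext0_locallyIntegrable ho (fnL u))).comp (contDiff_id.add contDiff_const)
  have hm2 : MemLp m 2 (volume.restrict Ω) := memLp_of_continuous ho hb hms.continuous
  have hM2 : MemLp (fun x => moll ρ (ext0 (gradL u)) (x + h)) 2 (volume.restrict Ω) :=
    memLp_of_continuous ho hb ((continuous_moll hρ (ext0_locallyIntegrable ho (gradL u))).comp
      (continuous_id.add continuous_const))
  have hP : ‖hm2.toLp _ - fnL u‖ ≤ c := by
    subst hm
    exact norm_toLp_moll_sub_le ho hρ (fnL u) h hm2 hc0.le H₁ (hnh.trans_le (min_le_left _ _))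
  have hQ : ‖hM2.toLp _ - gradL u‖ ≤ c :=
    norm_toLp_moll_sub_le ho hρ (gradL u) h hM2 hc0.le H₂ (hnh.trans_le (min_le_right _ _))
  have hS : S₂ (gradL (smoothW ho hb hms)) = S₂ (hM2.toLp _) := by
    refine Lp.ext ?_
    filter_upwards [h₃ (gradL (smoothW ho hb hms)), h₃ (hM2.toLp _), grad_smoothW ho hb hms, hM2.coeFn_toLp,
      ae_restrict_mem ho.measurableSet] with x a1 a2 a3 a4 hx
    refine a1.trans (Eq.trans ?_ a2.symm)
    by_cases hζx : ζ x = 0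
    · simp only [hζx, zero_smul]
    · have hxB : x ∈ B := hB (subset_tsupport _ hζx)
      refine congrArg (ζ x • ·) (a3.trans (Eq.trans ?_ a4.symm))
      refine ext_inner_right ℝ fun v => ?_
      rw [inner_gradient, ← fderiv_moll_ext0 ho hρ u (fun y hy => ?_) v]
      · rw [hm, fderiv_comp_add_right]
      · rw [Metric.mem_closedBall, dist_eq_norm] at hy
        have := hp.mem x ⟨subset_closure hx, hxB⟩ t ht0 ht1 (y - (x + h)) hy
        rwa [← hh, add_sub_cancel] at this
  refine ⟨m, hms, ?_⟩
  have hgr : gradL (mulW ho hb hζ (smoothW ho hb hms - u)) =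
      S₂ (hM2.toLp _ - gradL u) + S₃ (hm2.toLp _ - fnL u) := by
    have e1 : S₂ (hM2.toLp _ - gradL u) = S₂ (gradL (smoothW ho hb hms)) - S₂ (gradL u) :=
      (map_sub S₂ _ _).trans (congrArg (· - S₂ (gradL u)) hS.symm)
    have e2 : S₂ (gradL (smoothW ho hb hms - u)) = S₂ (gradL (smoothW ho hb hms)) - S₂ (gradL u) :=
      map_sub S₂ _ _
    exact (h₂ _).trans (congrArg (· + S₃ (hm2.toLp _ - fnL u)) (e2.trans e1.symm))
  calc ‖mulW ho hb hζ (smoothW ho hb hms - u)‖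
      ≤ ‖S₁ (hm2.toLp _ - fnL u)‖ + ‖S₂ (hM2.toLp _ - gradL u) + S₃ (hm2.toLp _ - fnL u)‖ := by
        exact (norm_WS_le _).trans (add_le_add (le_of_eq (congrArg norm (h₁ _)))
          (le_of_eq (congrArg norm hgr)))
    _ ≤ ‖S₁‖ * c + (‖S₂‖ * c + ‖S₃‖ * c) := by
        refine add_le_add ((S₁.le_opNorm _).trans (by gcongr)) ((norm_add_le _ _).trans
          (add_le_add ((S₂.le_opNorm _).trans (by gcongr)) ((S₃.le_opNorm _).trans (by gcongr))))
    _ ≤ K * c := by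
        have : K * c = ‖S₁‖ * c + ‖S₂‖ * c + ‖S₃‖ * c + c := by rw [hK]; ring
        linarith
    _ = ε / 2 := by rw [hc]; field_simp
    _ < ε := half_lt_self hε

lemma mulW_mem_closure_smooth (ho : IsOpen Ω) (hb : Bornology.IsBounded Ω) {B : Set (E N)}
    {e : E N} {η t₀ : ℝ} (hp : IsConePatch Ω B e η t₀) {ζ : E N → ℝ} (hζ : ContDiff ℝ ∞ ζ)
    (hB : tsupport ζ ⊆ B) (u : WS Ω) :
    mulW ho hb hζ u ∈ (smoothSubmodule Ω).topologicalClosure := by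
  rw [← SetLike.mem_coe, Submodule.topologicalClosure_coe, Metric.mem_closure_iff]
  intro ε hε
  have ⟨m, hm, h⟩ := exists_smooth_approx ho hb hp hζ hB u hε
  refine ⟨smoothW ho hb (hζ.mul hm), smoothW_mem ho hb _, ?_⟩
  have hd : dist (mulW ho hb hζ u) (smoothW ho hb (hζ.mul hm)) =
      ‖mulW ho hb hζ (smoothW ho hb hm - u)‖ := by
    have e1 := map_sub (mulW ho hb hζ) (smoothW ho hb hm) u
    have e2 := mulW_smoothW ho hb hζ hm
    exact (dist_comm _ _).trans ((dist_eq_norm _ _).trans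
      (congrArg norm ((congrArg (· - mulW ho hb hζ u) e2.symm).trans e1.symm)))
  exact hd.trans_lt h

/-- A smooth partition of unity on `closure Ω` whose members are supported in cone patches. -/
lemma exists_cone_partition (hΩ : IsBoundedLipschitzDomain Ω) :
    ∃ (s : Finset (E N)) (f : s → E N → ℝ), (∀ i, ContDiff ℝ ∞ (f i)) ∧
      (∀ x ∈ closure Ω, ∑ i, f i x = 1) ∧
      ∀ i, ∃ (B : Set (E N)) (e : E N) (η t₀ : ℝ), IsConePatch Ω B e η t₀ ∧ tsupport (f i) ⊆ B := by
  have hpatch : ∀ x : E N, ∃ r > 0, x ∈ closure Ω → ∃ (e : E N) (η t₀ : ℝ),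
      IsConePatch Ω (Metric.ball x r) e η t₀ := fun x => by
    by_cases hx : x ∈ closure Ω
    · obtain ⟨r, hr, h⟩ := exists_conePatch hΩ hx
      exact ⟨r, hr, fun _ => h⟩
    · exact ⟨1, one_pos, fun h => absurd h hx⟩
  choose r hr hpr using hpatch
  obtain ⟨s, hs, hcov⟩ := hΩ.isBounded.isCompact_closure.elim_nhds_subcover
    (fun x => Metric.ball x (r x)) (fun x _ => Metric.ball_mem_nhds x (hr x))
  obtain ⟨f, hf⟩ := SmoothPartitionOfUnity.exists_isSubordinate (modelWithCornersSelf ℝ (E N))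
    isClosed_closure (fun i : s => Metric.ball (i : E N) (r i)) (fun i => Metric.isOpen_ball)
    (fun x hx => by simpa using hcov hx)
  refine ⟨s, fun i => f i, fun i => (f i).contMDiff.contDiff, fun x hx => ?_, fun i => ?_⟩
  · rw [← finsum_eq_sum_of_fintype]
    exact f.sum_eq_one hx
  · obtain ⟨e, η, t₀, hp⟩ := hpr i (hs i i.2)
    exact ⟨_, e, η, t₀, hp, hf i⟩

/-- Smooth functions are dense in `W^{1,2}(Ω)`. -/
theorem smooth_dense (hΩ : IsBoundedLipschitzDomain Ω) :
    (smoothSubmodule Ω).topologicalClosure = ⊤ := by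
  have ho := hΩ.isOpen
  have hb := hΩ.isBounded
  obtain ⟨s, f, hsm, hsum, hpatch⟩ := exists_cone_partition hΩ
  rw [eq_top_iff]
  rintro u -
  have hu : u = ∑ i : s, mulW ho hb (hsm i) u := by
    refine WS_ext ho hb ?_
    have h1 : fnL (∑ i : s, mulW ho hb (hsm i) u) = ∑ i : s, fnL (mulW ho hb (hsm i) u) :=
      map_sum (fnL) _ _
    rw [h1]
    refine Lp.ext ?_
    have a1 := Lp.coeFn_finsetSum Finset.univ (fun i : s => fnL (mulW ho hb (hsm i) u))
    have a2 := ae_all_iff.2 fun i : s => fn_mulW_ae ho hb (hsm i) u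
    generalize (∑ i : s, fnL (mulW ho hb (hsm i) u)) = S at a1 ⊢
    filter_upwards [a1, a2, ae_restrict_mem ho.measurableSet] with x b1 b2 hx
    rw [b1, Finset.sum_apply, Finset.sum_congr rfl (fun i _ => b2 i), ← Finset.sum_mul,
      hsum x (subset_closure hx), one_mul]
  rw [hu]
  refine Submodule.sum_mem _ fun i _ => ?_
  have ⟨B, e, η, t₀, hp, hB⟩ := hpatch i
  exact mulW_mem_closure_smooth ho hb hp (hsm i) hB u

/-- A closed property of Sobolev functions holds if it holds for smooth functions. -/
lemma induction_smooth (hΩ : IsBoundedLipschitzDomain Ω) {p : WS Ω → Prop}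
    (hp : IsClosed {u | p u})
    (h : ∀ φ : E N → ℝ, ∀ hφ : ContDiff ℝ ∞ φ, p (smoothW hΩ.isOpen hΩ.isBounded hφ))
    (u : WS Ω) : p u := by
  have hu : u ∈ closure (smoothSubmodule Ω : Set (WS Ω)) := by
    rw [← Submodule.topologicalClosure_coe, smooth_dense hΩ]; trivial
  refine closure_minimal ?_ hp hu
  rintro v ⟨φ, hφ, hv⟩
  rw [eq_smoothW hΩ.isOpen hΩ.isBounded hφ hv]
  exact h φ hφ

/-- The product of a Sobolev function with a test function belongs to `W^{1,2}_0(Ω)`. -/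
lemma mulW_mem_W0 (hΩ : IsBoundedLipschitzDomain Ω) {ζ : E N → ℝ} (hζ : IsTest Ω ζ)
    (u : WS Ω) : mulW hΩ.isOpen hΩ.isBounded hζ.smooth u ∈ W0 Ω := by
  refine induction_smooth hΩ (p := fun u => mulW hΩ.isOpen hΩ.isBounded hζ.smooth u ∈ W0 Ω)
    (isClosed_W0.preimage (mulW hΩ.isOpen hΩ.isBounded hζ.smooth).continuous) (fun φ hφ => ?_) u
  rw [mulW_smoothW]
  have ht : IsTest Ω (fun x => ζ x * φ x) := by
    have := IsTest.mul hφ hζ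
    simpa only [mul_comm] using this
  exact test_mem_W0 hΩ.isOpen hΩ.isBounded ht

end Density

/-! ### Translations of Sobolev functions and Rellich's theorem -/

/-- Jensen's inequality for the square and a probability measure. -/
lemma lintegral_rpow_two_le {X : Type*} [MeasurableSpace X] {ν : Measure X}
    [IsProbabilityMeasure ν] {f : X → ENNReal} (hf : AEMeasurable f ν) :
    (∫⁻ x, f x ∂ν) ^ (2 : ℝ) ≤ ∫⁻ x, f x ^ (2 : ℝ) ∂ν := by
  have h := ENNReal.lintegral_mul_le_Lp_mul_Lq ν Real.HolderConjugate.two_two hf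
    (aemeasurable_const (b := (1 : ENNReal)))
  simp only [Pi.mul_apply, mul_one, ENNReal.one_rpow, lintegral_const, measure_univ] at h
  calc _ ≤ ((∫⁻ x, f x ^ (2 : ℝ) ∂ν) ^ ((1 : ℝ) / 2)) ^ (2 : ℝ) := by gcongr
    _ = _ := by rw [← ENNReal.rpow_mul]; norm_num

section Translation

variable {N : ℕ} {Ω : Set (E N)}

lemma norm_gradient_eq (φ : E N → ℝ) (x : E N) : ‖gradient φ x‖ = ‖fderiv ℝ φ x‖ := by
  rw [gradient, LinearIsometryEquiv.norm_map]

/-- The fundamental theorem of calculus along a segment. -/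
lemma enorm_sub_le_lintegral {φ : E N → ℝ} (hφ : ContDiff ℝ ∞ φ) (x h : E N) :
    ‖φ (x + h) - φ x‖ₑ ≤
      ∫⁻ s in Set.Ioc (0 : ℝ) 1, ‖gradient φ (x + s • h)‖ₑ * ‖h‖ₑ := by
  have hd : ∀ s ∈ Set.uIcc (0 : ℝ) 1, HasDerivAt (fun s : ℝ => φ (x + s • h))
      (fderiv ℝ φ (x + s • h) h) s := fun s _ => by
    have h1 : HasDerivAt (fun s : ℝ => x + s • h) h s := by
      simpa using ((hasDerivAt_id s).smul_const h).const_add x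
    exact (hφ.differentiable (by simp) (x + s • h)).hasFDerivAt.comp_hasDerivAt s h1
  have hc : Continuous fun s : ℝ => fderiv ℝ φ (x + s • h) h :=
    ((hφ.continuous_fderiv (by simp)).comp (by fun_prop)).clm_apply continuous_const
  have h1 := intervalIntegral.integral_eq_sub_of_hasDerivAt hd (hc.intervalIntegrable 0 1)
  simp only [one_smul, zero_smul, add_zero] at h1
  rw [← h1, intervalIntegral.integral_of_le zero_le_one]
  refine (enorm_integral_le_lintegral_enorm _).trans (lintegral_mono fun s => ?_)
  rw [← ofReal_norm, ← ofReal_norm, ← ofReal_norm,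
    ← ENNReal.ofReal_mul (norm_nonneg _), norm_gradient_eq]
  exact ENNReal.ofReal_le_ofReal (ContinuousLinearMap.le_opNorm _ _)

lemma lintegral_translate_le {D Ω' : Set (E N)} (hD : MeasurableSet D) (hΩ : MeasurableSet Ω')
    {h : E N} (hsub : ∀ x ∈ D, x + h ∈ Ω') (g : E N → ENNReal) :
    ∫⁻ x in D, g (x + h) ≤ ∫⁻ x in Ω', g x := by
  rw [← lintegral_indicator hD, ← lintegral_indicator hΩ,
    ← lintegral_add_right_eq_self (Ω'.indicator g) h]
  refine lintegral_mono fun x => ?_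
  by_cases hx : x ∈ D
  · rw [Set.indicator_of_mem hx, Set.indicator_of_mem (hsub x hx)]
  · rw [Set.indicator_of_notMem hx]; exact zero_le

lemma eLpNorm_two_eq {F : Type*} [NormedAddCommGroup F] {X : Type*} [MeasurableSpace X]
    (f : X → F) (μ : Measure X) :
    eLpNorm f 2 μ = (∫⁻ x, ‖f x‖ₑ ^ (2 : ℝ) ∂μ) ^ ((1 : ℝ) / 2) := by
  rw [eLpNorm_eq_lintegral_rpow_enorm_toReal (by norm_num) (by norm_num)]
  simp

lemma rpow_two_half (a : ENNReal) : (a ^ (2 : ℝ)) ^ ((1 : ℝ) / 2) = a := by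
  rw [← ENNReal.rpow_mul]; norm_num

lemma rpow_half_two (a : ENNReal) : (a ^ ((1 : ℝ) / 2)) ^ (2 : ℝ) = a := by
  rw [← ENNReal.rpow_mul]; norm_num

lemma lintegral_rpow_two_eq {F : Type*} [NormedAddCommGroup F] {X : Type*} [MeasurableSpace X]
    (f : X → F) (μ : Measure X) :
    ∫⁻ x, ‖f x‖ₑ ^ (2 : ℝ) ∂μ = eLpNorm f 2 μ ^ (2 : ℝ) := by
  rw [eLpNorm_two_eq, rpow_half_two]

lemma eLpNorm_translate_smooth_le {φ : E N → ℝ} (hφ : ContDiff ℝ ∞ φ) {D : Set (E N)}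
    (hD : MeasurableSet D) (ho : IsOpen Ω) {h : E N}
    (hsub : ∀ x ∈ D, ∀ s ∈ Set.Icc (0 : ℝ) 1, x + s • h ∈ Ω) :
    eLpNorm (fun x => φ (x + h) - φ x) 2 (volume.restrict D) ≤
      ‖h‖ₑ * eLpNorm (gradient φ) 2 (volume.restrict Ω) := by
  have hprob : IsProbabilityMeasure (volume.restrict (Set.Ioc (0 : ℝ) 1)) :=
    ⟨by rw [Measure.restrict_apply_univ]; simp⟩
  have hcg := continuous_gradient hφ
  have hm : Measurable fun p : E N × ℝ => ‖gradient φ (p.1 + p.2 • h)‖ₑ ^ (2 : ℝ) := by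
    have : Continuous fun p : E N × ℝ => gradient φ (p.1 + p.2 • h) := hcg.comp (by fun_prop)
    exact this.measurable.enorm.pow_const _
  have key : ∫⁻ x in D, ‖φ (x + h) - φ x‖ₑ ^ (2 : ℝ) ≤
      ‖h‖ₑ ^ (2 : ℝ) * ∫⁻ x in Ω, ‖gradient φ x‖ₑ ^ (2 : ℝ) := by
    calc ∫⁻ x in D, ‖φ (x + h) - φ x‖ₑ ^ (2 : ℝ)
        ≤ ∫⁻ x in D, ∫⁻ s in Set.Ioc (0 : ℝ) 1,
            ‖h‖ₑ ^ (2 : ℝ) * ‖gradient φ (x + s • h)‖ₑ ^ (2 : ℝ) := by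
          refine lintegral_mono fun x => ?_
          have hmx : Measurable fun s : ℝ => ‖gradient φ (x + s • h)‖ₑ * ‖h‖ₑ := by
            have : Continuous fun s : ℝ => gradient φ (x + s • h) := hcg.comp (by fun_prop)
            exact this.measurable.enorm.mul_const _
          calc _ ≤ (∫⁻ s in Set.Ioc (0 : ℝ) 1, ‖gradient φ (x + s • h)‖ₑ * ‖h‖ₑ) ^ (2 : ℝ) := by
                gcongr; exact enorm_sub_le_lintegral hφ x h
            _ ≤ ∫⁻ s in Set.Ioc (0 : ℝ) 1, (‖gradient φ (x + s • h)‖ₑ * ‖h‖ₑ) ^ (2 : ℝ) :=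
                lintegral_rpow_two_le hmx.aemeasurable
            _ = _ := by
                refine lintegral_congr fun s => ?_
                rw [ENNReal.mul_rpow_of_nonneg _ _ (by norm_num), mul_comm]
      _ = ∫⁻ s in Set.Ioc (0 : ℝ) 1, ∫⁻ x in D,
            ‖h‖ₑ ^ (2 : ℝ) * ‖gradient φ (x + s • h)‖ₑ ^ (2 : ℝ) :=
          lintegral_lintegral_swap (hm.const_mul _).aemeasurable
      _ ≤ ∫⁻ s in Set.Ioc (0 : ℝ) 1, ‖h‖ₑ ^ (2 : ℝ) * ∫⁻ x in Ω, ‖gradient φ x‖ₑ ^ (2 : ℝ) := by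
          refine setLIntegral_mono measurable_const fun s hs => ?_
          rw [lintegral_const_mul' _ _ (by simp)]
          refine mul_le_mul_right ?_ _
          exact lintegral_translate_le hD ho.measurableSet
            (fun x hx => hsub x hx s ⟨hs.1.le, hs.2⟩) (fun y => ‖gradient φ y‖ₑ ^ (2 : ℝ))
      _ = _ := by simp
  rw [eLpNorm_two_eq, eLpNorm_two_eq]
  calc _ ≤ (‖h‖ₑ ^ (2 : ℝ) * ∫⁻ x in Ω, ‖gradient φ x‖ₑ ^ (2 : ℝ)) ^ ((1 : ℝ) / 2) := by gcongr
    _ = _ := by rw [ENNReal.mul_rpow_of_nonneg _ _ (by norm_num), rpow_two_half]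

lemma eLpNorm_coe_eq {F : Type*} [NormedAddCommGroup F] {X : Type*} [MeasurableSpace X]
    {μ : Measure X} (f : Lp F 2 μ) : eLpNorm f 2 μ = ENNReal.ofReal ‖f‖ := by
  rw [Lp.norm_def, ENNReal.ofReal_toReal (Lp.memLp f).eLpNorm_ne_top]

/-- Difference quotients of Sobolev functions are controlled by the gradient. -/
lemma eLpNorm_translate_le (hΩ : IsBoundedLipschitzDomain Ω) (u : WS Ω) {D : Set (E N)}
    (hD : MeasurableSet D) {h : E N} (hsub : ∀ x ∈ D, ∀ s ∈ Set.Icc (0 : ℝ) 1, x + s • h ∈ Ω) :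
    eLpNorm (fun x => ext0 (fnL u) (x + h) - ext0 (fnL u) x) 2 (volume.restrict D) ≤
      ENNReal.ofReal (‖h‖ * ‖gradL u‖) := by
  have ho := hΩ.isOpen
  have hDΩ : ∀ x ∈ D, x ∈ Ω := fun x hx => by
    simpa using hsub x hx 0 ⟨le_rfl, zero_le_one⟩
  have hDΩ' : ∀ x ∈ D, x + h ∈ Ω := fun x hx => by
    simpa using hsub x hx 1 ⟨zero_le_one, le_rfl⟩
  have hqmp : ∀ {p : E N → Prop}, (∀ᵐ x ∂volume.restrict Ω, p x) →
      ∀ᵐ x ∂volume.restrict D, p (x + h) := fun {p} hp => by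
    rw [ae_restrict_iff' ho.measurableSet] at hp
    rw [ae_restrict_iff' hD]
    filter_upwards [(measurePreserving_add_right volume h).quasiMeasurePreserving.ae hp]
      with x hx hxD
    exact hx (hDΩ' x hxD)
  have hD0 : ∀ {p : E N → Prop}, (∀ᵐ x ∂volume.restrict Ω, p x) →
      ∀ᵐ x ∂volume.restrict D, p x := fun {p} hp => ae_mono (Measure.restrict_mono hDΩ le_rfl) hp
  -- the bound for smooth functions
  have hsm : ∀ φ : E N → ℝ, ∀ hφ : ContDiff ℝ ∞ φ,
      eLpNorm (fun x => ext0 (fnL (smoothW ho hΩ.isBounded hφ)) (x + h) -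
        ext0 (fnL (smoothW ho hΩ.isBounded hφ)) x) 2 (volume.restrict D) ≤
      ENNReal.ofReal (‖h‖ * ‖gradL (smoothW ho hΩ.isBounded hφ)‖) := fun φ hφ => by
    have e1 := (ext0_ae_eq ho (fnL (smoothW ho hΩ.isBounded hφ))).trans
      (fn_smoothW ho hΩ.isBounded hφ)
    have e2 : (fun x => ext0 (fnL (smoothW ho hΩ.isBounded hφ)) (x + h) -
        ext0 (fnL (smoothW ho hΩ.isBounded hφ)) x) =ᵐ[volume.restrict D]
        fun x => φ (x + h) - φ x := by
      filter_upwards [hqmp e1, hD0 e1] with x h1 h2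
      rw [h1, h2]
    rw [eLpNorm_congr_ae e2, ENNReal.ofReal_mul (norm_nonneg _), ofReal_norm,
      ← eLpNorm_coe_eq, eLpNorm_congr_ae (grad_smoothW ho hΩ.isBounded hφ)]
    exact eLpNorm_translate_smooth_le hφ hD ho hsub
  -- a crude bound, used to pass to the limit
  have hcrude : ∀ v : WS Ω, eLpNorm (fun x => ext0 (fnL v) (x + h) - ext0 (fnL v) x) 2
      (volume.restrict D) ≤ ENNReal.ofReal (2 * ‖v‖) := fun v => by
    have hs := ext0_stronglyMeasurable ho (fnL v)
    have hs' : StronglyMeasurable fun x => ext0 (fnL v) (x + h) :=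
      hs.comp_measurable (measurable_add_const h)
    have hb : eLpNorm (ext0 (fnL v)) 2 volume = ENNReal.ofReal ‖fnL v‖ := by
      rw [← eLpNorm_coe_eq, ext0, eLpNorm_indicator_eq_eLpNorm_restrict ho.measurableSet]
    refine (eLpNorm_mono_measure _ Measure.restrict_le_self).trans ?_
    refine (eLpNorm_sub_le hs'.aestronglyMeasurable hs.aestronglyMeasurable (by norm_num)).trans ?_
    have h2 : eLpNorm (fun x => ext0 (fnL v) (x + h)) 2 volume = ENNReal.ofReal ‖fnL v‖ := by
      rw [← hb]
      exact eLpNorm_comp_measurePreserving hs.aestronglyMeasurable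
        (measurePreserving_add_right volume h)
    rw [h2, hb, ← ENNReal.ofReal_add (norm_nonneg _) (norm_nonneg _)]
    exact ENNReal.ofReal_le_ofReal (by linarith [norm_fnL_le v])
  refine induction_smooth hΩ (p := fun u =>
    eLpNorm (fun x => ext0 (fnL u) (x + h) - ext0 (fnL u) x) 2 (volume.restrict D) ≤
      ENNReal.ofReal (‖h‖ * ‖gradL u‖)) ?_ hsm u
  refine isClosed_of_closure_subset fun v hv => ?_
  refine ENNReal.le_of_forall_pos_le_add fun ε hε _ => ?_
  obtain ⟨δ, hδ0, hδ⟩ : ∃ δ : ℝ, 0 < δ ∧ (2 + ‖h‖) * δ ≤ ε := by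
    refine ⟨ε / (2 + ‖h‖), by positivity, le_of_eq ?_⟩
    field_simp
  obtain ⟨w, hw, hvw⟩ := Metric.mem_closure_iff.1 hv δ hδ0
  rw [dist_eq_norm] at hvw
  have hae : ext0 (fnL v) =ᵐ[volume.restrict Ω] fun x => ext0 (fnL (v - w)) x + ext0 (fnL w) x := by
    have e0 : fnL (v - w) = fnL v - fnL w := map_sub _ _ _
    filter_upwards [ext0_ae_eq ho (fnL v), ext0_ae_eq ho (fnL w), ext0_ae_eq ho (fnL (v - w)),
      Lp.coeFn_sub (fnL v) (fnL w)] with x h1 h2 h3 h4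
    rw [h1, h2, h3, e0, h4, Pi.sub_apply]
    ring
  have hae2 : (fun x => ext0 (fnL v) (x + h) - ext0 (fnL v) x) =ᵐ[volume.restrict D]
      (fun x => ext0 (fnL (v - w)) (x + h) - ext0 (fnL (v - w)) x) +
        fun x => ext0 (fnL w) (x + h) - ext0 (fnL w) x := by
    filter_upwards [hqmp hae, hD0 hae] with x h1 h2
    rw [h1, h2, Pi.add_apply]
    ring
  have hms : ∀ v : WS Ω, AEStronglyMeasurable
      (fun x => ext0 (fnL v) (x + h) - ext0 (fnL v) x) (volume.restrict D) := fun v =>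
    (((ext0_stronglyMeasurable ho (fnL v)).comp_measurable (measurable_add_const h)).sub
      (ext0_stronglyMeasurable ho (fnL v))).aestronglyMeasurable
  rw [eLpNorm_congr_ae hae2]
  have hg : ‖gradL w‖ ≤ ‖gradL v‖ + δ := by
    have : gradL w = gradL v - gradL (v - w) := by rw [map_sub]; abel
    rw [this]
    exact (norm_sub_le _ _).trans (by linarith [norm_gradL_le (v - w)])
  calc _ ≤ ENNReal.ofReal (2 * ‖v - w‖) + ENNReal.ofReal (‖h‖ * ‖gradL w‖) :=
        (eLpNorm_add_le (hms _) (hms _) (by norm_num)).trans (add_le_add (hcrude _) hw)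
    _ ≤ ENNReal.ofReal (2 * δ) + ENNReal.ofReal (‖h‖ * (‖gradL v‖ + δ)) := by gcongr
    _ = ENNReal.ofReal (‖h‖ * ‖gradL v‖ + (2 + ‖h‖) * δ) := by
        rw [← ENNReal.ofReal_add (by positivity) (by positivity)]; congr 1; ring
    _ ≤ ENNReal.ofReal (‖h‖ * ‖gradL v‖ + ε) := ENNReal.ofReal_le_ofReal (by linarith)
    _ = _ := by rw [ENNReal.ofReal_add (by positivity) ε.coe_nonneg, ENNReal.ofReal_coe_nnreal]

end Translation

section Rellich

variable {ι : Type*} {N : ℕ} {Ω : Set (E N)}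

/-- A bounded weakly null family is uniformly null on compact sets. -/
lemma WeakLim.eventually_forall_mem {H : Type*} [NormedAddCommGroup H] [InnerProductSpace ℝ H]
    {U : Filter ι} {d : ι → H} (hd : WeakLim U d 0) {M : ℝ} (hM : ∀ i, ‖d i‖ ≤ M)
    {K : Set H} (hK : IsCompact K) {ε : ℝ} (hε : 0 < ε) :
    ∀ᶠ i in U, ∀ k ∈ K, |inner ℝ (d i) k| ≤ ε := by
  obtain ⟨δ, hδ0, hδ⟩ : ∃ δ : ℝ, 0 < δ ∧ |M| * δ ≤ ε / 2 := by
    refine ⟨ε / 2 / (|M| + 1), by positivity, ?_⟩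
    rw [mul_div_assoc', div_le_iff₀ (by positivity)]
    nlinarith [abs_nonneg M]
  obtain ⟨t, -, htf, hcov⟩ := hK.finite_cover_balls hδ0
  have h1 : ∀ᶠ i in U, ∀ k ∈ t, |inner ℝ (d i) k| < ε / 2 := by
    refine (eventually_all_finite htf).2 fun k _ => ?_
    have h2 := hd k
    rw [inner_zero_left] at h2
    have := (h2.abs).eventually_lt_const (u := ε / 2) (by rw [abs_zero]; positivity)
    exact this
  filter_upwards [h1] with i hi k hk
  obtain ⟨k', hk', hkk'⟩ := Set.mem_iUnion₂.1 (hcov hk)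
  rw [Metric.mem_ball, dist_eq_norm] at hkk'
  have e : inner ℝ (d i) k = inner ℝ (d i) k' + inner ℝ (d i) (k - k') := by
    rw [inner_sub_right]; ring
  rw [e]
  refine (abs_add_le _ _).trans ?_
  have h3 : |inner ℝ (d i) (k - k')| ≤ |M| * δ :=
    (abs_real_inner_le_norm _ _).trans
      (mul_le_mul ((hM i).trans (le_abs_self M)) hkk'.le (norm_nonneg _) (abs_nonneg _))
  linarith [hi k' hk']

/-- The kernel of a translated mollification, as an element of `L²(Ω)` depending continuously on
the point of evaluation. -/
lemma exists_kernel (ho : IsOpen Ω) (hb : Bornology.IsBounded Ω) {ρ : E N → ℝ} {ε : ℝ}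
    (hρ : IsMollifier ρ ε) : ∃ k : E N → L2 Ω, Continuous k ∧
      ∀ (u : L2 Ω) y, moll ρ (ext0 u) y = inner ℝ u (k y) := by
  have hfin := finite_restrict hb
  have hm : ∀ y, MemLp (fun w => ρ (y - w)) 2 (volume.restrict Ω) := fun y =>
    memLp_of_continuous ho hb (hρ.smooth.continuous.comp (by fun_prop))
  obtain ⟨L, hL⟩ := hρ.smooth.lipschitzWith_of_hasCompactSupport hρ.compact (by simp)
  refine ⟨fun y => (hm y).toLp _, ?_, fun u y => ?_⟩
  · refine LipschitzWith.continuous (K := measureUnivNNReal (volume.restrict Ω) ^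
      ((2 : ENNReal).toReal)⁻¹ * L) (LipschitzWith.of_dist_le_mul fun y z => ?_)
    rw [dist_eq_norm, ← MemLp.toLp_sub]
    have h1 := Lp.norm_le_of_ae_bound (f := ((hm y).sub (hm z)).toLp _)
      (C := L * dist y z) (by positivity) (by
      filter_upwards [((hm y).sub (hm z)).coeFn_toLp] with w hw
      rw [hw, Pi.sub_apply, ← dist_eq_norm]
      refine (hL.dist_le_mul _ _).trans_eq ?_
      rw [dist_sub_right])
    refine h1.trans_eq ?_
    rw [NNReal.coe_mul, NNReal.coe_rpow, mul_assoc]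
  · rw [moll, MeasureTheory.L2.inner_def, ← integral_indicator ho.measurableSet]
    have h1 : ∀ᵐ w, w ∈ Ω → (hm y).toLp _ w = ρ (y - w) :=
      (ae_restrict_iff' ho.measurableSet).1 (hm y).coeFn_toLp
    refine integral_congr_ae ?_
    filter_upwards [h1] with w hw
    by_cases hwΩ : w ∈ Ω
    · simp only [ext0, Set.indicator_of_mem hwΩ, hw hwΩ]
      simp
    · simp only [ext0, Set.indicator_of_notMem hwΩ, smul_zero]

/-- Rellich's theorem on a cone patch. -/
lemma tendsto_eLpNorm_patch (hΩ : IsBoundedLipschitzDomain Ω) {B : Set (E N)}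
    (hBm : MeasurableSet B) {e : E N} {η t₀ : ℝ} (hp : IsConePatch Ω B e η t₀) {U : Filter ι}
    {d : ι → WS Ω} (hd : WeakLim U d 0) {M : ℝ} (hM : ∀ i, ‖d i‖ ≤ M) :
    Tendsto (fun i => eLpNorm (fnL (d i)) 2 (volume.restrict (Ω ∩ B))) U (𝓝 0) := by
  have ho := hΩ.isOpen
  have hfin := finite_restrict hΩ.isBounded
  rw [ENNReal.tendsto_nhds_zero]
  intro ε hε
  by_cases hεt : ε = ⊤
  · rw [hεt]; simp
  obtain ⟨ε', hε', rfl⟩ : ∃ ε' : ℝ, 0 < ε' ∧ ENNReal.ofReal ε' = ε :=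
    ⟨ε.toReal, ENNReal.toReal_pos hε.ne' hεt, ENNReal.ofReal_toReal hεt⟩
  have hη := hp.eta_pos
  obtain ⟨t, ht0, ht1, ht2⟩ : ∃ t : ℝ, 0 < t ∧ t < t₀ ∧ t * (‖e‖ + η) * |M| ≤ ε' / 2 := by
    refine ⟨min (t₀ / 2) (ε' / 2 / ((‖e‖ + η) * (|M| + 1))), ?_, ?_, ?_⟩
    · exact lt_min (half_pos hp.height_pos) (by positivity)
    · exact (min_le_left _ _).trans_lt (half_lt_self hp.height_pos)
    · calc _ ≤ ε' / 2 / ((‖e‖ + η) * (|M| + 1)) * (‖e‖ + η) * (|M| + 1) := by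
            gcongr
            · exact min_le_right _ _
            · linarith
        _ = ε' / 2 := by field_simp
  have hηt : 0 < η * t := mul_pos hη ht0
  obtain ⟨ρ, hρ⟩ := exists_isMollifier N hηt
  obtain ⟨k, hkc, hk⟩ := exists_kernel ho hΩ.isBounded hρ
  have hDm : MeasurableSet (Ω ∩ B) := ho.measurableSet.inter hBm
  -- the mollification error
  have h1 : ∀ i, eLpNorm (fun x => moll ρ (ext0 (fnL (d i))) (x + t • e) - ext0 (fnL (d i)) x) 2
      (volume.restrict (Ω ∩ B)) ≤ ENNReal.ofReal (ε' / 2) := fun i => by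
    refine eLpNorm_moll_sub_le hρ (ext0_stronglyMeasurable ho _) (ext0_memLp ho _) _ _
      fun z hz => ?_
    have h2 := eLpNorm_translate_le hΩ (d i) hDm (h := t • e + -z)
      (fun x hx s hs => hp.segment_mem hx ht0 ht1 (by rwa [norm_neg]) hs)
    have h3 : ‖t • e + -z‖ * ‖gradL (d i)‖ ≤ ε' / 2 := by
      refine le_trans ?_ ht2
      have h4 : ‖t • e + -z‖ ≤ t * (‖e‖ + η) := by
        refine (norm_add_le _ _).trans ?_
        rw [norm_neg, norm_smul, Real.norm_eq_abs, abs_of_pos ht0]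
        linarith
      exact mul_le_mul h4 ((norm_gradL_le _).trans ((hM i).trans (le_abs_self M)))
        (norm_nonneg _) (by positivity)
    refine le_trans (le_of_eq ?_) (h2.trans (ENNReal.ofReal_le_ofReal h3))
    congr 1
    funext x
    rw [sub_eq_add_neg (x + t • e) z, add_assoc]
  -- the mollifications tend to zero uniformly
  obtain ⟨δ, hδ0, hδ⟩ : ∃ δ : ℝ, 0 < δ ∧
      volume.restrict (Ω ∩ B) Set.univ ^ ((2 : ENNReal).toReal)⁻¹ * ENNReal.ofReal δ ≤
        ENNReal.ofReal (ε' / 2) := by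
    have hfin2 : volume.restrict (Ω ∩ B) Set.univ ^ ((2 : ENNReal).toReal)⁻¹ ≠ ⊤ := by
      refine ENNReal.rpow_ne_top_of_nonneg (by simp) ?_
      rw [Measure.restrict_apply_univ]
      exact (measure_mono Set.inter_subset_left).trans_lt hΩ.isBounded.measure_lt_top |>.ne
    obtain ⟨c, hc⟩ : ∃ c : NNReal, (c : ENNReal) =
        volume.restrict (Ω ∩ B) Set.univ ^ ((2 : ENNReal).toReal)⁻¹ :=
      ⟨_, ENNReal.coe_toNNReal hfin2⟩
    refine ⟨ε' / 2 / (c + 1), by positivity, ?_⟩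
    rw [← hc, ← ENNReal.ofReal_coe_nnreal, ← ENNReal.ofReal_mul c.coe_nonneg]
    refine ENNReal.ofReal_le_ofReal ?_
    rw [mul_div_assoc', div_le_iff₀ (by positivity)]
    nlinarith [c.coe_nonneg]
  have hcomp : IsCompact ((fun x => k (x + t • e)) '' closure Ω) :=
    hΩ.isBounded.isCompact_closure.image (hkc.comp (by fun_prop))
  have hdf : WeakLim U (fun i => fnL (d i)) 0 := by simpa using hd.map fnL
  filter_upwards [hdf.eventually_forall_mem (fun i => (norm_fnL_le _).trans (hM i)) hcomp hδ0]
    with i hi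
  have h5 : eLpNorm (fun x => moll ρ (ext0 (fnL (d i))) (x + t • e)) 2
      (volume.restrict (Ω ∩ B)) ≤ ENNReal.ofReal (ε' / 2) := by
    refine (eLpNorm_le_of_ae_bound (C := δ) ?_).trans hδ
    refine (ae_restrict_iff' hDm).2 (Eventually.of_forall fun x hx => ?_)
    rw [hk]
    exact hi _ ⟨x, subset_closure hx.1, rfl⟩
  have hae : fnL (d i) =ᵐ[volume.restrict (Ω ∩ B)]
      (fun x => moll ρ (ext0 (fnL (d i))) (x + t • e)) -
      fun x => moll ρ (ext0 (fnL (d i))) (x + t • e) - ext0 (fnL (d i)) x := by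
    refine (ae_restrict_iff' hDm).2 (Eventually.of_forall fun x hx => ?_)
    rw [Pi.sub_apply, sub_sub_cancel, ext0_eq _ hx.1]
  have hmc : Continuous fun x => moll ρ (ext0 (fnL (d i))) (x + t • e) :=
    (continuous_moll hρ (ext0_locallyIntegrable ho _)).comp (by fun_prop)
  rw [eLpNorm_congr_ae hae]
  calc _ ≤ ENNReal.ofReal (ε' / 2) + ENNReal.ofReal (ε' / 2) :=
        (eLpNorm_sub_le hmc.aestronglyMeasurable (hmc.aestronglyMeasurable.sub
          (ext0_stronglyMeasurable ho _).aestronglyMeasurable) (by norm_num)).trans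
            (add_le_add h5 (h1 i))
    _ = ENNReal.ofReal ε' := by
        rw [← ENNReal.ofReal_add (by positivity) (by positivity), add_halves]

/-- Rellich's theorem: weak convergence in `W^{1,2}(Ω)` implies strong convergence in `L²(Ω)`. -/
theorem rellich (hΩ : IsBoundedLipschitzDomain Ω) {U : Filter ι} {u : ι → WS Ω} {u' : WS Ω}
    (h : WeakLim U u u') {M : ℝ} (hM : ∀ i, ‖u i‖ ≤ M) :
    Tendsto (fun i => fnL (u i)) U (𝓝 (fnL u')) := by
  have hd : WeakLim U (fun i => u i - u') 0 := by simpa using h.sub (WeakLim.const U u')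
  have hdM : ∀ i, ‖u i - u'‖ ≤ M + ‖u'‖ := fun i => (norm_sub_le _ _).trans (by linarith [hM i])
  obtain ⟨d, hdd⟩ : ∃ d : ι → WS Ω, d = fun i => u i - u' := ⟨_, rfl⟩
  have hpatch : ∀ x : E N, ∃ r > 0, x ∈ closure Ω → ∃ (e : E N) (η t₀ : ℝ),
      IsConePatch Ω (Metric.ball x r) e η t₀ := fun x => by
    by_cases hx : x ∈ closure Ω
    · obtain ⟨r, hr, h⟩ := exists_conePatch hΩ hx
      exact ⟨r, hr, fun _ => h⟩
    · exact ⟨1, one_pos, fun h => absurd h hx⟩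
  choose r hr hpr using hpatch
  obtain ⟨s, hs, hcov⟩ := hΩ.isBounded.isCompact_closure.elim_nhds_subcover
    (fun x => Metric.ball x (r x)) (fun x _ => Metric.ball_mem_nhds x (hr x))
  have h1 : ∀ x ∈ s, Tendsto (fun i => eLpNorm (fnL (d i)) 2
      (volume.restrict (Ω ∩ Metric.ball x (r x))) ^ (2 : ℝ)) U (𝓝 0) := fun x hx => by
    obtain ⟨e, η, t₀, hp⟩ := hpr x (hs x hx)
    have := tendsto_eLpNorm_patch hΩ measurableSet_ball hp (d := d) (hdd ▸ hd) (M := M + ‖u'‖)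
      (by rw [hdd]; exact hdM)
    have h2 := (ENNReal.continuous_rpow_const (y := 2)).continuousAt.tendsto.comp this
    simpa [Function.comp_def] using h2
  have h2 : Tendsto (fun i => ∑ x ∈ s, eLpNorm (fnL (d i)) 2
      (volume.restrict (Ω ∩ Metric.ball x (r x))) ^ (2 : ℝ)) U (𝓝 0) := by
    simpa using tendsto_finsetSum s h1
  have h3 : ∀ i, eLpNorm (fnL (d i)) 2 (volume.restrict Ω) ^ (2 : ℝ) ≤
      ∑ x ∈ s, eLpNorm (fnL (d i)) 2
      (volume.restrict (Ω ∩ Metric.ball x (r x))) ^ (2 : ℝ) := fun i => by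
    simp only [← lintegral_rpow_two_eq]
    have hsub : Ω ⊆ ⋃ x : s, Ω ∩ Metric.ball (x : E N) (r x) := fun y hy => by
      obtain ⟨x, hx, hyx⟩ := Set.mem_iUnion₂.1 (hcov (subset_closure hy))
      exact Set.mem_iUnion.2 ⟨⟨x, hx⟩, hy, hyx⟩
    calc ∫⁻ y in Ω, ‖fnL (d i) y‖ₑ ^ (2 : ℝ)
        ≤ ∫⁻ y in ⋃ x : s, Ω ∩ Metric.ball (x : E N) (r x), ‖fnL (d i) y‖ₑ ^ (2 : ℝ) :=
          lintegral_mono_set hsub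
      _ ≤ ∫⁻ y, ‖fnL (d i) y‖ₑ ^ (2 : ℝ) ∂(Measure.sum fun x : s =>
            volume.restrict (Ω ∩ Metric.ball (x : E N) (r x))) :=
          lintegral_mono' Measure.restrict_iUnion_le le_rfl
      _ = _ := by
          rw [lintegral_sum_measure, tsum_fintype]
          exact Finset.sum_coe_sort s (fun x => ∫⁻ y in Ω ∩ Metric.ball x (r x),
            ‖fnL (d i) y‖ₑ ^ (2 : ℝ))
  have h4 : Tendsto (fun i => eLpNorm (fnL (d i)) 2 (volume.restrict Ω)) U (𝓝 0) := by
    have h5 := tendsto_of_tendsto_of_tendsto_of_le_of_le tendsto_const_nhds h2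
      (fun _ => zero_le) h3
    have h6 := (ENNReal.continuous_rpow_const (y := 1 / 2)).continuousAt.tendsto.comp h5
    simpa only [Function.comp_def, rpow_two_half, ENNReal.zero_rpow_of_pos
      (by norm_num : (0 : ℝ) < 1 / 2)] using h6
  rw [tendsto_iff_norm_sub_tendsto_zero]
  have h7 : ∀ i, ‖fnL (u i) - fnL u'‖ = (eLpNorm (fnL (d i)) 2 (volume.restrict Ω)).toReal :=
    fun i => by rw [← map_sub, Lp.norm_def, hdd]
  simp only [h7]
  simpa [Function.comp_def] using (ENNReal.tendsto_toReal ENNReal.zero_ne_top).comp h4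

/-- On a connected domain, a Sobolev function with zero gradient is constant. -/
theorem ae_const_of_grad_eq_zero (hΩ : IsBoundedLipschitzDomain Ω) {u : WS Ω}
    (hu : gradL u = 0) : ∃ c : ℝ, fnL u =ᵐ[volume.restrict Ω] fun _ => c := by
  have ho := hΩ.isOpen
  -- mollifying shows that `u` is constant near every point
  have hloc : ∀ x : Ω, ∃ (c r : ℝ), 0 < r ∧ Metric.ball (x : E N) r ⊆ Ω ∧
      fnL u =ᵐ[volume.restrict (Metric.ball (x : E N) r)] fun _ => c := fun x => by
    obtain ⟨R, hR, hball⟩ := Metric.isOpen_iff.1 ho x x.2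
    have hr : 0 < R / 2 := by positivity
    have hr' : 0 < R / 4 := by positivity
    obtain ⟨ρ, hρ⟩ := exists_isMollifier N hr'
    have hin : ∀ y ∈ Metric.ball (x : E N) (R / 2), ∀ z : E N, ‖z‖ ≤ R / 4 → y + z ∈ Ω := by
      intro y hy z hz
      refine hball ?_
      rw [Metric.mem_ball, dist_eq_norm] at hy ⊢
      calc ‖y + z - x‖ = ‖(y - x) + z‖ := by congr 1; abel
        _ ≤ ‖y - x‖ + ‖z‖ := norm_add_le _ _
        _ < R := by linarith
    have hz : eLpNorm (fun y => moll ρ (ext0 (fnL u)) (y + 0) - ext0 (fnL u) y) 2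
        (volume.restrict (Metric.ball (x : E N) (R / 2))) ≤ 0 := by
      refine eLpNorm_moll_sub_le hρ (ext0_stronglyMeasurable ho _) (ext0_memLp ho _) _ _
        fun z hz => ?_
      have h1 := eLpNorm_translate_le hΩ u (D := Metric.ball (x : E N) (R / 2))
        measurableSet_ball (h := -z) (fun y hy s hs => hin y hy _ (by
          rw [norm_smul, norm_neg, Real.norm_eq_abs, abs_of_nonneg hs.1]
          nlinarith [hs.2, norm_nonneg z]))
      rw [hu, norm_zero, mul_zero, ENNReal.ofReal_zero] at h1
      simpa only [add_zero, sub_eq_add_neg] using h1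
    have hmc := contDiff_moll hρ (ext0_locallyIntegrable ho (fnL u))
    rw [nonpos_iff_eq_zero, eLpNorm_eq_zero_iff (by
      refine ((hmc.continuous.comp (by fun_prop)).aestronglyMeasurable.sub
        (ext0_stronglyMeasurable ho _).aestronglyMeasurable)) (by norm_num)] at hz
    have hfd : ∀ y ∈ Metric.ball (x : E N) (R / 2), fderiv ℝ (moll ρ (ext0 (fnL u))) y = 0 := by
      intro y hy
      ext v
      rw [fderiv_moll_ext0 ho hρ u (fun w hw => ?_) v]
      · have h0 : moll ρ (ext0 (gradL u)) y = 0 := by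
          rw [moll]
          refine integral_eq_zero_of_ae ?_
          have h1 : ∀ᵐ w, w ∈ Ω → gradL u w = 0 := by
            rw [← ae_restrict_iff' ho.measurableSet, hu]
            exact Lp.coeFn_zero _ _ _
          filter_upwards [h1] with w hw
          by_cases hwΩ : w ∈ Ω
          · simp [ext0, Set.indicator_of_mem hwΩ, hw hwΩ]
          · simp [ext0, Set.indicator_of_notMem hwΩ]
        rw [h0, inner_zero_left]; rfl
      · have := hin y hy (w - y) (by rwa [← dist_eq_norm])
        rwa [add_sub_cancel] at this
    refine ⟨moll ρ (ext0 (fnL u)) x, R / 2, hr, (Metric.ball_subset_ball (by linarith)).trans hball,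
      ?_⟩
    filter_upwards [hz, ae_restrict_mem measurableSet_ball] with y h1 h2
    have h3 := (convex_ball (x : E N) (R / 2)).is_const_of_fderivWithin_eq_zero (𝕜 := ℝ)
      (f := moll ρ (ext0 (fnL u))) (hmc.differentiable (by simp)).differentiableOn
      (fun y hy => by
        rw [fderivWithin_of_isOpen Metric.isOpen_ball hy]; exact hfd y hy)
      h2 (Metric.mem_ball_self hr)
    have h4 : y ∈ Ω := hball (Metric.ball_subset_ball (by linarith) h2)
    rw [ext0_eq _ h4, Pi.zero_apply, add_zero, sub_eq_zero] at h1
    rw [← h1, h3]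
  choose c r hr hsub hc using hloc
  have hlc : IsLocallyConstant c := by
    rw [IsLocallyConstant.iff_exists_open]
    intro x
    refine ⟨Subtype.val ⁻¹' Metric.ball (x : E N) (r x), Metric.isOpen_ball.preimage
      continuous_subtype_val, Metric.mem_ball_self (hr x), fun y hy => ?_⟩
    have hopen : IsOpen (Metric.ball (x : E N) (r x) ∩ Metric.ball (y : E N) (r y)) :=
      Metric.isOpen_ball.inter Metric.isOpen_ball
    have hpos : 0 < volume (Metric.ball (x : E N) (r x) ∩ Metric.ball (y : E N) (r y)) :=
      hopen.measure_pos volume ⟨y, hy, Metric.mem_ball_self (hr y)⟩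
    have h1 : ∀ᵐ z ∂volume.restrict (Metric.ball (x : E N) (r x) ∩ Metric.ball (y : E N) (r y)),
        fnL u z = c x := ae_mono (Measure.restrict_mono Set.inter_subset_left le_rfl) (hc x)
    have h2 : ∀ᵐ z ∂volume.restrict (Metric.ball (x : E N) (r x) ∩ Metric.ball (y : E N) (r y)),
        fnL u z = c y := ae_mono (Measure.restrict_mono Set.inter_subset_right le_rfl) (hc y)
    have hne : (ae (volume.restrict
        (Metric.ball (x : E N) (r x) ∩ Metric.ball (y : E N) (r y)))).NeBot := by
      rw [ae_neBot, Ne, Measure.restrict_eq_zero]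
      exact hpos.ne'
    obtain ⟨z, hz1, hz2⟩ := (h1.and h2).exists
    exact hz2.symm.trans hz1
  have hpc : PreconnectedSpace Ω := Subtype.preconnectedSpace hΩ.isConnected.isPreconnected
  obtain ⟨x₀, hx₀⟩ := hΩ.isConnected.nonempty
  refine ⟨c ⟨x₀, hx₀⟩, (ae_restrict_iff' ho.measurableSet).2 ?_⟩
  have hnull : volume {x | x ∈ Ω ∧ fnL u x ≠ c ⟨x₀, hx₀⟩} = 0 := by
    refine measure_null_of_locally_null _ fun x hx => ?_
    refine ⟨Metric.ball x (r ⟨x, hx.1⟩) ∩ {x | x ∈ Ω ∧ fnL u x ≠ c ⟨x₀, hx₀⟩}, ?_, ?_⟩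
    · rw [Set.inter_comm]
      exact inter_mem_nhdsWithin _ (Metric.ball_mem_nhds x (hr _))
    · have h1 := hc ⟨x, hx.1⟩
      rw [EventuallyEq, ae_restrict_iff' measurableSet_ball, ae_iff] at h1
      refine measure_mono_null (fun y hy => ?_) h1
      simp only [Set.mem_ofPred_eq, Classical.not_imp]
      refine ⟨hy.1, ?_⟩
      rw [hlc.apply_eq_of_preconnectedSpace ⟨x, hx.1⟩ ⟨x₀, hx₀⟩]
      exact hy.2.2
  rw [ae_iff]
  convert hnull using 2
  ext x
  simp

end Rellich

/-! ### Graph coordinates near the boundary -/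

section Graph

variable {N : ℕ} {Ω : Set (E N)}

/-- The hyperplane orthogonal to `e`. -/
abbrev Hyp {N : ℕ} (e : E N) : Submodule ℝ (E N) := (Submodule.span ℝ {e})ᗮ

lemma inner_hyp {e : E N} (y : Hyp e) : inner ℝ (y : E N) e = 0 := by
  have := (Submodule.mem_orthogonal' _ _).1 y.2 e (Submodule.mem_span_singleton_self e)
  exact this

lemma inner_hyp_add {e : E N} (he : ‖e‖ = 1) (y : Hyp e) (s : ℝ) :
    inner ℝ ((y : E N) + s • e) e = s := by
  rw [inner_add_left, inner_hyp, real_inner_smul_left, real_inner_self_eq_norm_sq, he]; simp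

/-- The orthogonal projection to the hyperplane orthogonal to `e`. -/
def hypProj (e : E N) : E N →L[ℝ] Hyp e := (Hyp e).orthogonalProjectionOnto

lemma hypProj_coe {e : E N} (he : ‖e‖ = 1) (x : E N) :
    (hypProj e x : E N) = x - inner ℝ x e • e := by
  have h : (hypProj e x : E N) = (Hyp e).starProjection x := rfl
  rw [h, Submodule.starProjection_orthogonal_val, Submodule.starProjection_unit_singleton ℝ he,
    real_inner_comm]

lemma hypProj_add {e : E N} (he : ‖e‖ = 1) (y : Hyp e) (s : ℝ) :
    hypProj e ((y : E N) + s • e) = y := by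
  apply Subtype.ext
  rw [hypProj_coe he, inner_hyp_add he, add_sub_cancel_right]

lemma lipschitz_hypProj (e : E N) : LipschitzWith 1 (hypProj e) :=
  Submodule.lipschitzWith_orthogonalProjectionOnto _

/-- Fubini's theorem for the decomposition of `ℝ^N` into a hyperplane and its normal line. -/
lemma lintegral_eq_slices {e : E N} (he : ‖e‖ = 1) {f : E N → ENNReal} (hf : Measurable f) :
    ∫⁻ x, f x = ∫⁻ y : Hyp e, ∫⁻ s : ℝ, f ((y : E N) + s • e) := by
  have h1 := (Submodule.span ℝ {e}).orthogonalDecomposition.symm.measurePreserving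
  have h2 := WithLp.volume_preserving_toLp (U := Submodule.span ℝ {e}) (V := Hyp e)
  have h3 := (LinearIsometryEquiv.toSpanUnitSingleton (𝕜 := ℝ) e he).measurePreserving
  rw [← (h1.comp h2).lintegral_comp hf, Measure.volume_eq_prod, lintegral_prod_symm]
  · refine lintegral_congr fun y => ?_
    rw [← h3.lintegral_comp]
    · refine lintegral_congr fun s => ?_
      simp [add_comm]
    · refine hf.comp ?_
      exact (h1.comp h2).measurable.comp (by fun_prop)
  · exact (hf.comp (h1.comp h2).measurable).aemeasurable

lemma finrank_hyp {e : E N} (he : ‖e‖ = 1) : Module.finrank ℝ (Hyp e) = N - 1 := by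
  have h := (Submodule.span ℝ {e}).finrank_add_finrank_orthogonal
  rw [finrank_span_singleton (by rintro rfl; simp at he), finrank_euclideanSpace_fin] at h
  change Module.finrank ℝ (Submodule.span ℝ {e})ᗮ = N - 1
  omega

lemma volume_hyp {e : E N} (he : ‖e‖ = 1) :
    (volume : Measure (Hyp e)) = Measure.euclideanHausdorffMeasure (N - 1) := by
  rw [← finrank_hyp he, InnerProductSpace.euclideanHausdorffMeasure_eq_volume]

/-- The Euclidean Hausdorff measure under Lipschitz maps. -/
lemma euclideanHausdorffMeasure_image_le {X Y : Type*} [MetricSpace X] [MeasurableSpace X]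
    [BorelSpace X] [MetricSpace Y] [MeasurableSpace Y] [BorelSpace Y] {K : NNReal} {f : X → Y}
    (hf : LipschitzWith K f) (d : ℕ) (s : Set X) :
    Measure.euclideanHausdorffMeasure d (f '' s) ≤
      (K : ENNReal) ^ d * Measure.euclideanHausdorffMeasure d s := by
  rw [Measure.euclideanHausdorffMeasure_def, Measure.euclideanHausdorffMeasure_def,
    Measure.smul_apply, Measure.smul_apply, mul_smul_comm]
  have := hf.hausdorffMeasure_image_le (Nat.cast_nonneg d) s
  rw [ENNReal.rpow_natCast] at this
  gcongr

/-- A coordinate system at the boundary point `x₀` in which `Ω` is the region above the graph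
of `γ`. -/
structure IsGraphChart (Ω : Set (E N)) (x₀ e : E N) (γ : E N → ℝ) (K : NNReal) (r : ℝ) : Prop where
  norm_eq : ‖e‖ = 1
  lipschitz : LipschitzWith K γ
  pos : 0 < r
  mem_iff : ∀ x ∈ Metric.ball x₀ r, (x ∈ Ω ↔ γ (x - inner ℝ x e • e) < inner ℝ x e)

/-- The parametrization `y ↦ y + γ(y) e` of the graph of `γ`. -/
def graphMap (e : E N) (γ : E N → ℝ) (y : Hyp e) : E N := (y : E N) + γ y • e

lemma lipschitz_graphMap {e : E N} (he : ‖e‖ = 1) {γ : E N → ℝ} {K : NNReal}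
    (hγ : LipschitzWith K γ) : LipschitzWith (1 + K) (graphMap e γ) := by
  refine LipschitzWith.of_dist_le_mul fun y z => ?_
  rw [dist_eq_norm, graphMap, graphMap]
  have h1 : (y : E N) + γ y • e - (z + γ z • e) = ((y : E N) - z) + (γ y - γ z) • e := by
    rw [sub_smul]; abel
  have h2 := hγ.dist_le_mul y z
  rw [Real.dist_eq, dist_eq_norm] at h2
  rw [h1, Subtype.dist_eq, dist_eq_norm]
  refine (norm_add_le _ _).trans ?_
  rw [norm_smul, he, Real.norm_eq_abs]
  push_cast
  linarith

lemma hypProj_graphMap {e : E N} (he : ‖e‖ = 1) (γ : E N → ℝ) (y : Hyp e) :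
    hypProj e (graphMap e γ y) = y := hypProj_add he y _

/-- Fubini's theorem in the coordinates `(y, s) ↦ y + (γ(y) + s) e`. -/
lemma lintegral_eq_graph {e : E N} (he : ‖e‖ = 1) {γ : E N → ℝ}
    {f : E N → ENNReal} (hf : Measurable f) :
    ∫⁻ x, f x = ∫⁻ y : Hyp e, ∫⁻ s : ℝ, f (graphMap e γ y + s • e) := by
  rw [lintegral_eq_slices he hf]
  refine lintegral_congr fun y => ?_
  rw [← lintegral_add_left_eq_self (fun s : ℝ => f ((y : E N) + s • e)) (γ y)]
  simp_rw [graphMap, add_smul, add_assoc]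

namespace IsGraphChart

variable {x₀ e : E N} {γ : E N → ℝ} {K : NNReal} {r : ℝ}

lemma param_mem_iff (h : IsGraphChart Ω x₀ e γ K r) {y : Hyp e} {s : ℝ}
    (hy : graphMap e γ y + s • e ∈ Metric.ball x₀ r) :
    graphMap e γ y + s • e ∈ Ω ↔ 0 < s := by
  rw [h.mem_iff _ hy, graphMap, add_assoc, ← add_smul, inner_hyp_add h.norm_eq,
    add_sub_cancel_right]
  exact lt_add_iff_pos_right _

lemma param_mem (h : IsGraphChart Ω x₀ e γ K r) {y : Hyp e} {s : ℝ}
    (hy : graphMap e γ y ∈ Metric.ball x₀ (r / 2)) (hs : 0 < s) (hs' : s ≤ r / 2) :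
    graphMap e γ y + s • e ∈ Ω := by
  refine (h.param_mem_iff ?_).2 hs
  rw [Metric.mem_ball, dist_eq_norm] at hy ⊢
  calc ‖graphMap e γ y + s • e - x₀‖ = ‖(graphMap e γ y - x₀) + s • e‖ := by congr 1; abel
    _ ≤ ‖graphMap e γ y - x₀‖ + ‖s • e‖ := norm_add_le _ _
    _ < r := by rw [norm_smul, h.norm_eq, Real.norm_eq_abs, abs_of_pos hs]; linarith

lemma graphMap_mem_frontier (h : IsGraphChart Ω x₀ e γ K r) (ho : IsOpen Ω) {y : Hyp e}
    (hy : graphMap e γ y ∈ Metric.ball x₀ r) : graphMap e γ y ∈ frontier Ω := by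
  rw [ho.frontier_eq]
  refine ⟨?_, fun hmem => ?_⟩
  · have hc : Tendsto (fun s : ℝ => graphMap e γ y + s • e) (𝓝[>] 0) (𝓝 (graphMap e γ y)) := by
      have : Continuous fun s : ℝ => graphMap e γ y + s • e := by fun_prop
      simpa using this.continuousWithinAt (s := Set.Ioi 0) (x := 0) |>.tendsto
    refine mem_closure_of_tendsto hc ?_
    filter_upwards [hc (Metric.isOpen_ball.mem_nhds hy), self_mem_nhdsWithin] with s h1 h2
    exact (h.param_mem_iff h1).2 h2
  · have := (h.param_mem_iff (y := y) (s := 0) (by simpa using hy)).1 (by simpa using hmem)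
    exact lt_irrefl _ this

lemma graphMap_hypProj (h : IsGraphChart Ω x₀ e γ K r) (ho : IsOpen Ω) {x : E N}
    (hx : x ∈ frontier Ω) (hxr : x ∈ Metric.ball x₀ r) : graphMap e γ (hypProj e x) = x := by
  rw [ho.frontier_eq] at hx
  have h1 := graph_le_of_mem_closure h.lipschitz.continuous h.mem_iff hx.1 hxr
  have h2 : inner ℝ x e ≤ γ (x - inner ℝ x e • e) := not_lt.1 fun h3 => hx.2 ((h.mem_iff x hxr).2 h3)
  rw [graphMap, hypProj_coe h.norm_eq, le_antisymm h1 h2, sub_add_cancel]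

end IsGraphChart

end Graph

/-! ### Trace and boundary strip inequalities for smooth functions -/

section TraceInequality

variable {N : ℕ} {Ω : Set (E N)}

/-- The Cauchy–Schwarz inequality against the constant function `1`. -/
lemma lintegral_rpow_two_le_mul {X : Type*} [MeasurableSpace X] {ν : Measure X}
    {f : X → ENNReal} (hf : AEMeasurable f ν) :
    (∫⁻ x, f x ∂ν) ^ (2 : ℝ) ≤ ν Set.univ * ∫⁻ x, f x ^ (2 : ℝ) ∂ν := by
  have h := ENNReal.lintegral_mul_le_Lp_mul_Lq ν Real.HolderConjugate.two_two hf
    (aemeasurable_const (b := (1 : ENNReal)))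
  simp only [Pi.mul_apply, mul_one, ENNReal.one_rpow, lintegral_const, one_mul] at h
  calc _ ≤ ((∫⁻ x, f x ^ (2 : ℝ) ∂ν) ^ ((1 : ℝ) / 2) * ν Set.univ ^ ((1 : ℝ) / 2)) ^ (2 : ℝ) := by
        gcongr
    _ = _ := by
        rw [ENNReal.mul_rpow_of_nonneg _ _ (by norm_num), rpow_half_two, rpow_half_two, mul_comm]

lemma enorm_rpow_two_le (a b : ℝ) :
    ‖a‖ₑ ^ (2 : ℝ) ≤ 2 * ‖b‖ₑ ^ (2 : ℝ) + 2 * ‖a - b‖ₑ ^ (2 : ℝ) := by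
  have h1 : ‖a‖ₑ ≤ ‖b‖ₑ + ‖a - b‖ₑ := by
    calc ‖a‖ₑ = ‖b + (a - b)‖ₑ := by congr 1; ring
      _ ≤ _ := enorm_add_le _ _
  have h2 := ENNReal.rpow_add_le_mul_rpow_add_rpow ‖b‖ₑ ‖a - b‖ₑ (p := 2) (by norm_num)
  norm_num at h2
  calc _ ≤ (‖b‖ₑ + ‖a - b‖ₑ) ^ (2 : ℝ) := by gcongr
    _ ≤ 2 * (‖b‖ₑ ^ (2 : ℝ) + ‖a - b‖ₑ ^ (2 : ℝ)) := by exact_mod_cast h2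
    _ = _ := mul_add _ _ _

/-- The increment of a smooth function over a segment of length at most `t` in a unit direction. -/
lemma enorm_sub_rpow_two_le {φ : E N → ℝ} (hφ : ContDiff ℝ ∞ φ) (x : E N) {e : E N}
    (he : ‖e‖ = 1) {s t : ℝ} (hs : 0 ≤ s) (hst : s ≤ t) :
    ‖φ (x + s • e) - φ x‖ₑ ^ (2 : ℝ) ≤
      ENNReal.ofReal t * ∫⁻ σ in Set.Ioc (0 : ℝ) t, ‖gradient φ (x + σ • e)‖ₑ ^ (2 : ℝ) := by
  have hcg := continuous_gradient hφ
  have hd : ∀ σ ∈ Set.uIcc (0 : ℝ) s, HasDerivAt (fun σ : ℝ => φ (x + σ • e))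
      (fderiv ℝ φ (x + σ • e) e) σ := fun σ _ => by
    have h1 : HasDerivAt (fun σ : ℝ => x + σ • e) e σ := by
      simpa using ((hasDerivAt_id σ).smul_const e).const_add x
    exact (hφ.differentiable (by simp) (x + σ • e)).hasFDerivAt.comp_hasDerivAt σ h1
  have hc : Continuous fun σ : ℝ => fderiv ℝ φ (x + σ • e) e :=
    ((hφ.continuous_fderiv (by simp)).comp (by fun_prop)).clm_apply continuous_const
  have h1 := intervalIntegral.integral_eq_sub_of_hasDerivAt hd (hc.intervalIntegrable 0 s)
  simp only [zero_smul, add_zero] at h1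
  have hm : Measurable fun σ : ℝ => ‖gradient φ (x + σ • e)‖ₑ := by
    have : Continuous fun σ : ℝ => gradient φ (x + σ • e) := hcg.comp (by fun_prop)
    exact this.measurable.enorm
  have h2 : ‖φ (x + s • e) - φ x‖ₑ ≤
      ∫⁻ σ in Set.Ioc (0 : ℝ) t, ‖gradient φ (x + σ • e)‖ₑ := by
    rw [← h1, intervalIntegral.integral_of_le hs]
    refine (enorm_integral_le_lintegral_enorm _).trans ?_
    refine (lintegral_mono fun σ => ?_).trans
      (lintegral_mono_set (Set.Ioc_subset_Ioc_right hst))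
    rw [← ofReal_norm, ← ofReal_norm, norm_gradient_eq]
    refine ENNReal.ofReal_le_ofReal ?_
    simpa [he] using ContinuousLinearMap.le_opNorm (fderiv ℝ φ (x + σ • e)) e
  calc _ ≤ (∫⁻ σ in Set.Ioc (0 : ℝ) t, ‖gradient φ (x + σ • e)‖ₑ) ^ (2 : ℝ) := by gcongr
    _ ≤ _ := by
      refine (lintegral_rpow_two_le_mul hm.aemeasurable).trans (le_of_eq ?_)
      simp

namespace IsGraphChart

variable {x₀ e : E N} {γ : E N → ℝ} {K : NNReal} {r : ℝ}

lemma continuous_graphMap (h : IsGraphChart Ω x₀ e γ K r) : Continuous (graphMap e γ) :=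
  (lipschitz_graphMap h.norm_eq h.lipschitz).continuous

/-- The surface measure is at most a multiple of the parameter measure. -/
lemma lintegral_surf_le (h : IsGraphChart Ω x₀ e γ K r) (ho : IsOpen Ω) {ρ : ℝ} (hρ : ρ ≤ r)
    {f : E N → ENNReal} (hf : Measurable f) :
    ∫⁻ x in Metric.ball x₀ ρ, f x ∂(surf Ω) ≤ ((1 + K : NNReal) : ENNReal) ^ (N - 1) *
      ∫⁻ y in graphMap e γ ⁻¹' Metric.ball x₀ ρ, f (graphMap e γ y) := by
  have hm := h.continuous_graphMap.measurable
  have hle : (surf Ω).restrict (Metric.ball x₀ ρ) ≤ ((1 + K : NNReal) : ENNReal) ^ (N - 1) •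
      Measure.map (graphMap e γ) (volume.restrict (graphMap e γ ⁻¹' Metric.ball x₀ ρ)) := by
    refine Measure.le_iff.2 fun S hS => ?_
    rw [Measure.restrict_apply hS, surf, Measure.restrict_apply (hS.inter measurableSet_ball),
      Measure.smul_apply, Measure.map_apply hm hS, Measure.restrict_apply (hm hS), smul_eq_mul,
      volume_hyp h.norm_eq]
    refine (measure_mono ?_).trans (euclideanHausdorffMeasure_image_le
      (lipschitz_graphMap h.norm_eq h.lipschitz) (N - 1) _)
    rintro x ⟨⟨hxS, hxB⟩, hxf⟩
    have hx := h.graphMap_hypProj ho hxf (Metric.ball_subset_ball hρ hxB)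
    exact ⟨hypProj e x, ⟨by rwa [Set.mem_preimage, hx], by rwa [Set.mem_preimage, hx]⟩, hx⟩
  refine (lintegral_mono' hle le_rfl).trans ?_
  rw [lintegral_smul_measure, lintegral_map hf hm, smul_eq_mul]

/-- The parameter measure is at most the surface measure. -/
lemma lintegral_le_surf (h : IsGraphChart Ω x₀ e γ K r) (ho : IsOpen Ω) {ρ : ℝ} (hρ : ρ ≤ r)
    {f : E N → ENNReal} (hf : Measurable f) :
    ∫⁻ y in graphMap e γ ⁻¹' Metric.ball x₀ ρ, f (graphMap e γ y) ≤ ∫⁻ x, f x ∂(surf Ω) := by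
  have hm := h.continuous_graphMap.measurable
  rw [← lintegral_map hf hm]
  refine lintegral_mono' (Measure.le_iff.2 fun S hS => ?_) le_rfl
  rw [Measure.map_apply hm hS, Measure.restrict_apply (hm hS), surf, Measure.restrict_apply hS,
    volume_hyp h.norm_eq]
  have h1 := euclideanHausdorffMeasure_image_le (lipschitz_hypProj e) (N - 1) (S ∩ frontier Ω)
  rw [ENNReal.coe_one, one_pow, one_mul] at h1
  refine (measure_mono ?_).trans h1
  rintro y ⟨hyS, hyB⟩
  exact ⟨graphMap e γ y, ⟨hyS, h.graphMap_mem_frontier ho (Metric.ball_subset_ball hρ hyB)⟩,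
    hypProj_graphMap h.norm_eq γ y⟩

/-- The part of `Ω` above a piece of the graph, up to height `t`. -/
lemma lintegral_layer_le (h : IsGraphChart Ω x₀ e γ K r) (ho : IsOpen Ω) {t : ℝ}
    (ht : t ≤ r / 2) {g : E N → ENNReal} (hg : Measurable g) :
    ∫⁻ y in graphMap e γ ⁻¹' Metric.ball x₀ (r / 2), (∫⁻ s in Set.Ioc (0 : ℝ) t,
      g (graphMap e γ y + s • e)) ≤ ∫⁻ x in Ω, g x := by
  have hmB : MeasurableSet (graphMap e γ ⁻¹' Metric.ball x₀ (r / 2)) :=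
    h.continuous_graphMap.measurable measurableSet_ball
  rw [← lintegral_indicator ho.measurableSet,
    lintegral_eq_graph h.norm_eq (γ := γ) (hg.indicator ho.measurableSet)]
  refine (setLIntegral_mono' hmB fun y hy => ?_).trans (setLIntegral_le_lintegral _ _)
  refine (setLIntegral_mono' measurableSet_Ioc fun s hs => ?_).trans
    (setLIntegral_le_lintegral _ _)
  rw [Set.indicator_of_mem (h.param_mem hy hs.1 (hs.2.trans ht))]

lemma measurable_comp (h : IsGraphChart Ω x₀ e γ K r) {g : E N → ENNReal} (hg : Measurable g) :
    Measurable fun p : Hyp e × ℝ => g (graphMap e γ p.1 + p.2 • e) := by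
  have hc := h.continuous_graphMap
  exact hg.comp (Continuous.measurable (by fun_prop))

/-- The increments between a piece of the graph and the points above it. -/
lemma lintegral_increment_le (h : IsGraphChart Ω x₀ e γ K r) (ho : IsOpen Ω) {t : ℝ}
    (ht : t ≤ r / 2) {φ : E N → ℝ} (hφ : ContDiff ℝ ∞ φ) :
    ∫⁻ y in graphMap e γ ⁻¹' Metric.ball x₀ (r / 2), (∫⁻ s in Set.Ioc (0 : ℝ) t,
      ‖φ (graphMap e γ y + s • e) - φ (graphMap e γ y)‖ₑ ^ (2 : ℝ)) ≤
      ENNReal.ofReal t * (ENNReal.ofReal t * ∫⁻ x in Ω, ‖gradient φ x‖ₑ ^ (2 : ℝ)) := by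
  have hg : Measurable fun x => ‖gradient φ x‖ₑ ^ (2 : ℝ) :=
    (continuous_gradient hφ).measurable.enorm.pow_const _
  refine le_trans ?_ (mul_le_mul_right (mul_le_mul_right (h.lintegral_layer_le ho ht hg) _) _)
  rw [← lintegral_const_mul' _ _ ENNReal.ofReal_ne_top,
    ← lintegral_const_mul' _ _ ENNReal.ofReal_ne_top]
  refine lintegral_mono fun y => ?_
  refine (setLIntegral_mono' measurableSet_Ioc fun s hs =>
    enorm_sub_rpow_two_le hφ (graphMap e γ y) h.norm_eq hs.1.le hs.2).trans ?_
  rw [setLIntegral_const, Real.volume_Ioc, sub_zero, mul_comm]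

/-- The values on a piece of the graph are bounded by those in the layer above it and the gradient.
The parameter `t` is free, which later makes the trace operator compact. -/
lemma lintegral_graph_le (h : IsGraphChart Ω x₀ e γ K r) (ho : IsOpen Ω) {t : ℝ}
    (ht : t ≤ r / 2) {φ : E N → ℝ} (hφ : ContDiff ℝ ∞ φ) :
    ENNReal.ofReal t * ∫⁻ y in graphMap e γ ⁻¹' Metric.ball x₀ (r / 2),
        ‖φ (graphMap e γ y)‖ₑ ^ (2 : ℝ) ≤
      2 * (∫⁻ x in Ω, ‖φ x‖ₑ ^ (2 : ℝ)) + 2 * (ENNReal.ofReal t *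
        (ENNReal.ofReal t * ∫⁻ x in Ω, ‖gradient φ x‖ₑ ^ (2 : ℝ))) := by
  have hφm : Measurable fun x => ‖φ x‖ₑ ^ (2 : ℝ) :=
    hφ.continuous.measurable.enorm.pow_const _
  have hm2 : Measurable fun p : Hyp e × ℝ => 2 * ‖φ (graphMap e γ p.1 + p.2 • e)‖ₑ ^ (2 : ℝ) :=
    (h.measurable_comp hφm).const_mul _
  calc _ = ∫⁻ y in graphMap e γ ⁻¹' Metric.ball x₀ (r / 2), (∫⁻ s in Set.Ioc (0 : ℝ) t,
        ‖φ (graphMap e γ y)‖ₑ ^ (2 : ℝ)) := by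
        rw [← lintegral_const_mul' _ _ ENNReal.ofReal_ne_top]
        refine lintegral_congr fun y => ?_
        rw [setLIntegral_const, Real.volume_Ioc, sub_zero, mul_comm]
    _ ≤ ∫⁻ y in graphMap e γ ⁻¹' Metric.ball x₀ (r / 2),
          ((∫⁻ s in Set.Ioc (0 : ℝ) t, 2 * ‖φ (graphMap e γ y + s • e)‖ₑ ^ (2 : ℝ)) +
          ∫⁻ s in Set.Ioc (0 : ℝ) t,
            2 * ‖φ (graphMap e γ y + s • e) - φ (graphMap e γ y)‖ₑ ^ (2 : ℝ)) := by
        refine lintegral_mono fun y => ?_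
        have hm3 : Measurable fun s : ℝ => 2 * ‖φ (graphMap e γ y + s • e)‖ₑ ^ (2 : ℝ) :=
          (hφm.comp (g := fun x => ‖φ x‖ₑ ^ (2 : ℝ))
            (f := fun s : ℝ => graphMap e γ y + s • e)
            (Continuous.measurable (by fun_prop))).const_mul _
        rw [← lintegral_add_left hm3]
        refine lintegral_mono fun s => ?_
        rw [← enorm_neg (φ (graphMap e γ y + s • e) - φ (graphMap e γ y)), neg_sub]
        exact enorm_rpow_two_le _ _
    _ ≤ _ := by
        rw [lintegral_add_left hm2.lintegral_prod_right']
        simp_rw [lintegral_const_mul' (2 : ENNReal) _ (by simp)]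
        exact add_le_add (mul_le_mul_right (h.lintegral_layer_le ho ht hφm) _)
          (mul_le_mul_right (h.lintegral_increment_le ho ht hφ) _)

/-- Conversely, the values in the layer of height `t` are bounded by `t` times the boundary values
and `t²` times the gradient. -/
lemma lintegral_layer_le' (h : IsGraphChart Ω x₀ e γ K r) (ho : IsOpen Ω) {t : ℝ}
    (ht : t ≤ r / 2) {φ : E N → ℝ} (hφ : ContDiff ℝ ∞ φ) :
    ∫⁻ y in graphMap e γ ⁻¹' Metric.ball x₀ (r / 2), (∫⁻ s in Set.Ioc (0 : ℝ) t,
        ‖φ (graphMap e γ y + s • e)‖ₑ ^ (2 : ℝ)) ≤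
      2 * (ENNReal.ofReal t * ∫⁻ x, ‖φ x‖ₑ ^ (2 : ℝ) ∂(surf Ω)) + 2 * (ENNReal.ofReal t *
        (ENNReal.ofReal t * ∫⁻ x in Ω, ‖gradient φ x‖ₑ ^ (2 : ℝ))) := by
  have hφm : Measurable fun x => ‖φ x‖ₑ ^ (2 : ℝ) :=
    hφ.continuous.measurable.enorm.pow_const _
  have hm2 : Measurable fun y : Hyp e => 2 * (ENNReal.ofReal t *
      ‖φ (graphMap e γ y)‖ₑ ^ (2 : ℝ)) :=
    ((hφm.comp h.continuous_graphMap.measurable).const_mul _).const_mul _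
  have hr := h.pos
  calc _ ≤ ∫⁻ y in graphMap e γ ⁻¹' Metric.ball x₀ (r / 2),
          (2 * (ENNReal.ofReal t * ‖φ (graphMap e γ y)‖ₑ ^ (2 : ℝ)) +
          ∫⁻ s in Set.Ioc (0 : ℝ) t,
            2 * ‖φ (graphMap e γ y + s • e) - φ (graphMap e γ y)‖ₑ ^ (2 : ℝ)) := by
        refine lintegral_mono fun y => ?_
        have h3 : 2 * (ENNReal.ofReal t * ‖φ (graphMap e γ y)‖ₑ ^ (2 : ℝ)) =
            ∫⁻ s in Set.Ioc (0 : ℝ) t, 2 * ‖φ (graphMap e γ y)‖ₑ ^ (2 : ℝ) := by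
          rw [setLIntegral_const, Real.volume_Ioc, sub_zero, mul_assoc, mul_comm (ENNReal.ofReal t)]
        rw [h3, ← lintegral_add_left measurable_const]
        exact lintegral_mono fun s => enorm_rpow_two_le _ _
    _ ≤ _ := by
        rw [lintegral_add_left hm2]
        simp_rw [lintegral_const_mul' (2 : ENNReal) _ (by simp)]
        rw [lintegral_const_mul' _ _ ENNReal.ofReal_ne_top]
        gcongr
        · exact h.lintegral_le_surf ho (by linarith) hφm
        · exact h.lintegral_increment_le ho ht hφ

/-- Near the centre of a chart, the points of `Ω` at distance less than `δ` from the complement lie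
in the layer of height `(1 + K) δ` above the graph. -/
lemma lintegral_strip_le (h : IsGraphChart Ω x₀ e γ K r) (ho : IsOpen Ω) {R δ : ℝ}
    (hR : R * (2 + K) ≤ r / 2) (hδ : 0 < δ) (hδR : δ ≤ R) (hne : Ωᶜ.Nonempty)
    {g : E N → ENNReal} (hg : Measurable g) :
    ∫⁻ x in Ω ∩ {x | Metric.infDist x Ωᶜ < δ} ∩ Metric.ball x₀ R, g x ≤
      ∫⁻ y in graphMap e γ ⁻¹' Metric.ball x₀ (r / 2), (∫⁻ s in Set.Ioc (0 : ℝ) ((1 + K) * δ),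
        g (graphMap e γ y + s • e)) := by
  have hK : (0 : ℝ) ≤ K := NNReal.coe_nonneg K
  have hR0 : 0 < R := hδ.trans_le hδR
  have hKR : 0 ≤ R * K := by positivity
  have hmB : MeasurableSet (graphMap e γ ⁻¹' Metric.ball x₀ (r / 2)) :=
    h.continuous_graphMap.measurable measurableSet_ball
  have hS : MeasurableSet (Ω ∩ {x | Metric.infDist x Ωᶜ < δ} ∩ Metric.ball x₀ R) :=
    (ho.measurableSet.inter (isOpen_lt (Metric.continuous_infDist_pt _)
      continuous_const).measurableSet).inter measurableSet_ball
  have key : ∀ (y : Hyp e) (s : ℝ),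
      graphMap e γ y + s • e ∈ Ω ∩ {x | Metric.infDist x Ωᶜ < δ} ∩ Metric.ball x₀ R →
      graphMap e γ y ∈ Metric.ball x₀ (r / 2) ∧ s ∈ Set.Ioc (0 : ℝ) ((1 + K) * δ) := by
    rintro y s ⟨⟨hxΩ, hxd⟩, hxB⟩
    obtain ⟨x, hx⟩ : ∃ x, x = graphMap e γ y + s • e := ⟨_, rfl⟩
    rw [← hx] at hxΩ hxd hxB
    have hxr : x ∈ Metric.ball x₀ r := Metric.ball_subset_ball (by nlinarith) hxB
    have hs : 0 < s := (h.param_mem_iff (hx ▸ hxr)).1 (hx ▸ hxΩ)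
    obtain ⟨z, hz, hzd⟩ := (Metric.infDist_lt_iff hne).1 hxd
    have hzr : z ∈ Metric.ball x₀ r := by
      rw [Metric.mem_ball] at hxB ⊢
      have := dist_triangle_left z x₀ x
      nlinarith
    have hzγ : inner ℝ z e ≤ γ (hypProj e z) := by
      rw [hypProj_coe h.norm_eq]
      exact not_lt.1 fun hlt => hz ((h.mem_iff z hzr).2 hlt)
    have hxe : inner ℝ x e = γ y + s := by
      rw [hx, graphMap, add_assoc, ← add_smul, inner_hyp_add h.norm_eq]
    have hxp : hypProj e x = y := by
      rw [hx, graphMap, add_assoc, ← add_smul, hypProj_add h.norm_eq]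
    have h1 : |inner ℝ x e - inner ℝ z e| ≤ dist x z := by
      rw [← inner_sub_left, dist_eq_norm]
      simpa [h.norm_eq] using abs_real_inner_le_norm (x - z) e
    have h2 : dist (γ y) (γ (hypProj e z)) ≤ K * dist x z := by
      refine (h.lipschitz.dist_le_mul _ _).trans (mul_le_mul_of_nonneg_left ?_ hK)
      rw [← hxp]
      simpa [Subtype.dist_eq] using (lipschitz_hypProj e).dist_le_mul x z
    rw [Real.dist_eq] at h2
    have h3 : s ≤ (1 + K) * δ := by
      have := abs_le.1 h1
      have := abs_le.1 h2
      nlinarith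
    refine ⟨?_, hs, h3⟩
    rw [Metric.mem_ball] at hxB ⊢
    have h4 : dist (graphMap e γ y) x = s := by
      rw [hx, dist_eq_norm, sub_add_cancel_left, norm_neg, norm_smul, h.norm_eq,
        Real.norm_eq_abs, abs_of_pos hs, mul_one]
    have := dist_triangle (graphMap e γ y) x x₀
    nlinarith
  rw [← lintegral_indicator hS, lintegral_eq_graph h.norm_eq (γ := γ) (hg.indicator hS),
    ← lintegral_indicator hmB]
  refine lintegral_mono fun y => ?_
  by_cases hy : y ∈ graphMap e γ ⁻¹' Metric.ball x₀ (r / 2)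
  · rw [Set.indicator_of_mem hy, ← lintegral_indicator measurableSet_Ioc]
    refine lintegral_mono fun s => ?_
    refine Set.indicator_apply_le' (fun hmem => ?_) fun _ => zero_le
    rw [Set.indicator_of_mem (key y s hmem).2]
  · rw [Set.indicator_of_notMem hy, nonpos_iff_eq_zero]
    refine lintegral_eq_zero_of_ae_eq_zero (Eventually.of_forall fun s => ?_)
    exact Set.indicator_of_notMem (fun hmem => hy (key y s hmem).1) _

end IsGraphChart

end TraceInequality

/-! ### Global boundary estimates and the surface measure -/

section BoundaryEstimates

variable {N : ℕ} {Ω : Set (E N)}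

lemma compl_nonempty (hN : 0 < N) (hb : Bornology.IsBounded Ω) : Ωᶜ.Nonempty := by
  have : Nonempty (Fin N) := ⟨⟨0, hN⟩⟩
  by_contra h
  rw [Set.not_nonempty_iff_eq_empty, Set.compl_empty_iff] at h
  exact NormedSpace.unbounded_univ ℝ (E N) (h ▸ hb)

lemma IsBoundedLipschitzDomain.exists_chart (hΩ : IsBoundedLipschitzDomain Ω) {x₀ : E N}
    (hx : x₀ ∈ frontier Ω) : ∃ e γ K r, IsGraphChart Ω x₀ e γ K r := by
  obtain ⟨e, γ, K, r, h1, h2, h3, h4⟩ := hΩ.lipschitz x₀ hx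
  exact ⟨e, γ, K, r, h1, h2, h3, h4⟩

/-- On `U`, the boundary values of smooth functions and their values near the boundary control
each other, up to the gradient. -/
def HasBoundaryEstimates (Ω U : Set (E N)) (R : ℝ) (C : ENNReal) : Prop :=
  ∀ t ∈ Set.Ioc 0 R, ∀ φ : E N → ℝ, ContDiff ℝ ∞ φ →
    (ENNReal.ofReal t * ∫⁻ x in U, ‖φ x‖ₑ ^ (2 : ℝ) ∂(surf Ω) ≤
      C * ((∫⁻ x in Ω, ‖φ x‖ₑ ^ (2 : ℝ)) + ENNReal.ofReal t *
        (ENNReal.ofReal t * ∫⁻ x in Ω, ‖gradient φ x‖ₑ ^ (2 : ℝ)))) ∧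
    (∫⁻ x in Ω ∩ {x | Metric.infDist x Ωᶜ < t} ∩ U, ‖φ x‖ₑ ^ (2 : ℝ) ≤
      C * (ENNReal.ofReal t * (∫⁻ x, ‖φ x‖ₑ ^ (2 : ℝ) ∂(surf Ω)) + ENNReal.ofReal t *
        (ENNReal.ofReal t * ∫⁻ x in Ω, ‖gradient φ x‖ₑ ^ (2 : ℝ))))

lemma IsGraphChart.hasBoundaryEstimates {x₀ e : E N} {γ : E N → ℝ} {K : NNReal} {r : ℝ}
    (h : IsGraphChart Ω x₀ e γ K r) (ho : IsOpen Ω) (hne : Ωᶜ.Nonempty) :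
    ∃ R > 0, ∃ C : ENNReal, C ≠ ⊤ ∧ HasBoundaryEstimates Ω (Metric.ball x₀ R) R C := by
  have hK : (0 : ℝ) ≤ K := NNReal.coe_nonneg K
  have hr := h.pos
  have hR : r / (2 * (2 + K)) * (2 + K) = r / 2 := by field_simp
  obtain ⟨R, hRdef⟩ : ∃ R, R = r / (2 * (2 + (K : ℝ))) := ⟨_, rfl⟩
  have hR0 : 0 < R := by rw [hRdef]; positivity
  rw [← hRdef] at hR
  obtain ⟨c, hc⟩ : ∃ c : ENNReal, c = ((1 + K : NNReal) : ENNReal) := ⟨_, rfl⟩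
  have hctop : c ≠ ⊤ := hc ▸ ENNReal.coe_ne_top
  have hc1 : 1 ≤ c := by rw [hc]; exact_mod_cast le_add_of_nonneg_right (zero_le (a := K))
  have hcK : ∀ t : ℝ, ENNReal.ofReal ((1 + K) * t) = c * ENNReal.ofReal t := fun t => by
    rw [ENNReal.ofReal_mul (by positivity), hc]
    congr 1
    rw [ENNReal.ofReal_eq_coe_nnreal (by positivity)]
    norm_cast
  refine ⟨R, hR0, 2 * c ^ (N - 1) + 2 * c ^ 2, ENNReal.add_ne_top.2
    ⟨ENNReal.mul_ne_top (by simp) (ENNReal.pow_ne_top hctop),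
      ENNReal.mul_ne_top (by simp) (ENNReal.pow_ne_top hctop)⟩, fun t ht φ hφ => ?_⟩
  have hφm : Measurable fun x => ‖φ x‖ₑ ^ (2 : ℝ) :=
    hφ.continuous.measurable.enorm.pow_const _
  have hRr : R ≤ r / 2 := by nlinarith
  constructor
  · have h1 := h.lintegral_surf_le ho (ρ := r / 2) (by linarith) hφm
    have h2 := h.lintegral_graph_le ho (ht.2.trans hRr) hφ
    rw [← hc] at h1
    calc _ ≤ ENNReal.ofReal t * ∫⁻ x in Metric.ball x₀ (r / 2), ‖φ x‖ₑ ^ (2 : ℝ) ∂(surf Ω) :=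
          mul_le_mul_right (lintegral_mono_set (Metric.ball_subset_ball hRr)) _
      _ ≤ ENNReal.ofReal t * (c ^ (N - 1) * ∫⁻ y in graphMap e γ ⁻¹' Metric.ball x₀ (r / 2),
            ‖φ (graphMap e γ y)‖ₑ ^ (2 : ℝ)) := mul_le_mul_right h1 _
      _ = c ^ (N - 1) * (ENNReal.ofReal t * ∫⁻ y in graphMap e γ ⁻¹' Metric.ball x₀ (r / 2),
            ‖φ (graphMap e γ y)‖ₑ ^ (2 : ℝ)) := by ring
      _ ≤ _ := mul_le_mul_right h2 _
      _ = (2 * c ^ (N - 1)) * ((∫⁻ x in Ω, ‖φ x‖ₑ ^ (2 : ℝ)) + ENNReal.ofReal t *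
            (ENNReal.ofReal t * ∫⁻ x in Ω, ‖gradient φ x‖ₑ ^ (2 : ℝ))) := by ring
      _ ≤ _ := mul_le_mul_left le_self_add _
  · have ht' : (1 + K) * t ≤ r / 2 := by nlinarith [ht.1, ht.2]
    have h1 := h.lintegral_strip_le ho hR.le ht.1 ht.2 hne hφm
    have h2 := h.lintegral_layer_le' ho ht' hφ
    rw [hcK] at h2
    refine (h1.trans h2).trans ?_
    generalize (∫⁻ x, ‖φ x‖ₑ ^ (2 : ℝ) ∂(surf Ω)) = a
    generalize (∫⁻ x in Ω, ‖gradient φ x‖ₑ ^ (2 : ℝ)) = b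
    generalize ENNReal.ofReal t = τ
    calc 2 * (c * τ * a) + 2 * (c * τ * (c * τ * b))
        = 2 * c * 1 * (τ * a) + 2 * c ^ 2 * (τ * (τ * b)) := by ring
      _ ≤ 2 * c * c * (τ * a) + 2 * c ^ 2 * (τ * (τ * b)) := by gcongr
      _ = 2 * c ^ 2 * (τ * a + τ * (τ * b)) := by ring
      _ ≤ _ := mul_le_mul_left le_add_self _

/-- The estimates hold on a neighbourhood of the whole boundary. -/
lemma exists_hasBoundaryEstimates (hN : 0 < N) (hΩ : IsBoundedLipschitzDomain Ω) :
    ∃ U, IsOpen U ∧ frontier Ω ⊆ U ∧ ∃ R > 0, ∃ C : ENNReal, C ≠ ⊤ ∧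
      HasBoundaryEstimates Ω U R C := by
  have hne := compl_nonempty hN hΩ.isBounded
  have hcomp : IsCompact (frontier Ω) :=
    hΩ.isBounded.isCompact_closure.of_isClosed_subset isClosed_frontier frontier_subset_closure
  refine hcomp.induction_on (p := fun s => ∃ U, IsOpen U ∧ s ⊆ U ∧ ∃ R > 0, ∃ C : ENNReal,
    C ≠ ⊤ ∧ HasBoundaryEstimates Ω U R C) ?_ ?_ ?_ ?_
  · exact ⟨∅, isOpen_empty, subset_rfl, 1, one_pos, 0, by simp, fun t _ φ _ => by simp⟩
  · rintro s s' hs ⟨U, h1, h2, h3⟩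
    exact ⟨U, h1, hs.trans h2, h3⟩
  · rintro s s' ⟨U, hU, hsU, R, hR, C, hC, h⟩ ⟨U', hU', hsU', R', hR', C', hC', h'⟩
    refine ⟨U ∪ U', hU.union hU', Set.union_subset_union hsU hsU', min R R', lt_min hR hR',
      C + C', ENNReal.add_ne_top.2 ⟨hC, hC'⟩, fun t ht φ hφ => ?_⟩
    have a := h t ⟨ht.1, ht.2.trans (min_le_left _ _)⟩ φ hφ
    have a' := h' t ⟨ht.1, ht.2.trans (min_le_right _ _)⟩ φ hφ
    constructor
    · rw [add_mul]
      refine le_trans ?_ (add_le_add a.1 a'.1)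
      rw [← mul_add]
      exact mul_le_mul_right (lintegral_union_le _ _ _) _
    · rw [add_mul, Set.inter_union_distrib_left]
      exact (lintegral_union_le _ _ _).trans (add_le_add a.2 a'.2)
  · intro x hx
    obtain ⟨e, γ, K, r, hch⟩ := hΩ.exists_chart hx
    obtain ⟨R, hR, C, hC, h⟩ := hch.hasBoundaryEstimates hΩ.isOpen hne
    exact ⟨Metric.ball x R, mem_nhdsWithin_of_mem_nhds (Metric.ball_mem_nhds x hR),
      Metric.ball x R, Metric.isOpen_ball, subset_rfl, R, hR, C, hC, h⟩

lemma lintegral_fn_smoothW (ho : IsOpen Ω) (hb : Bornology.IsBounded Ω) {φ : E N → ℝ}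
    (hφ : ContDiff ℝ ∞ φ) :
    ∫⁻ x in Ω, ‖φ x‖ₑ ^ (2 : ℝ) = ENNReal.ofReal (‖fnL (smoothW ho hb hφ)‖ ^ 2) := by
  rw [lintegral_rpow_two_eq, ← eLpNorm_congr_ae (fn_smoothW ho hb hφ), eLpNorm_coe_eq,
    ENNReal.ofReal_rpow_of_nonneg (norm_nonneg _) (by norm_num), Real.rpow_two]

lemma lintegral_grad_smoothW (ho : IsOpen Ω) (hb : Bornology.IsBounded Ω) {φ : E N → ℝ}
    (hφ : ContDiff ℝ ∞ φ) :
    ∫⁻ x in Ω, ‖gradient φ x‖ₑ ^ (2 : ℝ) = ENNReal.ofReal (‖gradL (smoothW ho hb hφ)‖ ^ 2) := by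
  rw [lintegral_rpow_two_eq, ← eLpNorm_congr_ae (grad_smoothW ho hb hφ), eLpNorm_coe_eq,
    ENNReal.ofReal_rpow_of_nonneg (norm_nonneg _) (by norm_num), Real.rpow_two]

lemma surf_restrict_eq {U : Set (E N)} (hU : IsOpen U) (h : frontier Ω ⊆ U) :
    (surf Ω).restrict U = surf Ω := by
  rw [surf, Measure.restrict_restrict hU.measurableSet, Set.inter_eq_self_of_subset_right h]

/-- The trace inequality for smooth functions. -/
lemma exists_trace_smooth_le (hN : 0 < N) (hΩ : IsBoundedLipschitzDomain Ω) :
    ∃ R > 0, ∃ C : ℝ, 0 ≤ C ∧ ∀ t ∈ Set.Ioc 0 R, ∀ φ : E N → ℝ, ∀ hφ : ContDiff ℝ ∞ φ,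
      ∫⁻ x, ‖φ x‖ₑ ^ (2 : ℝ) ∂(surf Ω) ≤ ENNReal.ofReal (C *
        (t⁻¹ * ‖fnL (smoothW hΩ.isOpen hΩ.isBounded hφ)‖ ^ 2 +
          t * ‖gradL (smoothW hΩ.isOpen hΩ.isBounded hφ)‖ ^ 2)) := by
  obtain ⟨U, hU, hfr, R, hR, C, hC, h⟩ := exists_hasBoundaryEstimates hN hΩ
  refine ⟨R, hR, C.toReal, ENNReal.toReal_nonneg, fun t ht φ hφ => ?_⟩
  have h1 := (h t ht φ hφ).1
  rw [surf_restrict_eq hU hfr, lintegral_fn_smoothW hΩ.isOpen hΩ.isBounded hφ,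
    lintegral_grad_smoothW hΩ.isOpen hΩ.isBounded hφ] at h1
  generalize ‖fnL (smoothW hΩ.isOpen hΩ.isBounded hφ)‖ = a at h1 ⊢
  generalize ‖gradL (smoothW hΩ.isOpen hΩ.isBounded hφ)‖ = b at h1 ⊢
  have ht0 := ht.1
  have h2 : C * (ENNReal.ofReal (a ^ 2) + ENNReal.ofReal t *
      (ENNReal.ofReal t * ENNReal.ofReal (b ^ 2))) =
      ENNReal.ofReal t * ENNReal.ofReal (C.toReal * (t⁻¹ * a ^ 2 + t * b ^ 2)) := by
    nth_rewrite 1 [← ENNReal.ofReal_toReal hC]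
    rw [← ENNReal.ofReal_mul ht0.le, ← ENNReal.ofReal_mul ht0.le,
      ← ENNReal.ofReal_add (by positivity) (by positivity),
      ← ENNReal.ofReal_mul ENNReal.toReal_nonneg, ← ENNReal.ofReal_mul ht0.le]
    congr 1
    field_simp
  rw [h2] at h1
  exact (ENNReal.mul_le_mul_iff_right (ENNReal.ofReal_pos.2 ht0).ne' ENNReal.ofReal_ne_top).1 h1

/-- The boundary strip inequality for smooth functions. -/
lemma exists_strip_smooth_le (hN : 0 < N) (hΩ : IsBoundedLipschitzDomain Ω) :
    ∃ R > 0, ∃ C : ENNReal, C ≠ ⊤ ∧ ∀ t ∈ Set.Ioc 0 R, ∀ φ : E N → ℝ, ∀ hφ : ContDiff ℝ ∞ φ,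
      ∫⁻ x in Ω ∩ {x | Metric.infDist x Ωᶜ < t}, ‖φ x‖ₑ ^ (2 : ℝ) ≤
      C * (ENNReal.ofReal t * (∫⁻ x, ‖φ x‖ₑ ^ (2 : ℝ) ∂(surf Ω)) + ENNReal.ofReal t *
        (ENNReal.ofReal t * ENNReal.ofReal
          (‖gradL (smoothW hΩ.isOpen hΩ.isBounded hφ)‖ ^ 2))) := by
  obtain ⟨U, hU, hfr, R, hR, C, hC, h⟩ := exists_hasBoundaryEstimates hN hΩ
  have hcomp : IsCompact (frontier Ω) :=
    hΩ.isBounded.isCompact_closure.of_isClosed_subset isClosed_frontier frontier_subset_closure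
  obtain ⟨δ, hδ, hth⟩ := hcomp.exists_thickening_subset_open hU hfr
  have huniv : Ω ≠ Set.univ := fun h' => by
    obtain ⟨x, hx⟩ := compl_nonempty hN hΩ.isBounded
    exact hx (h' ▸ Set.mem_univ x)
  refine ⟨min R δ, lt_min hR hδ, C, hC, fun t ht φ hφ => ?_⟩
  have h1 := (h t ⟨ht.1, ht.2.trans (min_le_left _ _)⟩ φ hφ).2
  rw [lintegral_grad_smoothW hΩ.isOpen hΩ.isBounded hφ] at h1
  have hsub : Ω ∩ {x | Metric.infDist x Ωᶜ < t} ⊆ Ω ∩ {x | Metric.infDist x Ωᶜ < t} ∩ U := by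
    refine fun x hx => ⟨hx, hth ?_⟩
    obtain ⟨y, hy, hxy⟩ := exists_mem_frontier_infDist_compl_eq_dist hx.1 huniv
    refine Metric.mem_thickening_iff.2 ⟨y, hy, ?_⟩
    rw [← hxy]
    exact lt_of_lt_of_le hx.2 (ht.2.trans (min_le_right _ _))
  exact (lintegral_mono_set hsub).trans h1

lemma isFiniteMeasure_surf (hN : 0 < N) (hΩ : IsBoundedLipschitzDomain Ω) :
    IsFiniteMeasure (surf Ω) := by
  obtain ⟨R, hR, C, -, h⟩ := exists_trace_smooth_le hN hΩ
  have := h R ⟨hR, le_rfl⟩ (fun _ => 1) contDiff_const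
  refine ⟨lt_of_le_of_lt ?_ (this.trans_lt ENNReal.ofReal_lt_top)⟩
  simp

lemma surf_ne_zero (hN : 0 < N) (hΩ : IsBoundedLipschitzDomain Ω) : surf Ω ≠ 0 := by
  intro h0
  have huniv : Ω ≠ Set.univ := fun h => by
    obtain ⟨x, hx⟩ := compl_nonempty hN hΩ.isBounded
    exact hx (h ▸ Set.mem_univ x)
  have hne : (frontier Ω).Nonempty := nonempty_frontier_iff.2
    ⟨hΩ.isConnected.nonempty, huniv⟩
  obtain ⟨x₀, hx₀⟩ := hne
  obtain ⟨e, γ, K, r, h⟩ := hΩ.exists_chart hx₀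
  have h1 := h.lintegral_le_surf hΩ.isOpen le_rfl (f := fun _ => 1) measurable_const
  rw [h0, lintegral_zero_measure, setLIntegral_one] at h1
  have hopen : IsOpen (graphMap e γ ⁻¹' Metric.ball x₀ r) :=
    Metric.isOpen_ball.preimage h.continuous_graphMap
  have hmem : hypProj e x₀ ∈ graphMap e γ ⁻¹' Metric.ball x₀ r := by
    have hB := Metric.mem_ball_self (x := x₀) h.pos
    rw [Set.mem_preimage, h.graphMap_hypProj hΩ.isOpen hx₀ hB]
    exact hB
  exact (hopen.measure_pos volume ⟨_, hmem⟩).ne' (le_antisymm h1 zero_le)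

lemma memLp_surf (hN : 0 < N) (hΩ : IsBoundedLipschitzDomain Ω) {φ : E N → ℝ}
    (hφ : ContDiff ℝ ∞ φ) : MemLp φ 2 (surf Ω) := by
  obtain ⟨R, hR, C, -, h⟩ := exists_trace_smooth_le hN hΩ
  refine ⟨hφ.continuous.aestronglyMeasurable, ?_⟩
  rw [eLpNorm_two_eq]
  exact ENNReal.rpow_lt_top_of_nonneg (by norm_num)
    ((h R ⟨hR, le_rfl⟩ φ hφ).trans_lt ENNReal.ofReal_lt_top).ne

end BoundaryEstimates

/-! ### The trace operator -/

section Trace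

variable {N : ℕ} {Ω : Set (E N)}

/-- The smooth functions on `ℝ^N`. -/
def smoothFns (N : ℕ) : Submodule ℝ (E N → ℝ) where
  carrier := {φ | ContDiff ℝ ∞ φ}
  zero_mem' := (contDiff_const : ContDiff ℝ ∞ fun _ : E N => (0 : ℝ))
  add_mem' := fun {φ ψ} (h : ContDiff ℝ ∞ φ) (h' : ContDiff ℝ ∞ ψ) => h.add h'
  smul_mem' := fun c φ (h : ContDiff ℝ ∞ φ) => h.const_smul c

/-- The restriction of smooth functions to `Ω`, as a linear map to `W^{1,2}(Ω)`. -/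
def smoothToW (hΩ : IsBoundedLipschitzDomain Ω) : smoothFns N →ₗ[ℝ] WS Ω where
  toFun φ := smoothW hΩ.isOpen hΩ.isBounded φ.2
  map_add' φ ψ := by
    refine (eq_smoothW hΩ.isOpen hΩ.isBounded _ ?_).symm
    exact (Lp.coeFn_add _ _).trans ((fn_smoothW hΩ.isOpen hΩ.isBounded φ.2).add
      (fn_smoothW hΩ.isOpen hΩ.isBounded ψ.2))
  map_smul' c φ := by
    refine (eq_smoothW hΩ.isOpen hΩ.isBounded _ ?_).symm
    exact (Lp.coeFn_smul _ _).trans ((fn_smoothW hΩ.isOpen hΩ.isBounded φ.2).const_smul c)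

/-- The restriction of smooth functions to `∂Ω`. -/
def smoothToBd (hN : 0 < N) (hΩ : IsBoundedLipschitzDomain Ω) : smoothFns N →ₗ[ℝ] L2Bd Ω where
  toFun φ := (memLp_surf hN hΩ φ.2).toLp φ
  map_add' _ _ := MemLp.toLp_add _ _
  map_smul' c φ := MemLp.toLp_const_smul c (memLp_surf hN hΩ φ.2)

lemma smoothToBd_coeFn (hN : 0 < N) (hΩ : IsBoundedLipschitzDomain Ω) (φ : smoothFns N) :
    smoothToBd hN hΩ φ =ᵐ[surf Ω] φ := MemLp.coeFn_toLp (memLp_surf hN hΩ φ.2)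

lemma denseRange_smoothToW (hΩ : IsBoundedLipschitzDomain Ω) : DenseRange (smoothToW hΩ) :=
  fun u => induction_smooth hΩ (p := fun u => u ∈ closure (Set.range (smoothToW hΩ)))
    isClosed_closure (fun φ hφ => subset_closure ⟨⟨φ, hφ⟩, rfl⟩) u

lemma norm_smoothToBd_sq (hN : 0 < N) (hΩ : IsBoundedLipschitzDomain Ω) (φ : smoothFns N) :
    ENNReal.ofReal (‖smoothToBd hN hΩ φ‖ ^ 2) = ∫⁻ x, ‖(φ : E N → ℝ) x‖ₑ ^ (2 : ℝ) ∂(surf Ω) := by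
  rw [lintegral_rpow_two_eq, ← eLpNorm_congr_ae (smoothToBd_coeFn hN hΩ φ), eLpNorm_coe_eq,
    ENNReal.ofReal_rpow_of_nonneg (norm_nonneg _) (by norm_num), Real.rpow_two]

lemma exists_norm_smoothToBd_le (hN : 0 < N) (hΩ : IsBoundedLipschitzDomain Ω) :
    ∃ R > 0, ∃ C : ℝ, 0 ≤ C ∧ ∀ t ∈ Set.Ioc 0 R, ∀ φ : smoothFns N, ‖smoothToBd hN hΩ φ‖ ^ 2 ≤
      C * (t⁻¹ * ‖fnL (smoothToW hΩ φ)‖ ^ 2 + t * ‖gradL (smoothToW hΩ φ)‖ ^ 2) := by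
  obtain ⟨R, hR, C, hC, h⟩ := exists_trace_smooth_le hN hΩ
  refine ⟨R, hR, C, hC, fun t ht φ => ?_⟩
  have h1 := h t ht φ φ.2
  rw [← norm_smoothToBd_sq hN hΩ] at h1
  refine (ENNReal.ofReal_le_ofReal_iff ?_).1 h1
  have := ht.1
  positivity

lemma exists_isTraceOperator (hN : 0 < N) (hΩ : IsBoundedLipschitzDomain Ω) :
    ∃ T, IsTraceOperator Ω T := by
  have hbd : ∃ C, ∀ φ : smoothFns N, ‖smoothToBd hN hΩ φ‖ ≤ C * ‖smoothToW hΩ φ‖ := by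
    obtain ⟨R, hR, C, hC, h⟩ := exists_norm_smoothToBd_le hN hΩ
    refine ⟨Real.sqrt (C * (R⁻¹ + R)), fun φ => ?_⟩
    refine abs_le_of_sq_le_sq' ?_ (by positivity) |>.2
    rw [mul_pow, Real.sq_sqrt (by positivity), norm_sq_WS]
    refine (h R ⟨hR, le_rfl⟩ φ).trans ?_
    rw [mul_assoc]
    refine mul_le_mul_of_nonneg_left ?_ hC
    have h1 : 0 ≤ R * ‖fnL (smoothToW hΩ φ)‖ ^ 2 := by positivity
    have h2 : 0 ≤ R⁻¹ * ‖gradL (smoothToW hΩ φ)‖ ^ 2 := by positivity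
    linarith
  refine ⟨((smoothToBd hN hΩ).extendOfNorm (smoothToW hΩ)).comp
    (eqv Ω).symm.toContinuousLinearEquiv.toContinuousLinearMap, fun φ hφ u hu => ?_⟩
  have hu' : (eqv Ω).symm u = smoothToW hΩ ⟨φ, hφ⟩ := eq_smoothW hΩ.isOpen hΩ.isBounded hφ hu
  have h1 : ((smoothToBd hN hΩ).extendOfNorm (smoothToW hΩ)).comp
      (eqv Ω).symm.toContinuousLinearEquiv.toContinuousLinearMap u =
      smoothToBd hN hΩ ⟨φ, hφ⟩ := by
    change (smoothToBd hN hΩ).extendOfNorm (smoothToW hΩ) ((eqv Ω).symm u) = _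
    rw [hu', LinearMap.extendOfNorm_eq (denseRange_smoothToW hΩ) hbd]
  rw [h1]
  exact smoothToBd_coeFn hN hΩ ⟨φ, hφ⟩

lemma IsTraceOperator.eq (hΩ : IsBoundedLipschitzDomain Ω) {T T' : W12 Ω →L[ℝ] L2Bd Ω}
    (h : IsTraceOperator Ω T) (h' : IsTraceOperator Ω T') : T = T' := by
  have key : ∀ u : WS Ω, T (eqv Ω u) = T' (eqv Ω u) := by
    refine induction_smooth hΩ (isClosed_eq (T.continuous.comp (eqv Ω).continuous)
      (T'.continuous.comp (eqv Ω).continuous)) fun φ hφ => Lp.ext ?_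
    have hf := fn_smoothW hΩ.isOpen hΩ.isBounded hφ
    rw [← fn_eqv] at hf
    exact (h φ hφ _ hf).trans (h' φ hφ _ hf).symm
  ext1 u
  exact key ((eqv Ω).symm u)

theorem existsUnique_isTraceOperator (hN : 0 < N) (hΩ : IsBoundedLipschitzDomain Ω) :
    ∃! T, IsTraceOperator Ω T := by
  obtain ⟨T, hT⟩ := exists_isTraceOperator hN hΩ
  exact ⟨T, hT, fun T' hT' => IsTraceOperator.eq hΩ hT' hT⟩

/-- The trace operator on `WS Ω`. -/
def tr (Ω : Set (E N)) : WS Ω →L[ℝ] L2Bd Ω :=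
  (trace Ω).comp (eqv Ω).toContinuousLinearEquiv.toContinuousLinearMap

lemma isTraceOperator_trace (hN : 0 < N) (hΩ : IsBoundedLipschitzDomain Ω) :
    IsTraceOperator Ω (trace Ω) := by
  have h := exists_isTraceOperator hN hΩ
  rw [trace, dif_pos h]
  exact h.choose_spec

lemma tr_ae_eq (hN : 0 < N) (hΩ : IsBoundedLipschitzDomain Ω) {φ : E N → ℝ}
    (hφ : ContDiff ℝ ∞ φ) {u : WS Ω} (hu : fnL u =ᵐ[volume.restrict Ω] φ) :
    tr Ω u =ᵐ[surf Ω] φ := isTraceOperator_trace hN hΩ φ hφ (eqv Ω u) hu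

lemma tr_smoothToW (hN : 0 < N) (hΩ : IsBoundedLipschitzDomain Ω) (φ : smoothFns N) :
    tr Ω (smoothToW hΩ φ) = smoothToBd hN hΩ φ :=
  Lp.ext ((tr_ae_eq hN hΩ φ.2 (fn_smoothW hΩ.isOpen hΩ.isBounded φ.2)).trans
    (smoothToBd_coeFn hN hΩ φ).symm)

/-- The trace inequality, with a parameter. -/
theorem exists_norm_tr_sq_le (hN : 0 < N) (hΩ : IsBoundedLipschitzDomain Ω) :
    ∃ R > 0, ∃ C : ℝ, 0 ≤ C ∧ ∀ t ∈ Set.Ioc 0 R, ∀ u : WS Ω, ‖tr Ω u‖ ^ 2 ≤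
      C * (t⁻¹ * ‖fnL u‖ ^ 2 + t * ‖gradL u‖ ^ 2) := by
  obtain ⟨R, hR, C, hC, h⟩ := exists_norm_smoothToBd_le hN hΩ
  refine ⟨R, hR, C, hC, fun t ht => induction_smooth hΩ (isClosed_le ?_ ?_) fun φ hφ => ?_⟩
  · exact (tr Ω).continuous.norm.pow 2
  · exact continuous_const.mul ((continuous_const.mul (fnL.continuous.norm.pow 2)).add
      (continuous_const.mul (gradL.continuous.norm.pow 2)))
  · have := h t ht ⟨φ, hφ⟩
    rwa [← tr_smoothToW hN hΩ] at this

/-- The trace operator is compact: it maps bounded weakly convergent families to strongly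
convergent ones. -/
theorem tendsto_tr {ι : Type*} (hN : 0 < N) (hΩ : IsBoundedLipschitzDomain Ω) {U : Filter ι}
    [U.NeBot] {u : ι → WS Ω} {u' : WS Ω} (h : WeakLim U u u') {M : ℝ} (hM : ∀ i, ‖u i‖ ≤ M) :
    Tendsto (fun i => tr Ω (u i)) U (𝓝 (tr Ω u')) := by
  obtain ⟨R, hR, C, hC, htr⟩ := exists_norm_tr_sq_le hN hΩ
  have hfn := rellich hΩ h hM
  have hM0 : 0 ≤ M := by
    have : (Set.univ : Set ι).Nonempty := U.nonempty_of_mem univ_mem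
    exact (norm_nonneg _).trans (hM this.some)
  have hu' := h.norm_le hM0 hM
  rw [tendsto_iff_norm_sub_tendsto_zero] at hfn ⊢
  have hsq : Tendsto (fun i => ‖tr Ω (u i) - tr Ω u'‖ ^ 2) U (𝓝 0) := by
    refine (tendsto_order.2 ⟨fun a ha => Eventually.of_forall fun i =>
      ha.trans_le (by positivity), fun a ha => ?_⟩)
    obtain ⟨t, ht, htR, hta⟩ : ∃ t, 0 < t ∧ t ≤ R ∧ C * (t * (2 * M) ^ 2) < a / 2 := by
      refine ⟨min R (a / (4 * (C * (2 * M) ^ 2 + 1))), by positivity, min_le_left _ _, ?_⟩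
      have h1 : min R (a / (4 * (C * (2 * M) ^ 2 + 1))) ≤ a / (4 * (C * (2 * M) ^ 2 + 1)) :=
        min_le_right _ _
      have h2 : 0 ≤ C * (2 * M) ^ 2 := by positivity
      calc C * (min R (a / (4 * (C * (2 * M) ^ 2 + 1))) * (2 * M) ^ 2)
          = min R (a / (4 * (C * (2 * M) ^ 2 + 1))) * (C * (2 * M) ^ 2) := by ring
        _ ≤ a / (4 * (C * (2 * M) ^ 2 + 1)) * (C * (2 * M) ^ 2 + 1) := by
          gcongr
          linarith
        _ = a / 4 := by field_simp
        _ < a / 2 := by linarith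
    have hlim : Tendsto (fun i => C * (t⁻¹ * ‖fnL (u i) - fnL u'‖ ^ 2)) U (𝓝 0) := by
      simpa using ((hfn.pow 2).const_mul t⁻¹).const_mul C
    filter_upwards [hlim.eventually_lt_const (show (0 : ℝ) < a / 2 by linarith)] with i hi
    have h1 := htr t ⟨ht, htR⟩ (u i - u')
    rw [map_sub, map_sub] at h1
    have h2 : ‖gradL (u i - u')‖ ≤ 2 * M := by
      refine (norm_gradL_le _).trans ((norm_sub_le _ _).trans ?_)
      linarith [hM i]
    have h3 : C * (t * ‖gradL (u i - u')‖ ^ 2) ≤ C * (t * (2 * M) ^ 2) := by gcongr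
    rw [mul_add] at h1
    linarith
  have := hsq.sqrt
  simpa [Real.sqrt_sq (norm_nonneg _)] using this

lemma IsTest.tr_eq_zero (hN : 0 < N) (hΩ : IsBoundedLipschitzDomain Ω) {φ : E N → ℝ}
    (hφ : IsTest Ω φ) {u : WS Ω} (hu : fnL u =ᵐ[volume.restrict Ω] φ) : tr Ω u = 0 := by
  refine Lp.ext ((tr_ae_eq hN hΩ hφ.smooth hu).trans ?_)
  have h : ∀ᵐ x ∂(surf Ω), x ∈ frontier Ω := ae_restrict_mem isClosed_frontier.measurableSet
  filter_upwards [h, Lp.coeFn_zero ℝ 2 (surf Ω)] with x hx h0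
  rw [h0, Pi.zero_apply]
  refine image_eq_zero_of_notMem_tsupport fun hx' => ?_
  rw [hΩ.isOpen.frontier_eq] at hx
  exact hx.2 (hφ.subset hx')

/-- Functions in `W^{1,2}_0(Ω)` have zero trace. -/
lemma tr_eq_zero_of_mem_W0 (hN : 0 < N) (hΩ : IsBoundedLipschitzDomain Ω) {u : WS Ω}
    (hu : u ∈ W0 Ω) : tr Ω u = 0 := by
  have h1 : eqv Ω u ∈ closure (testSubmodule Ω : Set (W12 Ω)) := hu
  have hcl : IsClosed {w : W12 Ω | trace Ω w = 0} :=
    isClosed_eq (trace Ω).continuous continuous_const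
  refine closure_minimal ?_ hcl h1
  rintro w ⟨φ, hφ, hw⟩
  exact hφ.tr_eq_zero hN hΩ (u := (eqv Ω).symm w) hw

end Trace

/-! ### Functions with zero trace -/

section ZeroTrace

variable {N : ℕ} {Ω : Set (E N)}

/-- Multiplication by the indicator function of `S` in `L²(Ω)`. -/
def cut (Ω S : Set (E N)) : L2 Ω →L[ℝ] L2 Ω :=
  mulOp (volume.restrict Ω) (sField (S.indicator fun _ => (1 : ℝ)))

lemma cut_coeFn {S : Set (E N)} (hS : MeasurableSet S) (u : L2 Ω) :
    cut Ω S u =ᵐ[volume.restrict Ω] S.indicator u := by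
  have h : IsBddField (volume.restrict Ω) (sField (F := ℝ) (S.indicator fun _ => (1 : ℝ))) 1 := by
    refine ⟨?_, Eventually.of_forall fun x => ?_⟩
    · exact ((measurable_const.indicator hS).aestronglyMeasurable).smul_const _
    · by_cases hx : x ∈ S <;> simp [sField, hx]
  filter_upwards [h.coeFn u] with x hx
  rw [cut, hx]
  by_cases hx : x ∈ S <;> simp [sField, hx]

lemma norm_cut_sq {S : Set (E N)} (hS : MeasurableSet S) (u : L2 Ω) :
    ENNReal.ofReal (‖cut Ω S u‖ ^ 2) = ∫⁻ x in Ω ∩ S, ‖u x‖ₑ ^ (2 : ℝ) := by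
  have h : ENNReal.ofReal (‖cut Ω S u‖ ^ 2) = eLpNorm (cut Ω S u) 2 (volume.restrict Ω) ^ (2 : ℝ) := by
    rw [eLpNorm_coe_eq, ENNReal.ofReal_rpow_of_nonneg (norm_nonneg _) (by norm_num), Real.rpow_two]
  rw [h, eLpNorm_congr_ae (cut_coeFn hS u), eLpNorm_indicator_eq_eLpNorm_restrict hS,
    ← lintegral_rpow_two_eq, Measure.restrict_restrict hS, Set.inter_comm]

/-- The points at distance less than `t` from the complement of `Ω`. -/
def strip (Ω : Set (E N)) (t : ℝ) : Set (E N) := {x | Metric.infDist x Ωᶜ < t}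

lemma measurableSet_strip (t : ℝ) : MeasurableSet (strip Ω t) :=
  (isOpen_lt (Metric.continuous_infDist_pt _) continuous_const).measurableSet

/-- The boundary strip inequality. -/
lemma exists_norm_cut_sq_le (hN : 0 < N) (hΩ : IsBoundedLipschitzDomain Ω) :
    ∃ R > 0, ∃ C : ℝ, 0 ≤ C ∧ ∀ t ∈ Set.Ioc 0 R, ∀ u : WS Ω, ‖cut Ω (strip Ω t) (fnL u)‖ ^ 2 ≤
      C * (t * ‖tr Ω u‖ ^ 2 + t * (t * ‖gradL u‖ ^ 2)) := by
  obtain ⟨R, hR, C, hC, h⟩ := exists_strip_smooth_le hN hΩ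
  refine ⟨R, hR, C.toReal, ENNReal.toReal_nonneg, fun t ht =>
    induction_smooth hΩ (isClosed_le ?_ ?_) fun φ hφ => ?_⟩
  · exact ((cut Ω (strip Ω t)).continuous.comp fnL.continuous).norm.pow 2
  · exact continuous_const.mul ((continuous_const.mul ((tr Ω).continuous.norm.pow 2)).add
      (continuous_const.mul (continuous_const.mul (gradL.continuous.norm.pow 2))))
  · have ht0 := ht.1
    have h1 := h t ht φ hφ
    have h2 : ∫⁻ x in Ω ∩ strip Ω t, ‖φ x‖ₑ ^ (2 : ℝ) = ENNReal.ofReal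
        (‖cut Ω (strip Ω t) (fnL (smoothW hΩ.isOpen hΩ.isBounded hφ))‖ ^ 2) := by
      rw [norm_cut_sq (measurableSet_strip t)]
      refine lintegral_congr_ae ?_
      filter_upwards [ae_mono (Measure.restrict_mono Set.inter_subset_left le_rfl)
        (fn_smoothW hΩ.isOpen hΩ.isBounded hφ)] with x hx
      rw [hx]
    have h3 := norm_smoothToBd_sq hN hΩ ⟨φ, hφ⟩
    rw [← tr_smoothToW hN hΩ] at h3
    change ENNReal.ofReal (‖tr Ω (smoothW hΩ.isOpen hΩ.isBounded hφ)‖ ^ 2) = _ at h3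
    change ∫⁻ x in Ω ∩ strip Ω t, ‖φ x‖ₑ ^ (2 : ℝ) ≤ _ at h1
    rw [h2, ← h3, ← ENNReal.ofReal_toReal hC, ← ENNReal.ofReal_mul ht0.le,
      ← ENNReal.ofReal_mul ht0.le, ← ENNReal.ofReal_mul ht0.le,
      ← ENNReal.ofReal_add (by positivity) (by positivity),
      ← ENNReal.ofReal_mul ENNReal.toReal_nonneg] at h1
    exact (ENNReal.ofReal_le_ofReal_iff (by positivity)).1 h1

lemma exists_lipschitz_smoothTransition : ∃ L : NNReal, LipschitzWith L Real.smoothTransition := by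
  have hd : Differentiable ℝ Real.smoothTransition :=
    (Real.smoothTransition.contDiff (n := 1)).differentiable (by simp)
  have hc : Continuous (deriv Real.smoothTransition) :=
    (Real.smoothTransition.contDiff (n := 1)).continuous_deriv le_rfl
  obtain ⟨C, hC⟩ := (isCompact_Icc (a := (0 : ℝ)) (b := 1)).exists_bound_of_continuousOn
    hc.continuousOn
  refine ⟨C.toNNReal, lipschitzWith_of_nnnorm_deriv_le hd fun x => ?_⟩
  rw [← NNReal.coe_le_coe, coe_nnnorm]
  by_cases hx : x ∈ Set.Icc (0 : ℝ) 1
  · exact (hC x hx).trans (Real.le_coe_toNNReal C)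
  · have h0 : deriv Real.smoothTransition x = 0 := by
      rw [Set.mem_Icc, not_and_or, not_le, not_le] at hx
      rcases hx with hx | hx
      · have : Real.smoothTransition =ᶠ[𝓝 x] fun _ => 0 := by
          filter_upwards [Iio_mem_nhds hx] with y hy
          exact Real.smoothTransition.zero_of_nonpos (le_of_lt hy)
        rw [this.deriv_eq, deriv_const]
      · have : Real.smoothTransition =ᶠ[𝓝 x] fun _ => 1 := by
          filter_upwards [Ioi_mem_nhds hx] with y hy
          exact Real.smoothTransition.one_of_one_le (le_of_lt hy)
        rw [this.deriv_eq, deriv_const]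
    rw [h0, norm_zero]
    exact NNReal.coe_nonneg _

lemma integrable_mollifier_mul {ρ : E N → ℝ} {ε : ℝ} (hρ : IsMollifier ρ ε) {f : E N → ℝ}
    (hf : Continuous f) (y : E N) : Integrable fun z => ρ z • f (y - z) := by
  refine Continuous.integrable_of_hasCompactSupport ?_ hρ.compact.smul_right
  exact hρ.smooth.continuous.smul (hf.comp (by fun_prop))

/-- Mollification does not increase Lipschitz constants. -/
lemma lipschitz_moll {ρ : E N → ℝ} {ε : ℝ} (hρ : IsMollifier ρ ε) {f : E N → ℝ} {K : NNReal}
    (hf : LipschitzWith K f) : LipschitzWith K (moll ρ f) := by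
  refine LipschitzWith.of_dist_le_mul fun x y => ?_
  rw [Real.dist_eq, moll_eq, moll_eq, ← integral_sub (integrable_mollifier_mul hρ hf.continuous x)
    (integrable_mollifier_mul hρ hf.continuous y), ← Real.norm_eq_abs]
  calc _ ≤ ∫ z, ρ z * (K * dist x y) := by
        refine norm_integral_le_of_norm_le (hρ.integrable.mul_const _) (Eventually.of_forall
          fun z => ?_)
        rw [← smul_sub, norm_smul, Real.norm_of_nonneg (hρ.nonneg z), Real.norm_eq_abs,
          ← Real.dist_eq]
        refine mul_le_mul_of_nonneg_left ?_ (hρ.nonneg z)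
        simpa using hf.dist_le_mul (x - z) (y - z)
    _ = K * dist x y := by rw [integral_mul_const, hρ.integral_eq, one_mul]

lemma abs_moll_sub_le {ρ : E N → ℝ} {ε : ℝ} (hρ : IsMollifier ρ ε) {f : E N → ℝ}
    (hf : LipschitzWith 1 f) (x : E N) : |moll ρ f x - f x| ≤ ε := by
  have h1 : f x = ∫ z, ρ z • f x := by
    simp_rw [smul_eq_mul]
    rw [integral_mul_const, hρ.integral_eq, one_mul]
  rw [moll_eq]
  nth_rewrite 1 [h1]
  rw [← integral_sub (integrable_mollifier_mul hρ hf.continuous x)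
    (hρ.integrable.smul_const _), ← Real.norm_eq_abs]
  calc _ ≤ ∫ z, ρ z * ε := by
        refine norm_integral_le_of_norm_le (hρ.integrable.mul_const _) (Eventually.of_forall
          fun z => ?_)
        rw [← smul_sub, norm_smul, Real.norm_of_nonneg (hρ.nonneg z), Real.norm_eq_abs,
          ← Real.dist_eq]
        by_cases hz : ε < ‖z‖
        · rw [hρ.eq_zero hz, zero_mul, zero_mul]
        · refine mul_le_mul_of_nonneg_left ?_ (hρ.nonneg z)
          have := hf.dist_le_mul (x - z) x
          rw [NNReal.coe_one, one_mul, dist_eq_norm (x - z), sub_sub_cancel_left, norm_neg] at this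
          exact this.trans (not_lt.1 hz)
    _ = ε := by rw [integral_mul_const, hρ.integral_eq, one_mul]

/-- Smooth cut-off functions at distance comparable to `δ` from the boundary. -/
lemma exists_cutoff (N : ℕ) : ∃ L : ℝ, 0 ≤ L ∧ ∀ (Ω : Set (E N)), IsOpen Ω →
    Bornology.IsBounded Ω → Ωᶜ.Nonempty → ∀ δ : ℝ, 0 < δ → ∃ χ : E N → ℝ, IsTest Ω χ ∧
      (∀ x, χ x ∈ Set.Icc (0 : ℝ) 1) ∧ (∀ x ∉ strip Ω (5 * δ), χ x = 1 ∧ gradient χ x = 0) ∧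
      ∀ x, ‖gradient χ x‖ ≤ L / δ := by
  obtain ⟨L, hL⟩ := exists_lipschitz_smoothTransition
  refine ⟨L, NNReal.coe_nonneg L, fun Ω ho hb hne δ hδ => ?_⟩
  obtain ⟨ρ, hρ⟩ := exists_isMollifier N hδ
  have hd : LipschitzWith 1 fun x => Metric.infDist x Ωᶜ := Metric.lipschitz_infDist_pt _
  obtain ⟨d, hdef⟩ : ∃ d, d = moll ρ fun x => Metric.infDist x Ωᶜ := ⟨_, rfl⟩
  have hdl : LipschitzWith 1 d := hdef ▸ lipschitz_moll hρ hd
  have hds : ContDiff ℝ ∞ d := hdef ▸ contDiff_moll hρ hd.continuous.locallyIntegrable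
  have hdd : ∀ x, |d x - Metric.infDist x Ωᶜ| ≤ δ := fun x => hdef ▸ abs_moll_sub_le hρ hd x
  -- the mollified distance `d` is within `δ` of the distance, so a transition from `0` to `1`
  -- between `d = 2δ` and `d = 3δ` takes place at distances between `δ` and `4δ`
  obtain ⟨χ, hχ⟩ : ∃ χ : E N → ℝ, χ = fun x => Real.smoothTransition (δ⁻¹ * d x - 2) := ⟨_, rfl⟩
  have hχs : ContDiff ℝ ∞ χ := by
    rw [hχ]
    exact Real.smoothTransition.contDiff.comp ((contDiff_const.mul hds).sub contDiff_const)
  have hone : ∀ x, 4 * δ ≤ Metric.infDist x Ωᶜ → χ x = 1 := fun x hx => by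
    rw [hχ]
    refine Real.smoothTransition.one_of_one_le ?_
    have h1 := (abs_le.1 (hdd x)).1
    have h2 : 3 * δ ≤ d x := by linarith
    have h3 : δ⁻¹ * (3 * δ) ≤ δ⁻¹ * d x := by gcongr
    have h4 : δ⁻¹ * (3 * δ) = 3 := by field_simp
    linarith
  have hzero : ∀ x, Metric.infDist x Ωᶜ < δ → χ x = 0 := fun x hx => by
    rw [hχ]
    refine Real.smoothTransition.zero_of_nonpos ?_
    have h1 := (abs_le.1 (hdd x)).2
    have h2 : d x ≤ 2 * δ := by linarith
    have h3 : δ⁻¹ * d x ≤ δ⁻¹ * (2 * δ) := by gcongr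
    have h4 : δ⁻¹ * (2 * δ) = 2 := by field_simp
    linarith
  have hsupp : tsupport χ ⊆ {x | δ ≤ Metric.infDist x Ωᶜ} := by
    refine closure_minimal (fun x hx => ?_) (isClosed_le continuous_const
      (Metric.continuous_infDist_pt _))
    by_contra h
    exact hx (hzero x (not_le.1 h))
  have hsub : tsupport χ ⊆ Ω := fun x hx => by
    by_contra h
    have h1 : δ ≤ Metric.infDist x Ωᶜ := hsupp hx
    rw [Metric.infDist_zero_of_mem h] at h1
    linarith
  have hlip : LipschitzWith (L * (Real.toNNReal δ⁻¹ * 1)) χ := by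
    rw [hχ]
    refine hL.comp ?_
    refine LipschitzWith.of_dist_le_mul fun x y => ?_
    have h1 := hdl.dist_le_mul x y
    rw [Real.dist_eq] at h1 ⊢
    have h2 : δ⁻¹ * d x - 2 - (δ⁻¹ * d y - 2) = δ⁻¹ * (d x - d y) := by ring
    rw [h2, abs_mul, abs_of_pos (inv_pos.2 hδ)]
    push_cast
    rw [Real.coe_toNNReal _ (inv_pos.2 hδ).le, mul_assoc]
    exact mul_le_mul_of_nonneg_left h1 (inv_pos.2 hδ).le
  refine ⟨χ, ⟨hχs, ?_, hsub⟩, fun x => ?_, fun x hx => ?_, fun x => ?_⟩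
  · exact Metric.isCompact_of_isClosed_isBounded (isClosed_tsupport χ) (hb.subset hsub)
  · rw [hχ]
    exact ⟨Real.smoothTransition.nonneg _, Real.smoothTransition.le_one _⟩
  · have hx' : 5 * δ ≤ Metric.infDist x Ωᶜ := not_lt.1 hx
    refine ⟨hone x (by linarith), ?_⟩
    have hev : χ =ᶠ[𝓝 x] fun _ => 1 := by
      have : {y | 4 * δ < Metric.infDist y Ωᶜ} ∈ 𝓝 x :=
        (isOpen_lt continuous_const (Metric.continuous_infDist_pt _)).mem_nhds
          (show 4 * δ < Metric.infDist x Ωᶜ by linarith)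
      filter_upwards [this] with y hy using hone y (le_of_lt hy)
    rw [gradient, hev.fderiv_eq]
    simp
  · rw [norm_gradient_eq]
    refine (norm_fderiv_le_of_lipschitz ℝ hlip).trans (le_of_eq ?_)
    push_cast
    rw [Real.coe_toNNReal _ (inv_pos.2 hδ).le, mul_one, div_eq_mul_inv]

/-- Functions with zero trace belong to `W^{1,2}_0(Ω)`: the products with cut-off functions are
bounded in `W^{1,2}(Ω)` by the strip inequality, and converge to the function in `L²`. -/
theorem mem_W0_of_tr_eq_zero (hN : 0 < N) (hΩ : IsBoundedLipschitzDomain Ω) {u : WS Ω}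
    (hu : tr Ω u = 0) : u ∈ W0 Ω := by
  have ho := hΩ.isOpen
  have hb := hΩ.isBounded
  obtain ⟨R, hR, C, hC, hstrip⟩ := exists_norm_cut_sq_le hN hΩ
  obtain ⟨L, hL, hcut⟩ := exists_cutoff N
  have hδ : ∀ n : ℕ, 0 < R / (5 * (n + 1)) := fun n => by positivity
  choose χ hχ h01 hin hgr using fun n : ℕ =>
    hcut Ω ho hb (compl_nonempty hN hb) (R / (5 * (n + 1))) (hδ n)
  -- the `L²` norm of `u` over the strip
  have hs : ∀ n : ℕ, ‖cut Ω (strip Ω (5 * (R / (5 * (n + 1))))) (fnL u)‖ ≤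
      Real.sqrt C * (5 * (R / (5 * (n + 1)))) * ‖gradL u‖ := fun n => by
    have hδn := hδ n
    have h1 := hstrip (5 * (R / (5 * (n + 1)))) ⟨by positivity, by
      rw [show 5 * (R / (5 * ((n : ℝ) + 1))) = R / (n + 1) by field_simp]
      exact div_le_self hR.le (by linarith [n.cast_nonneg (α := ℝ)])⟩ u
    rw [hu, norm_zero] at h1
    refine abs_le_of_sq_le_sq' ?_ (by positivity) |>.2
    rw [mul_pow, mul_pow, Real.sq_sqrt hC]
    refine h1.trans (le_of_eq (by ring))
  obtain ⟨v, hv⟩ : ∃ v : ℕ → WS Ω, v = fun n => mulW ho hb (hχ n).smooth u := ⟨_, rfl⟩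
  have hv0 : ∀ n, v n ∈ W0 Ω := fun n => hv ▸ mulW_mem_W0 hΩ (hχ n) u
  have hstr : ∀ᵐ x ∂volume.restrict Ω, ∀ n : ℕ, cut Ω (strip Ω (5 * (R / (5 * (n + 1))))) (fnL u) x
      = (strip Ω (5 * (R / (5 * ((n : ℝ) + 1))))).indicator (fnL u) x :=
    ae_all_iff.2 fun n => cut_coeFn (measurableSet_strip _) _
  have hfn : ∀ n, ‖fnL (v n) - fnL u‖ ≤
      Real.sqrt C * (5 * (R / (5 * (n + 1)))) * ‖gradL u‖ := fun n => by
    refine le_trans ?_ (hs n)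
    refine (Lp.norm_le_mul_norm_of_ae_le_mul (c := 1) ?_).trans (one_mul _).le
    have h1 := fn_mulW_ae ho hb (hχ n).smooth u
    rw [hv]
    filter_upwards [Lp.coeFn_sub (fnL (mulW ho hb (hχ n).smooth u)) (fnL u), h1, hstr]
      with x a1 a2 a3
    rw [a1, Pi.sub_apply, a2, a3, one_mul]
    by_cases hx : x ∈ strip Ω (5 * (R / (5 * ((n : ℝ) + 1))))
    · rw [Set.indicator_of_mem hx]
      have h2 : χ n x * fnL u x - fnL u x = (χ n x - 1) * fnL u x := by ring
      rw [h2, norm_mul]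
      refine mul_le_of_le_one_left (norm_nonneg _) ?_
      rw [Real.norm_eq_abs, abs_le]
      constructor <;> linarith [(h01 n x).1, (h01 n x).2]
    · rw [Set.indicator_of_notMem hx, (hin n x hx).1, one_mul, sub_self]
  have hgrad : ∀ n, ‖gradL (v n)‖ ≤ ‖gradL u‖ + L * 5 * Real.sqrt C * ‖gradL u‖ := fun n => by
    have hδn := hδ n
    have hdec : gradL (v n) = mulOp (volume.restrict Ω) (sField (χ n)) (gradL u) +
        mulOp (volume.restrict Ω) (gField (χ n)) (fnL u) := by rw [hv]; exact grad_mulW ..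
    rw [hdec]
    refine (norm_add_le _ _).trans (add_le_add ?_ ?_)
    · refine (Lp.norm_le_mul_norm_of_ae_le_mul (c := 1) ?_).trans (one_mul _).le
      filter_upwards [sField_coeFn ho hb (hχ n).smooth.continuous (gradL u)] with x hx
      rw [hx, norm_smul]
      refine mul_le_mul_of_nonneg_right ?_ (norm_nonneg _)
      rw [Real.norm_of_nonneg (h01 n x).1]
      exact (h01 n x).2
    · have h1 : ‖mulOp (volume.restrict Ω) (gField (χ n)) (fnL u)‖ ≤
          L / (R / (5 * (n + 1))) * ‖cut Ω (strip Ω (5 * (R / (5 * (n + 1))))) (fnL u)‖ := by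
        refine Lp.norm_le_mul_norm_of_ae_le_mul ?_
        filter_upwards [gField_coeFn ho hb (hχ n).smooth (fnL u), hstr] with x hx a3
        rw [hx, a3, norm_smul]
        by_cases hx : x ∈ strip Ω (5 * (R / (5 * ((n : ℝ) + 1))))
        · rw [Set.indicator_of_mem hx, mul_comm]
          exact mul_le_mul_of_nonneg_right (hgr n x) (norm_nonneg _)
        · rw [Set.indicator_of_notMem hx, (hin n x hx).2, norm_zero, norm_zero, mul_zero, mul_zero]
      refine h1.trans ((mul_le_mul_of_nonneg_left (hs n) (by positivity)).trans (le_of_eq ?_))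
      field_simp
  have hlim : Tendsto (fun n : ℕ => Real.sqrt C * (5 * (R / (5 * ((n : ℝ) + 1)))) * ‖gradL u‖)
      atTop (𝓝 0) := by
    have h1 : Tendsto (fun n : ℕ => 1 / ((n : ℝ) + 1)) atTop (𝓝 0) :=
      tendsto_one_div_add_atTop_nhds_zero_nat
    have h2 := h1.const_mul (Real.sqrt C * R * ‖gradL u‖)
    rw [mul_zero] at h2
    refine h2.congr fun n => ?_
    field_simp
  have hbd : ∀ n, ‖v n‖ ≤ (‖fnL u‖ + Real.sqrt C * (5 * (R / 5)) * ‖gradL u‖) +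
      (‖gradL u‖ + L * 5 * Real.sqrt C * ‖gradL u‖) := fun n => by
    refine (norm_WS_le _).trans (add_le_add ?_ (hgrad n))
    have h1 : ‖fnL (v n)‖ ≤ ‖fnL u‖ + ‖fnL (v n) - fnL u‖ := norm_le_norm_add_norm_sub' _ _
    refine h1.trans (add_le_add le_rfl ((hfn n).trans ?_))
    gcongr
    linarith [n.cast_nonneg (α := ℝ)]
  obtain ⟨w, hw⟩ := WeakLim.exists_of_bounded (hyperfilter ℕ) hbd
  have hw0 : w ∈ W0 Ω := hw.mem_closed isClosed_W0 hv0
  have hfnlim : Tendsto (fun n => fnL (v n)) (hyperfilter ℕ : Filter ℕ) (𝓝 (fnL u)) := by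
    rw [tendsto_iff_norm_sub_tendsto_zero]
    refine (squeeze_zero (fun n => norm_nonneg _) hfn hlim).mono_left ?_
    rw [← Nat.cofinite_eq_atTop]
    exact hyperfilter_le_cofinite
  have heq : fnL w = fnL u := (hw.map fnL).unique (WeakLim.of_tendsto hfnlim)
  rwa [← WS_ext ho hb heq]

end ZeroTrace

/-! ### Poincaré inequality and boundary value problems -/

section Solutions

variable {N : ℕ} {Ω : Set (E N)}

/-- The constant function `1` as an element of `W^{1,2}(Ω)`. -/
def oneW (hΩ : IsBoundedLipschitzDomain Ω) : WS Ω :=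
  smoothW hΩ.isOpen hΩ.isBounded (φ := fun _ => 1) contDiff_const

lemma fn_oneW (hΩ : IsBoundedLipschitzDomain Ω) :
    fnL (oneW hΩ) =ᵐ[volume.restrict Ω] fun _ => (1 : ℝ) := fn_smoothW _ _ _

lemma grad_oneW (hΩ : IsBoundedLipschitzDomain Ω) : gradL (oneW hΩ) = 0 := by
  refine Lp.ext ((grad_smoothW hΩ.isOpen hΩ.isBounded contDiff_const).trans ?_)
  filter_upwards [Lp.coeFn_zero (E N) 2 (volume.restrict Ω)] with x hx
  rw [hx, Pi.zero_apply, gradient]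
  simp

lemma tr_oneW (hN : 0 < N) (hΩ : IsBoundedLipschitzDomain Ω) :
    tr Ω (oneW hΩ) =ᵐ[surf Ω] fun _ => (1 : ℝ) := tr_ae_eq hN hΩ contDiff_const (fn_oneW hΩ)

lemma mem_L2Star_iff (hN : 0 < N) (hΩ : IsBoundedLipschitzDomain Ω) (g : L2Bd Ω) :
    g ∈ L2Star Ω ↔ inner ℝ g (tr Ω (oneW hΩ)) = 0 := by
  have := isFiniteMeasure_surf hN hΩ
  have h1 : inner ℝ g (tr Ω (oneW hΩ)) = ∫ x, g x ∂(surf Ω) := by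
    rw [MeasureTheory.L2.inner_def]
    refine integral_congr_ae ?_
    filter_upwards [tr_oneW hN hΩ] with x hx
    rw [hx]; simp
  rw [h1]
  exact ⟨fun h => h.2, fun h => ⟨(Lp.memLp g).integrable (by norm_num), h⟩⟩

lemma norm_tr_oneW_pos (hN : 0 < N) (hΩ : IsBoundedLipschitzDomain Ω) :
    0 < inner ℝ (tr Ω (oneW hΩ)) (tr Ω (oneW hΩ)) := by
  rw [real_inner_self_eq_norm_sq]
  refine pow_pos (norm_pos_iff.2 fun h0 => ?_) 2
  have h1 := tr_oneW hN hΩ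
  rw [h0] at h1
  have h2 : ∀ᵐ x ∂(surf Ω), False := by
    filter_upwards [h1, Lp.coeFn_zero ℝ 2 (surf Ω)] with x a b
    rw [b] at a
    simp at a
  rw [eventually_false_iff_eq_bot, ae_eq_bot] at h2
  exact surf_ne_zero hN hΩ h2

/-- The Sobolev functions whose trace has mean zero. -/
def WMean (hΩ : IsBoundedLipschitzDomain Ω) : Submodule ℝ (WS Ω) :=
  ((innerSL ℝ (tr Ω (oneW hΩ))).comp (tr Ω)).ker

lemma mem_WMean (hN : 0 < N) (hΩ : IsBoundedLipschitzDomain Ω) {u : WS Ω} :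
    u ∈ WMean hΩ ↔ tr Ω u ∈ L2Star Ω := by
  rw [mem_L2Star_iff hN hΩ, real_inner_comm]; rfl

lemma isClosed_WMean (hΩ : IsBoundedLipschitzDomain Ω) : IsClosed (WMean hΩ : Set (WS Ω)) :=
  ContinuousLinearMap.isClosed_ker _

lemma W0_le_WMean (hN : 0 < N) (hΩ : IsBoundedLipschitzDomain Ω) : W0 Ω ≤ WMean hΩ := fun u hu => by
  rw [mem_WMean hN hΩ, tr_eq_zero_of_mem_W0 hN hΩ hu]
  exact zero_mem _

/-- The Poincaré inequality for functions whose trace has mean zero. -/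
theorem exists_poincare (hN : 0 < N) (hΩ : IsBoundedLipschitzDomain Ω) :
    ∃ C : ℝ, 0 < C ∧ ∀ u ∈ WMean hΩ, ‖u‖ ≤ C * ‖gradL u‖ := by
  by_contra! h
  choose w hw hlt using fun n : ℕ => h (n + 1) (by positivity)
  have hpos : ∀ n, 0 < ‖w n‖ := fun n =>
    lt_of_le_of_lt (by positivity) (hlt n)
  obtain ⟨u, hu⟩ : ∃ u : ℕ → WS Ω, u = fun n => (‖w n‖⁻¹) • w n := ⟨_, rfl⟩
  have hu1 : ∀ n, ‖u n‖ = 1 := fun n => by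
    rw [hu, norm_smul, norm_inv, norm_norm, inv_mul_cancel₀ (hpos n).ne']
  have hum : ∀ n, u n ∈ WMean hΩ := fun n => hu ▸ Submodule.smul_mem _ _ (hw n)
  have hug : ∀ n : ℕ, ‖gradL (u n)‖ ≤ 1 / ((n : ℝ) + 1) := fun n => by
    rw [hu, map_smul, norm_smul, norm_inv, norm_norm, le_div_iff₀ (by positivity),
      inv_mul_eq_div, div_mul_eq_mul_div, div_le_one (hpos n), mul_comm]
    exact (hlt n).le
  have hgrad : Tendsto (fun n => gradL (u n)) atTop (𝓝 0) :=
    squeeze_zero_norm hug tendsto_one_div_add_atTop_nhds_zero_nat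
  have hU : (hyperfilter ℕ : Filter ℕ) ≤ atTop := by
    rw [← Nat.cofinite_eq_atTop]; exact hyperfilter_le_cofinite
  obtain ⟨a, ha⟩ := WeakLim.exists_of_bounded (hyperfilter ℕ) fun n => (hu1 n).le
  have ha0 : gradL a = 0 := (ha.map gradL).unique (WeakLim.of_tendsto (hgrad.mono_left hU))
  obtain ⟨c, hc⟩ := ae_const_of_grad_eq_zero hΩ ha0
  have hac : a = c • oneW hΩ := by
    refine WS_ext hΩ.isOpen hΩ.isBounded (Lp.ext (hc.trans ?_))
    rw [map_smul]
    filter_upwards [Lp.coeFn_smul c (fnL (oneW hΩ)), fn_oneW hΩ] with x h1 h2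
    rw [h1, Pi.smul_apply, h2, smul_eq_mul, mul_one]
  have ham : a ∈ WMean hΩ := ha.mem_closed (isClosed_WMean hΩ) hum
  rw [mem_WMean hN hΩ, mem_L2Star_iff hN hΩ, hac, map_smul, real_inner_smul_left] at ham
  have hc0 : c = 0 := (mul_eq_zero.1 ham).resolve_right (norm_tr_oneW_pos hN hΩ).ne'
  rw [hc0, zero_smul] at hac
  have hfn := rellich hΩ ha fun n => (hu1 n).le
  rw [hac, map_zero] at hfn
  have h1 : Tendsto (fun n => ‖fnL (u n)‖ ^ 2 + ‖gradL (u n)‖ ^ 2) (hyperfilter ℕ : Filter ℕ)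
      (𝓝 0) := by
    simpa using (hfn.norm.pow 2).add ((hgrad.mono_left hU).norm.pow 2)
  have h2 : (fun n => ‖fnL (u n)‖ ^ 2 + ‖gradL (u n)‖ ^ 2) = fun _ => (1 : ℝ) := by
    funext n
    rw [← norm_sq_WS, hu1, one_pow]
  rw [h2] at h1
  exact one_ne_zero (tendsto_nhds_unique tendsto_const_nhds h1)

/-- The operator of multiplication by a function in `L²(Ω, ℝ^N)`. -/
def mulF (Ω : Set (E N)) (ζ : E N → ℝ) : L2Vec Ω →L[ℝ] L2Vec Ω :=
  mulOp (volume.restrict Ω) (sField ζ)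

/-- `T` behaves as the multiplication by a bounded elliptic tensor field. -/
structure IsTensorOp (α β : ℝ) (T : L2Vec Ω →L[ℝ] L2Vec Ω) : Prop where
  pos : 0 < α
  coercive : ∀ G, α * ‖G‖ ^ 2 ≤ inner ℝ (T G) G
  norm_le : ∀ G, ‖T G‖ ≤ β * ‖G‖
  comm : ∀ ζ : E N → ℝ, ContDiff ℝ ∞ ζ → ∀ G, T (mulF Ω ζ G) = mulF Ω ζ (T G)

lemma mulF_coeFn (hΩ : IsBoundedLipschitzDomain Ω) {ζ : E N → ℝ} (hζ : ContDiff ℝ ∞ ζ)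
    (G : L2Vec Ω) : mulF Ω ζ G =ᵐ[volume.restrict Ω] fun x => ζ x • G x :=
  sField_coeFn hΩ.isOpen hΩ.isBounded hζ.continuous G

lemma MemTilde.isTensorOp (hΩ : IsBoundedLipschitzDomain Ω) {α β : ℝ}
    {A : E N → Matrix (Fin N) (Fin N) ℝ} (hA : MemTilde Ω α β A) (hα : 0 < α) (hαβ : α ≤ β) :
    IsTensorOp α β (tens Ω A) where
  pos := hα
  coercive := hA.tens_coercive hα hαβ
  norm_le := hA.norm_tens_le hα hαβ
  comm ζ hζ G := by
    refine Lp.ext ?_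
    filter_upwards [mulF_coeFn hΩ hζ G, mulF_coeFn hΩ hζ (tens Ω A G),
      hA.tens_coeFn hα hαβ G, hA.tens_coeFn hα hαβ (mulF Ω ζ G)] with x h1 h2 h3 h4
    rw [h4, h1, h2, h3, ← actC_apply, ← actC_apply, map_smul]

variable {α β : ℝ} {T : L2Vec Ω →L[ℝ] L2Vec Ω}

/-- The Lax–Milgram theorem on a closed subspace on which the gradient controls the norm: the
solution depends linearly and continuously on the functional. -/
lemma exists_solution (hT : IsTensorOp α β T) {V : Submodule ℝ (WS Ω)}
    (hV : IsClosed (V : Set (WS Ω))) {C : ℝ} (hC : 0 < C) (hP : ∀ u ∈ V, ‖u‖ ≤ C * ‖gradL u‖) :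
    ∃ S : StrongDual ℝ (WS Ω) →L[ℝ] WS Ω, ∀ F, S F ∈ V ∧
      ∀ ψ ∈ V, inner ℝ (T (gradL (S F))) (gradL ψ) = F ψ := by
  have : CompleteSpace V := hV.completeSpace_coe
  obtain ⟨G, hG⟩ : ∃ G : V →L[ℝ] L2Vec Ω, G = gradL.comp V.subtypeL := ⟨_, rfl⟩
  obtain ⟨B, hB⟩ : ∃ B : V →L[ℝ] V →L[ℝ] ℝ, ∀ u v, B u v = inner ℝ (T (G u)) (G v) :=
    ⟨(innerSL ℝ).bilinearComp (T.comp G) G, fun u v => rfl⟩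
  have hcoer : IsCoercive B := by
    have hα := hT.pos
    refine ⟨α / C ^ 2, by positivity, fun u => ?_⟩
    rw [hB]
    refine le_trans ?_ (hT.coercive (G u))
    have h1 : ‖u‖ ≤ C * ‖G u‖ := by rw [hG]; exact hP u u.2
    have h2 : ‖u‖ * ‖u‖ ≤ (C * ‖G u‖) * (C * ‖G u‖) := by gcongr
    calc α / C ^ 2 * ‖u‖ * ‖u‖ = α / C ^ 2 * (‖u‖ * ‖u‖) := by ring
      _ ≤ α / C ^ 2 * ((C * ‖G u‖) * (C * ‖G u‖)) := by gcongr
      _ = α * ‖G u‖ ^ 2 := by field_simp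
  obtain ⟨R, hR⟩ : ∃ R : StrongDual ℝ (WS Ω) →L[ℝ] V,
      ∀ F, ∀ v : V, inner ℝ (R F) v = F v := by
    refine ⟨((InnerProductSpace.toDual ℝ V).symm.toContinuousLinearEquiv.toContinuousLinearMap).comp
      (ContinuousLinearMap.precomp ℝ V.subtypeL), fun F v => ?_⟩
    exact InnerProductSpace.toDual_symm_apply
  refine ⟨V.subtypeL.comp (hcoer.continuousLinearEquivOfBilin.symm.toContinuousLinearMap.comp R),
    fun F => ⟨Subtype.coe_prop _, fun ψ hψ => ?_⟩⟩
  have h1 := hcoer.continuousLinearEquivOfBilin_apply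
    (hcoer.continuousLinearEquivOfBilin.symm (R F)) ⟨ψ, hψ⟩
  rw [ContinuousLinearEquiv.apply_symm_apply, hR, hB, hG] at h1
  exact h1.symm

lemma solution_unique (hT : IsTensorOp α β T) {V : Submodule ℝ (WS Ω)} {C : ℝ}
    (hP : ∀ u ∈ V, ‖u‖ ≤ C * ‖gradL u‖) {u v : WS Ω} (huv : u - v ∈ V)
    (h : ∀ ψ ∈ V, inner ℝ (T (gradL u)) (gradL ψ) = inner ℝ (T (gradL v)) (gradL ψ)) :
    u = v := by
  have h1 : inner ℝ (T (gradL (u - v))) (gradL (u - v)) = 0 := by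
    have := h _ huv
    rw [map_sub gradL u v, map_sub T, inner_sub_left, ← map_sub gradL, this, sub_self]
  have h2 := hT.coercive (gradL (u - v))
  rw [h1] at h2
  have h3 : ‖gradL (u - v)‖ = 0 := by
    have hα := hT.pos
    have := norm_nonneg (gradL (u - v))
    by_contra hne
    have : 0 < ‖gradL (u - v)‖ := lt_of_le_of_ne this (Ne.symm hne)
    have : 0 < α * ‖gradL (u - v)‖ ^ 2 := by positivity
    linarith
  have h4 := hP _ huv
  rw [h3, mul_zero] at h4
  exact sub_eq_zero.1 (norm_le_zero_iff.1 h4)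

/-- `v` solves the Neumann problem with datum `g` for the tensor `T`. -/
structure IsNeu (hΩ : IsBoundedLipschitzDomain Ω) (T : L2Vec Ω →L[ℝ] L2Vec Ω) (g : L2Bd Ω)
    (v : WS Ω) : Prop where
  mean : v ∈ WMean hΩ
  weak : ∀ ψ, inner ℝ (T (gradL v)) (gradL ψ) = inner ℝ g (tr Ω ψ)

/-- `u` has the boundary values of `φ` and `div(T∇u) = 0`. -/
structure IsDir (T : L2Vec Ω →L[ℝ] L2Vec Ω) (φ u : WS Ω) : Prop where
  boundary : u - φ ∈ W0 Ω
  weak : ∀ ψ ∈ W0 Ω, inner ℝ (T (gradL u)) (gradL ψ) = 0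

lemma exists_neu (hN : 0 < N) (hΩ : IsBoundedLipschitzDomain Ω) (hT : IsTensorOp α β T) :
    ∃ S : L2Bd Ω →L[ℝ] WS Ω, ∀ g ∈ L2Star Ω, IsNeu hΩ T g (S g) := by
  obtain ⟨C, hC, hP⟩ := exists_poincare hN hΩ
  obtain ⟨S, hS⟩ := exists_solution hT (isClosed_WMean hΩ) hC hP
  obtain ⟨l, hl⟩ : ∃ l : L2Bd Ω →L[ℝ] StrongDual ℝ (WS Ω), ∀ g ψ, l g ψ = inner ℝ g (tr Ω ψ) :=
    ⟨(innerSL ℝ).bilinearComp (ContinuousLinearMap.id ℝ _) (tr Ω), fun _ _ => rfl⟩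
  refine ⟨S.comp l, fun g hg => ⟨(hS (l g)).1, fun ψ => ?_⟩⟩
  -- subtracting a constant makes the trace of the test function of mean zero
  obtain ⟨k, hk⟩ : ∃ k, k = inner ℝ (tr Ω ψ) (tr Ω (oneW hΩ)) /
    inner ℝ (tr Ω (oneW hΩ)) (tr Ω (oneW hΩ)) := ⟨_, rfl⟩
  have hpos := norm_tr_oneW_pos hN hΩ
  have hm : ψ - k • oneW hΩ ∈ WMean hΩ := by
    rw [mem_WMean hN hΩ, mem_L2Star_iff hN hΩ, map_sub, map_smul, inner_sub_left,
      real_inner_smul_left, hk, div_mul_cancel₀ _ hpos.ne', sub_self]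
  have h1 := (hS (l g)).2 _ hm
  rw [hl, map_sub gradL, map_smul gradL, grad_oneW, smul_zero, sub_zero, map_sub (tr Ω),
    map_smul (tr Ω), inner_sub_right, real_inner_smul_right,
    (mem_L2Star_iff hN hΩ g).1 hg, mul_zero, sub_zero] at h1
  exact h1

lemma IsNeu.unique (hN : 0 < N) {hΩ : IsBoundedLipschitzDomain Ω} (hT : IsTensorOp α β T)
    {g : L2Bd Ω} {v v' : WS Ω} (h : IsNeu hΩ T g v) (h' : IsNeu hΩ T g v') : v = v' := by
  obtain ⟨C, hC, hP⟩ := exists_poincare hN hΩ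
  exact solution_unique hT hP (Submodule.sub_mem _ h.mean h'.mean) fun ψ _ => by
    rw [h.weak, h'.weak]

lemma exists_dirSource (hN : 0 < N) (hΩ : IsBoundedLipschitzDomain Ω) (hT : IsTensorOp α β T) :
    ∃ S : StrongDual ℝ (WS Ω) →L[ℝ] WS Ω, ∀ F, S F ∈ W0 Ω ∧
      ∀ ψ ∈ W0 Ω, inner ℝ (T (gradL (S F))) (gradL ψ) = F ψ := by
  obtain ⟨C, hC, hP⟩ := exists_poincare hN hΩ
  exact exists_solution hT isClosed_W0 hC fun u hu => hP u (W0_le_WMean hN hΩ hu)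

lemma exists_dir (hN : 0 < N) (hΩ : IsBoundedLipschitzDomain Ω) (hT : IsTensorOp α β T) :
    ∃ S : WS Ω →L[ℝ] WS Ω, ∀ φ, IsDir T φ (S φ) := by
  obtain ⟨S, hS⟩ := exists_dirSource hN hΩ hT
  obtain ⟨l, hl⟩ : ∃ l : WS Ω →L[ℝ] StrongDual ℝ (WS Ω),
      ∀ φ ψ, l φ ψ = inner ℝ (T (gradL φ)) (gradL ψ) :=
    ⟨(innerSL ℝ).bilinearComp (T.comp gradL) gradL, fun _ _ => rfl⟩
  refine ⟨ContinuousLinearMap.id ℝ _ - S.comp l, fun φ => ⟨?_, fun ψ hψ => ?_⟩⟩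
  · have : (ContinuousLinearMap.id ℝ (WS Ω) - S.comp l) φ - φ = -(S (l φ)) := by
      simp
    rw [this]
    exact neg_mem (hS _).1
  · have : (ContinuousLinearMap.id ℝ (WS Ω) - S.comp l) φ = φ - S (l φ) := rfl
    rw [this, map_sub gradL, map_sub T, inner_sub_left, (hS _).2 ψ hψ, hl, sub_self]

lemma IsDir.unique (hN : 0 < N) (hΩ : IsBoundedLipschitzDomain Ω) (hT : IsTensorOp α β T)
    {φ φ' u u' : WS Ω} (h : IsDir T φ u) (h' : IsDir T φ' u') (hφ : φ - φ' ∈ W0 Ω) : u = u' := by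
  obtain ⟨C, hC, hP⟩ := exists_poincare hN hΩ
  refine solution_unique hT (fun u hu => hP u (W0_le_WMean hN hΩ hu)) ?_ fun ψ hψ => by
    rw [h.weak ψ hψ, h'.weak ψ hψ]
  have : u - u' = (u - φ) - (u' - φ') + (φ - φ') := by abel
  rw [this]
  exact add_mem (sub_mem h.boundary h'.boundary) hφ

end Solutions

/-! ### Compensated compactness and `H`-convergence -/

section Compensated

variable {N : ℕ} {Ω : Set (E N)} {ι : Type*}

lemma inner_mulF (hΩ : IsBoundedLipschitzDomain Ω) {ζ : E N → ℝ} (hζ : ContDiff ℝ ∞ ζ)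
    (G H : L2Vec Ω) : inner ℝ (mulF Ω ζ G) H = inner ℝ G (mulF Ω ζ H) := by
  rw [MeasureTheory.L2.inner_def, MeasureTheory.L2.inner_def]
  refine integral_congr_ae ?_
  filter_upwards [mulF_coeFn hΩ hζ G, mulF_coeFn hΩ hζ H] with x h1 h2
  rw [h1, h2, real_inner_smul_left, real_inner_smul_right]

lemma mulF_mulF (hΩ : IsBoundedLipschitzDomain Ω) {ζ ξ : E N → ℝ} (hζ : ContDiff ℝ ∞ ζ)
    (hξ : ContDiff ℝ ∞ ξ) (G : L2Vec Ω) :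
    mulF Ω ζ (mulF Ω ξ G) = mulF Ω (fun x => ζ x * ξ x) G := by
  refine Lp.ext ?_
  filter_upwards [mulF_coeFn hΩ hζ (mulF Ω ξ G), mulF_coeFn hΩ hξ G,
    mulF_coeFn hΩ (hζ.mul hξ) G] with x h1 h2 h3
  rw [h1, h2, h3, smul_smul]

/-- The div-curl lemma: the divergences of `σ i` are fixed, the fields `∇w i` are gradients. -/
lemma div_curl (hΩ : IsBoundedLipschitzDomain Ω) {U : Filter ι} [U.NeBot] {σ : ι → L2Vec Ω}
    {σ' : L2Vec Ω} (hσ : WeakLim U σ σ') {M : ℝ} (hσM : ∀ i, ‖σ i‖ ≤ M) {w : ι → WS Ω} {w' : WS Ω}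
    (hw : WeakLim U w w') {M' : ℝ} (hwM : ∀ i, ‖w i‖ ≤ M') {F : StrongDual ℝ (WS Ω)}
    (hF : ∀ i, ∀ ψ ∈ W0 Ω, inner ℝ (σ i) (gradL ψ) = F ψ) {ζ : E N → ℝ} (hζ : IsTest Ω ζ) :
    Tendsto (fun i => inner ℝ (σ i) (mulF Ω ζ (gradL (w i)))) U
      (𝓝 (inner ℝ σ' (mulF Ω ζ (gradL w')))) := by
  have hF' : ∀ ψ ∈ W0 Ω, inner ℝ σ' (gradL ψ) = F ψ := fun ψ hψ => by
    have h1 := hσ (gradL ψ)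
    simp only [hF _ ψ hψ] at h1
    exact tendsto_nhds_unique h1 tendsto_const_nhds
  obtain ⟨m, hm⟩ : ∃ m, m = mulW hΩ.isOpen hΩ.isBounded hζ.smooth := ⟨_, rfl⟩
  obtain ⟨q, hq⟩ : ∃ q : L2 Ω →L[ℝ] L2Vec Ω, q = mulOp (volume.restrict Ω) (gField ζ) := ⟨_, rfl⟩
  have hdec : ∀ u : WS Ω, mulF Ω ζ (gradL u) = gradL (m u) - q (fnL u) := fun u => by
    rw [hm, hq, grad_mulW, mulF, add_sub_cancel_right]
  have hmW : ∀ u : WS Ω, m u ∈ W0 Ω := fun u => hm ▸ mulW_mem_W0 hΩ hζ u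
  have key : ∀ i, inner ℝ (σ i) (mulF Ω ζ (gradL (w i))) =
      F (m (w i)) - inner ℝ (σ i) (q (fnL (w i))) := fun i => by
    rw [hdec, inner_sub_right, hF i _ (hmW _)]
  rw [hdec, inner_sub_right, hF' _ (hmW _)]
  simp only [key]
  have h1 : Tendsto (fun i => F (m (w i))) U (𝓝 (F (m w'))) := hw.clm (F.comp m)
  refine h1.sub (hσ.inner_tendsto hσM ?_)
  exact (q.continuous.tendsto _).comp (rellich hΩ hw hwM)

/-- A cut-off function that is `1` near the support of a test function. -/
lemma exists_test_eq_one (hN : 0 < N) (hΩ : IsBoundedLipschitzDomain Ω) {ζ : E N → ℝ}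
    (hζ : IsTest Ω ζ) : ∃ χ : E N → ℝ, IsTest Ω χ ∧
      ∀ x, ζ x ≠ 0 → χ x = 1 ∧ gradient χ x = 0 := by
  have hne := compl_nonempty hN hΩ.isBounded
  obtain ⟨L, hL, hcut⟩ := exists_cutoff N
  obtain ⟨δ, hδ, hth⟩ := hζ.compact.exists_thickening_subset_open hΩ.isOpen hζ.subset
  obtain ⟨χ, hχ, -, h1, -⟩ := hcut Ω hΩ.isOpen hΩ.isBounded hne (δ / 5) (by positivity)
  refine ⟨χ, hχ, fun x hx => h1 x fun hxs => ?_⟩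
  have hlt : Metric.infDist x Ωᶜ < 5 * (δ / 5) := hxs
  rw [mul_div_cancel₀ _ (by norm_num : (5 : ℝ) ≠ 0)] at hlt
  obtain ⟨z, hz, hzd⟩ := (Metric.infDist_lt_iff hne).1 hlt
  exact hz (hth (Metric.mem_thickening_iff.2 ⟨x, subset_tsupport _ hx, by rwa [dist_comm]⟩))

/-- A function in `W^{1,2}_0(Ω)` that is linear near the support of a test function. -/
lemma exists_W0_linear (hN : 0 < N) (hΩ : IsBoundedLipschitzDomain Ω) {ζ : E N → ℝ}
    (hζ : IsTest Ω ζ) (η : E N) :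
    ∃ ψ ∈ W0 Ω, ∀ᵐ x ∂volume.restrict Ω, ζ x ≠ 0 → gradL ψ x = η := by
  obtain ⟨χ, hχ, h1⟩ := exists_test_eq_one hN hΩ hζ
  have hl : ContDiff ℝ ∞ fun x : E N => (inner ℝ η x : ℝ) := contDiff_const.inner ℝ contDiff_id
  have ht : IsTest Ω (fun x => χ x * inner ℝ η x) := by
    have := IsTest.mul hl hχ
    simpa only [mul_comm] using this
  refine ⟨_, test_mem_W0 hΩ.isOpen hΩ.isBounded ht, ?_⟩
  filter_upwards [grad_smoothW hΩ.isOpen hΩ.isBounded ht.smooth] with x hx hζx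
  obtain ⟨hc, hg⟩ := h1 x hζx
  rw [hx]
  have hχd : HasGradientAt χ 0 x :=
    hg ▸ (hχ.smooth.differentiable (by simp) x).hasGradientAt
  refine HasGradientAt.gradient ?_
  rw [hasGradientAt_iff_hasFDerivAt] at hχd ⊢
  have hld : HasFDerivAt (fun x : E N => (inner ℝ η x : ℝ)) (innerSL ℝ η) x :=
    (innerSL ℝ η).hasFDerivAt
  have := hχd.mul hld
  refine this.congr_fderiv ?_
  ext v
  simp [hc]

/-- `H`-convergence along a filter, for operators on `L²(Ω, ℝ^N)` in place of tensor fields. -/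
def HLim (Ω : Set (E N)) (U : Filter ι) (T : ι → L2Vec Ω →L[ℝ] L2Vec Ω)
    (T' : L2Vec Ω →L[ℝ] L2Vec Ω) : Prop :=
  ∀ (F : StrongDual ℝ (WS Ω)) (u : ι → WS Ω) (u' : WS Ω),
    (∀ i, u i ∈ W0 Ω) → (∀ i, ∀ ψ ∈ W0 Ω, inner ℝ (T i (gradL (u i))) (gradL ψ) = F ψ) →
    u' ∈ W0 Ω → (∀ ψ ∈ W0 Ω, inner ℝ (T' (gradL u')) (gradL ψ) = F ψ) →
      WeakLim U u u' ∧ WeakLim U (fun i => T i (gradL (u i))) (T' (gradL u'))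

lemma HLim.mono {U V : Filter ι} {T : ι → L2Vec Ω →L[ℝ] L2Vec Ω} {T' : L2Vec Ω →L[ℝ] L2Vec Ω}
    (h : HLim Ω U T T') (hVU : V ≤ U) : HLim Ω V T T' := fun F u u' h1 h2 h3 h4 =>
  ⟨(h F u u' h1 h2 h3 h4).1.mono hVU, (h F u u' h1 h2 h3 h4).2.mono hVU⟩

variable {α β : ℝ} {T : ι → L2Vec Ω →L[ℝ] L2Vec Ω} {T' : L2Vec Ω →L[ℝ] L2Vec Ω} {U : Filter ι}

/-- The oscillating test functions of an element `z` of `W^{1,2}_0(Ω)`: the solutions `u i` of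
`div(T i ∇u i) = div(T' ∇z)` converge weakly to `z`, and so do their fluxes to `T' ∇z`. -/
lemma HLim.exists_recovery (hN : 0 < N) (hΩ : IsBoundedLipschitzDomain Ω)
    (hT : ∀ i, IsTensorOp α β (T i)) (hH : HLim Ω U T T') {z : WS Ω} (hz : z ∈ W0 Ω) :
    ∃ u : ι → WS Ω, (∀ i, u i ∈ W0 Ω) ∧ (∃ M, ∀ i, ‖u i‖ ≤ M) ∧
      (∀ i, ∀ ψ ∈ W0 Ω, inner ℝ (T i (gradL (u i))) (gradL ψ) = inner ℝ (T' (gradL z)) (gradL ψ)) ∧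
      WeakLim U u z ∧ WeakLim U (fun i => T i (gradL (u i))) (T' (gradL z)) := by
  obtain ⟨F, hF⟩ : ∃ F : StrongDual ℝ (WS Ω), ∀ ψ, F ψ = inner ℝ (T' (gradL z)) (gradL ψ) :=
    ⟨(innerSL ℝ (T' (gradL z))).comp gradL, fun _ => rfl⟩
  choose S hS using fun i => exists_dirSource hN hΩ (hT i)
  obtain ⟨C, hC, hP⟩ := exists_poincare hN hΩ
  refine ⟨fun i => S i F, fun i => (hS i F).1, ⟨C * (‖F‖ * C / α), fun i => ?_⟩,
    fun i ψ hψ => by rw [(hS i F).2 ψ hψ, hF],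
    hH F _ z (fun i => (hS i F).1) (fun i => (hS i F).2) hz fun ψ _ => (hF ψ).symm⟩
  have hα := (hT i).pos
  have h1 := hP _ (W0_le_WMean hN hΩ (hS i F).1)
  refine h1.trans (mul_le_mul_of_nonneg_left ?_ hC.le)
  have h2 := (hT i).coercive (gradL (S i F))
  rw [(hS i F).2 _ (hS i F).1] at h2
  have h3 : F (S i F) ≤ ‖F‖ * (C * ‖gradL (S i F)‖) :=
    (le_abs_self _).trans ((F.le_opNorm _).trans (by gcongr))
  rw [le_div_iff₀ hα]
  rcases (norm_nonneg (gradL (S i F))).eq_or_lt with h0 | h0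
  · rw [← h0, zero_mul]; positivity
  · refine le_of_mul_le_mul_right ?_ h0
    nlinarith

/-- The linear algebra of Minty's argument: a monotonicity inequality along a line, localized by
the self-adjoint operator `m`, determines the flux `σ`. -/
lemma eq_zero_of_monotone {H : Type*} [NormedAddCommGroup H] [InnerProductSpace ℝ H]
    {m T : H →L[ℝ] H} (hm : ∀ p q, inner ℝ (m p) q = inner ℝ p (m q))
    (hmT : ∀ p, T (m p) = m (T p)) {σ p q s : H} (hpq : m q = m p)
    (h : ∀ t : ℝ, 0 ≤ inner ℝ (σ - T (q - t • s)) (m (p - (q - t • s)))) :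
    inner ℝ (m (σ - T p)) s = 0 := by
  obtain ⟨a, ha⟩ : ∃ a, a = inner ℝ (m (σ - T p)) s := ⟨_, rfl⟩
  obtain ⟨b, hb⟩ : ∃ b, b = inner ℝ (m (T s)) s := ⟨_, rfl⟩
  have hq : ∀ t : ℝ, 0 ≤ t * a + t ^ 2 * b := fun t => by
    have h1 := h t
    have h2 : m (σ - T (q - t • s)) = m (σ - T p) + t • m (T s) := by
      rw [map_sub T, map_smul, map_sub, map_sub, map_sub, map_smul, ← hmT q, hpq, hmT]
      abel
    have h3 : m (p - (q - t • s)) = m (t • s) := by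
      rw [map_sub, map_sub, hpq]
      abel
    rw [h3, ← hm, h2, inner_add_left, real_inner_smul_right, real_inner_smul_right,
      real_inner_smul_left, ← ha, ← hb] at h1
    linarith
  -- a quadratic polynomial without constant term changes sign unless its linear term vanishes
  rw [← ha]
  by_contra hne
  have hbb : 0 < |b| + 1 := by positivity
  have h1 := hq (-(a / (|b| + 1)))
  have h2 : -(a / (|b| + 1)) * a + (-(a / (|b| + 1))) ^ 2 * b =
      -(a ^ 2 / (|b| + 1)) * (1 - b / (|b| + 1)) := by field_simp; ring
  rw [h2] at h1
  have h3 : 0 < a ^ 2 / (|b| + 1) := by positivity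
  have h4 : b / (|b| + 1) < 1 := (div_lt_one hbb).2 (by linarith [le_abs_self b])
  nlinarith

/-- A vector field that is orthogonal to all gradients, after localization by squares, is zero: the
gradients of the functions that are linear near a given compact set are locally all constants. -/
lemma eq_of_forall_mulF (hN : 0 < N) (hΩ : IsBoundedLipschitzDomain Ω) {G : L2Vec Ω}
    (h : ∀ ζ : E N → ℝ, IsTest Ω ζ → ∀ ψ ∈ W0 Ω,
      inner ℝ (mulF Ω (fun x => ζ x * ζ x) G) (gradL ψ) = 0) : G = 0 := by
  -- polarization: with `χ = 1` near the support of `ζ`, `4 ζ = (χ + ζ)² - (χ - ζ)²` there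
  have hpol : ∀ ζ : E N → ℝ, IsTest Ω ζ → ∀ ψ ∈ W0 Ω,
      inner ℝ (mulF Ω ζ G) (gradL ψ) = 0 := fun ζ hζ ψ hψ => by
    obtain ⟨χ, hχ, h1⟩ := exists_test_eq_one hN hΩ hζ
    have hp : IsTest Ω fun x => χ x + ζ x :=
      ⟨hχ.smooth.add hζ.smooth, hχ.compact.add hζ.compact,
        (tsupport_add χ ζ).trans (Set.union_subset hχ.subset hζ.subset)⟩
    have hm : IsTest Ω fun x => χ x - ζ x :=
      ⟨hχ.smooth.sub hζ.smooth, hχ.compact.sub hζ.compact,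
        (tsupport_sub χ ζ).trans (Set.union_subset hχ.subset hζ.subset)⟩
    have heq : mulF Ω ζ G = (4⁻¹ : ℝ) • (mulF Ω (fun x => (χ x + ζ x) * (χ x + ζ x)) G -
        mulF Ω (fun x => (χ x - ζ x) * (χ x - ζ x)) G) := by
      obtain ⟨P, hP⟩ : ∃ P, P = mulF Ω (fun x => (χ x + ζ x) * (χ x + ζ x)) G := ⟨_, rfl⟩
      obtain ⟨Q, hQ⟩ : ∃ Q, Q = mulF Ω (fun x => (χ x - ζ x) * (χ x - ζ x)) G := ⟨_, rfl⟩
      have a1 := mulF_coeFn hΩ (hp.smooth.mul hp.smooth) G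
      have a2 := mulF_coeFn hΩ (hm.smooth.mul hm.smooth) G
      rw [← hP] at a1 ⊢
      rw [← hQ] at a2 ⊢
      refine Lp.ext ?_
      filter_upwards [a1, a2, mulF_coeFn hΩ hζ.smooth G, Lp.coeFn_sub P Q,
        Lp.coeFn_smul (4⁻¹ : ℝ) (P - Q)] with x b1 b2 b3 b4 b5
      rw [b5, Pi.smul_apply, b4, Pi.sub_apply, b1, b2, b3, ← sub_smul, smul_smul]
      congr 1
      by_cases hx : ζ x = 0
      · rw [hx]; ring
      · rw [(h1 x hx).1]; ring
    rw [heq, real_inner_smul_left, inner_sub_left, h _ hp ψ hψ, h _ hm ψ hψ]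
    simp
  refine Lp.ext ((vec_ae_eq_zero_of_test hΩ.isOpen (integrable_L2 hΩ.isBounded G)
    fun ζ hζ η => ?_).trans
    (Lp.coeFn_zero _ _ _).symm)
  obtain ⟨ψ, hψ, hη⟩ := exists_W0_linear hN hΩ hζ η
  rw [← hpol ζ hζ ψ hψ, MeasureTheory.L2.inner_def]
  refine integral_congr_ae ?_
  filter_upwards [hη, mulF_coeFn hΩ hζ.smooth G] with x h1 h2
  rw [h2, real_inner_smul_left]
  by_cases hx : ζ x = 0
  · rw [hx]; ring
  · rw [h1 hx]; ring

/-- Convergence of fluxes, by Minty's monotonicity argument: if `w i ⇀ w'` and `div(T i ∇w i) = 0`,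
then `T i ∇w i ⇀ T' ∇w'`, whatever the boundary values. -/
theorem HLim.flux_tendsto (hN : 0 < N) (hΩ : IsBoundedLipschitzDomain Ω) {U : Ultrafilter ι}
    (hT : ∀ i, IsTensorOp α β (T i)) (hT' : IsTensorOp α β T') (hH : HLim Ω U T T')
    {w : ι → WS Ω} {w' : WS Ω} (hw : WeakLim (U : Filter ι) w w') {M : ℝ} (hM : ∀ i, ‖w i‖ ≤ M)
    (h0 : ∀ i, ∀ ψ ∈ W0 Ω, inner ℝ (T i (gradL (w i))) (gradL ψ) = 0) :
    WeakLim (U : Filter ι) (fun i => T i (gradL (w i))) (T' (gradL w')) := by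
  have hbd : ∀ {u : ι → WS Ω} {M : ℝ}, (∀ i, ‖u i‖ ≤ M) → ∀ i, ‖T i (gradL (u i))‖ ≤ |β| * M :=
    fun {u M} hu i => ((hT i).norm_le _).trans
      (mul_le_mul (le_abs_self β) ((norm_gradL_le _).trans (hu i)) (norm_nonneg _) (abs_nonneg β))
  obtain ⟨σ, hσ⟩ := WeakLim.exists_of_bounded U (hbd hM)
  -- the monotonicity inequality in the limit
  have hmon : ∀ z ∈ W0 Ω, ∀ ζ : E N → ℝ, IsTest Ω ζ →
      0 ≤ inner ℝ (σ - T' (gradL z)) (mulF Ω (fun x => ζ x * ζ x) (gradL (w' - z))) := by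
    intro z hz ζ hζ
    obtain ⟨u, hu0, ⟨M', hu⟩, hus, huz, huf⟩ := hH.exists_recovery hN hΩ hT hz
    obtain ⟨F, hF⟩ : ∃ F : StrongDual ℝ (WS Ω), ∀ ψ, F ψ = -inner ℝ (T' (gradL z)) (gradL ψ) :=
      ⟨-(innerSL ℝ (T' (gradL z))).comp gradL, fun _ => rfl⟩
    have hζ2 : IsTest Ω fun x => ζ x * ζ x := IsTest.mul hζ.smooth hζ
    have hlim := div_curl hΩ (hσ.sub huf) (M := |β| * M + |β| * M')
      (fun i => (norm_sub_le _ _).trans (add_le_add (hbd hM i) (hbd hu i))) (hw.sub huz)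
      (M' := M + M') (fun i => (norm_sub_le _ _).trans (add_le_add (hM i) (hu i))) (F := F)
      (fun i ψ hψ => by rw [inner_sub_left, h0 i ψ hψ, hus i ψ hψ, hF, zero_sub]) hζ2
    refine ge_of_tendsto hlim (Eventually.of_forall fun i => ?_)
    have h1 := (hT i).coercive (mulF Ω ζ (gradL (w i - u i)))
    rw [(hT i).comm ζ hζ.smooth, inner_mulF hΩ hζ.smooth, mulF_mulF hΩ hζ.smooth hζ.smooth,
      map_sub gradL, map_sub (T i)] at h1
    rw [map_sub gradL]
    have hα := (hT i).pos
    exact le_trans (by positivity) h1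
  have hkey : σ - T' (gradL w') = 0 := by
    refine eq_of_forall_mulF hN hΩ fun ζ hζ ψ hψ => ?_
    obtain ⟨χ, hχ, hχ1⟩ := exists_test_eq_one hN hΩ hζ
    have hζ2 : ContDiff ℝ ∞ fun x => ζ x * ζ x := hζ.smooth.mul hζ.smooth
    obtain ⟨y, hy⟩ : ∃ y, y = mulW hΩ.isOpen hΩ.isBounded hχ.smooth w' := ⟨_, rfl⟩
    have hy0 : y ∈ W0 Ω := hy ▸ mulW_mem_W0 hΩ hχ w'
    -- `y` agrees with `w'` near the support of `ζ`
    have hyw : mulF Ω (fun x => ζ x * ζ x) (gradL y) =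
        mulF Ω (fun x => ζ x * ζ x) (gradL w') := by
      refine Lp.ext ?_
      filter_upwards [mulF_coeFn hΩ hζ2 (gradL y), mulF_coeFn hΩ hζ2 (gradL w'),
        grad_mulW_ae hΩ.isOpen hΩ.isBounded hχ.smooth w'] with x b1 b2 b3
      rw [b1, b2, hy, b3]
      by_cases hx : ζ x = 0
      · rw [hx]; simp
      · rw [(hχ1 x hx).1, (hχ1 x hx).2]; simp
    refine eq_zero_of_monotone (T := T') (m := mulF Ω fun x => ζ x * ζ x)
      (inner_mulF hΩ hζ2) (hT'.comm _ hζ2) hyw fun t => ?_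
    have h1 := hmon (y - t • ψ) (sub_mem hy0 (Submodule.smul_mem _ _ hψ)) ζ hζ
    rwa [map_sub gradL w', map_sub gradL y, map_smul gradL] at h1
  rw [sub_eq_zero] at hkey
  rwa [hkey] at hσ

/-- The limit of symmetric tensors is symmetric in the localized sense: the products of the fluxes of
one family of oscillating test functions with the gradients of another pass to the limit. -/
lemma HLim.symm_limit (hN : 0 < N) (hΩ : IsBoundedLipschitzDomain Ω) [U.NeBot]
    (hT : ∀ i, IsTensorOp α β (T i)) (hH : HLim Ω U T T')
    (hs : ∀ i G H, inner ℝ (T i G) H = inner ℝ G (T i H)) {ζ : E N → ℝ} (hζ : IsTest Ω ζ)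
    {y z : WS Ω} (hy : y ∈ W0 Ω) (hz : z ∈ W0 Ω) :
    inner ℝ (T' (gradL z)) (mulF Ω ζ (gradL y)) = inner ℝ (T' (gradL y)) (mulF Ω ζ (gradL z)) := by
  obtain ⟨u, hu0, ⟨M, hu⟩, hus, huz, huf⟩ := hH.exists_recovery hN hΩ hT hz
  obtain ⟨v, hv0, ⟨M', hv⟩, hvs, hvz, hvf⟩ := hH.exists_recovery hN hΩ hT hy
  have hbd : ∀ {u : ι → WS Ω} {M : ℝ}, (∀ i, ‖u i‖ ≤ M) → ∀ i, ‖T i (gradL (u i))‖ ≤ |β| * M :=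
    fun {u M} hu i => ((hT i).norm_le _).trans
      (mul_le_mul (le_abs_self β) ((norm_gradL_le _).trans (hu i)) (norm_nonneg _) (abs_nonneg β))
  have h1 := div_curl hΩ huf (hbd hu) hvz hv (F := (innerSL ℝ (T' (gradL z))).comp gradL)
    (fun i ψ hψ => hus i ψ hψ) hζ
  have h2 := div_curl hΩ hvf (hbd hv) huz hu (F := (innerSL ℝ (T' (gradL y))).comp gradL)
    (fun i ψ hψ => hvs i ψ hψ) hζ
  refine tendsto_nhds_unique h1 (h2.congr fun i => ?_)
  rw [hs, (hT i).comm ζ hζ.smooth, ← inner_mulF hΩ hζ.smooth, real_inner_comm]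

end Compensated

/-! ### Limits of solutions with varying data -/

section Limits

variable {N : ℕ} {Ω : Set (E N)} {ι : Type*} {α β : ℝ}

lemma exists_le_norm_apply_add {X Y : Type*} [NormedAddCommGroup X] [NormedSpace ℝ X]
    [NormedAddCommGroup Y] [NormedSpace ℝ Y] (K : X →L[ℝ] Y) {ε : ℝ} (hε : 0 < ε) :
    ∃ x, ‖x‖ ≤ 1 ∧ ‖K‖ ≤ ‖K x‖ + ε := by
  obtain ⟨x, hx, h⟩ := K.exists_lt_apply_of_lt_opNorm (r := ‖K‖ - ε) (by linarith)
  exact ⟨x, hx.le, by linarith⟩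

lemma norm_le_of_energy {T : L2Vec Ω →L[ℝ] L2Vec Ω} (hT : IsTensorOp α β T) {u : WS Ω} {C c : ℝ}
    (hC : 0 ≤ C) (hc : 0 ≤ c) (hP : ‖u‖ ≤ C * ‖gradL u‖)
    (h : inner ℝ (T (gradL u)) (gradL u) ≤ c * ‖gradL u‖) : ‖u‖ ≤ C * (c / α) := by
  have hα := hT.pos
  refine hP.trans (mul_le_mul_of_nonneg_left ?_ hC)
  have h2 := (hT.coercive (gradL u)).trans h
  rw [le_div_iff₀ hα]
  rcases (norm_nonneg (gradL u)).eq_or_lt with h0 | h0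
  · rw [← h0, zero_mul]; exact hc
  · refine le_of_mul_le_mul_right ?_ h0
    nlinarith

lemma isClosed_L2Star (hN : 0 < N) (hΩ : IsBoundedLipschitzDomain Ω) :
    IsClosed (L2Star Ω : Set (L2Bd Ω)) := by
  have h : (L2Star Ω : Set (L2Bd Ω)) = {g | inner ℝ g (tr Ω (oneW hΩ)) = 0} :=
    Set.ext fun g => mem_L2Star_iff hN hΩ g
  rw [h]
  exact isClosed_eq (continuous_id.inner continuous_const) continuous_const

variable {T : ι → L2Vec Ω →L[ℝ] L2Vec Ω} {T' : L2Vec Ω →L[ℝ] L2Vec Ω} {U : Ultrafilter ι}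

/-- Weak convergence of the Neumann data implies weak convergence of the solutions. -/
lemma IsNeu.weakLim (hN : 0 < N) (hΩ : IsBoundedLipschitzDomain Ω)
    (hT : ∀ i, IsTensorOp α β (T i)) (hT' : IsTensorOp α β T') (hH : HLim Ω U T T')
    {g : ι → L2Bd Ω} {g' : L2Bd Ω} (hg : WeakLim (U : Filter ι) g g') {M : ℝ} (hM0 : 0 ≤ M)
    (hM : ∀ i, ‖g i‖ ≤ M) {v : ι → WS Ω} {v' : WS Ω} (hv : ∀ i, IsNeu hΩ (T i) (g i) (v i))
    (hv' : IsNeu hΩ T' g' v') :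
    WeakLim (U : Filter ι) v v' ∧ ∃ M', ∀ i, ‖v i‖ ≤ M' := by
  obtain ⟨C, hC, hP⟩ := exists_poincare hN hΩ
  have hbd : ∀ i, ‖v i‖ ≤ C * (M * (‖tr Ω‖ * C) / α) := fun i => by
    refine norm_le_of_energy (hT i) hC.le (by positivity) (hP _ (hv i).mean) ?_
    rw [(hv i).weak]
    have h1 := hP _ (hv i).mean
    calc inner ℝ (g i) (tr Ω (v i)) ≤ ‖g i‖ * ‖tr Ω (v i)‖ := real_inner_le_norm _ _
      _ ≤ M * (‖tr Ω‖ * (C * ‖gradL (v i)‖)) := by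
        refine mul_le_mul (hM i) (((tr Ω).le_opNorm _).trans ?_) (norm_nonneg _) hM0
        gcongr
      _ = _ := by ring
  obtain ⟨a, ha⟩ := WeakLim.exists_of_bounded U hbd
  have hflux := hH.flux_tendsto hN hΩ hT hT' ha hbd fun i ψ hψ => by
    rw [(hv i).weak, tr_eq_zero_of_mem_W0 hN hΩ hψ, inner_zero_right]
  have haN : IsNeu hΩ T' g' a := by
    refine ⟨ha.mem_closed (isClosed_WMean hΩ) fun i => (hv i).mean, fun ψ => ?_⟩
    have h1 := hflux (gradL ψ)
    simp only [(hv _).weak] at h1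
    exact tendsto_nhds_unique h1 (hg (tr Ω ψ))
  rw [hv'.unique hN hT' haN]
  exact ⟨ha, _, hbd⟩

/-- Strong convergence of the Dirichlet data implies convergence of the fluxes. -/
lemma IsDir.flux_weakLim (hN : 0 < N) (hΩ : IsBoundedLipschitzDomain Ω)
    (hT : ∀ i, IsTensorOp α β (T i)) (hT' : IsTensorOp α β T') (hH : HLim Ω U T T')
    {φ : ι → WS Ω} {φ' : WS Ω} (hφ : Tendsto φ U (𝓝 φ')) {M : ℝ} (hM0 : 0 ≤ M)
    (hM : ∀ i, ‖φ i‖ ≤ M) {u : ι → WS Ω} {u' : WS Ω} (hu : ∀ i, IsDir (T i) (φ i) (u i))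
    (hu' : IsDir T' φ' u') :
    WeakLim (U : Filter ι) (fun i => T i (gradL (u i))) (T' (gradL u')) ∧
      ∃ M', ∀ i, ‖T i (gradL (u i))‖ ≤ M' := by
  obtain ⟨C, hC, hP⟩ := exists_poincare hN hΩ
  have hbd : ∀ i, ‖u i - φ i‖ ≤ C * (|β| * M / α) := fun i => by
    have hmem := (hu i).boundary
    refine norm_le_of_energy (hT i) hC.le (by positivity) (hP _ (W0_le_WMean hN hΩ hmem)) ?_
    have h1 := (hu i).weak _ hmem
    have h2 : gradL (u i - φ i) = gradL (u i) - gradL (φ i) := map_sub gradL _ _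
    have h3 : inner ℝ (T i (gradL (u i - φ i))) (gradL (u i - φ i)) =
        -inner ℝ (T i (gradL (φ i))) (gradL (u i - φ i)) := by
      rw [congrArg (T i) h2, map_sub (T i), inner_sub_left, h1, zero_sub]
    rw [h3]
    calc -inner ℝ (T i (gradL (φ i))) (gradL (u i - φ i))
        ≤ ‖T i (gradL (φ i))‖ * ‖gradL (u i - φ i)‖ :=
          (neg_le_abs _).trans (abs_real_inner_le_norm _ _)
      _ ≤ (|β| * M) * ‖gradL (u i - φ i)‖ := by
        refine mul_le_mul_of_nonneg_right (((hT i).norm_le _).trans ?_) (norm_nonneg _)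
        exact mul_le_mul (le_abs_self β) ((norm_gradL_le _).trans (hM i)) (norm_nonneg _)
          (abs_nonneg β)
  have hbu : ∀ i, ‖u i‖ ≤ M + C * (|β| * M / α) := fun i => by
    have h1 : ‖u i‖ ≤ ‖φ i‖ + ‖u i - φ i‖ := norm_le_norm_add_norm_sub' _ _
    exact h1.trans (add_le_add (hM i) (hbd i))
  obtain ⟨a, ha⟩ := WeakLim.exists_of_bounded U hbu
  have hflux := hH.flux_tendsto hN hΩ hT hT' ha hbu fun i => (hu i).weak
  have haD : IsDir T' φ' a := by
    refine ⟨(ha.sub (WeakLim.of_tendsto hφ)).mem_closed isClosed_W0 fun i => (hu i).boundary,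
      fun ψ hψ => ?_⟩
    have h1 := hflux (gradL ψ)
    simp only [(hu _).weak ψ hψ] at h1
    exact tendsto_nhds_unique h1 tendsto_const_nhds
  have hau := hu'.unique hN hΩ hT' haD (by rw [sub_self]; exact zero_mem _)
  rw [hau]
  refine ⟨hflux, |β| * (M + C * (|β| * M / α)), fun i => ((hT i).norm_le _).trans ?_⟩
  exact mul_le_mul (le_abs_self β) ((norm_gradL_le _).trans (hbu i)) (norm_nonneg _)
    (abs_nonneg β)

/-- The energy of the difference of a Dirichlet and a Neumann solution. -/
lemma energy_eq (hN : 0 < N) {hΩ : IsBoundedLipschitzDomain Ω} {T : L2Vec Ω →L[ℝ] L2Vec Ω}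
    (hs : ∀ G H, inner ℝ (T G) H = inner ℝ G (T H)) {φ u v : WS Ω} {g : L2Bd Ω}
    (hu : IsDir T φ u) (hv : IsNeu hΩ T g v) :
    inner ℝ (T (gradL u - gradL v)) (gradL u - gradL v) =
      inner ℝ (T (gradL u)) (gradL φ) - 2 * inner ℝ g (tr Ω φ) + inner ℝ g (tr Ω v) := by
  have h1 : inner ℝ (T (gradL u)) (gradL u) = inner ℝ (T (gradL u)) (gradL φ) := by
    have := hu.weak _ hu.boundary
    rw [map_sub gradL, inner_sub_right] at this
    linarith
  have h2 : tr Ω u = tr Ω φ := by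
    have := tr_eq_zero_of_mem_W0 hN hΩ hu.boundary
    rwa [map_sub, sub_eq_zero] at this
  rw [map_sub T, inner_sub_left, inner_sub_right, inner_sub_right, hs (gradL u) (gradL v),
    real_inner_comm (T (gradL v)) (gradL u), hv.weak, hv.weak, h1, h2]
  ring

lemma energy_tendsto (hN : 0 < N) (hΩ : IsBoundedLipschitzDomain Ω)
    (hT : ∀ i, IsTensorOp α β (T i)) (hT' : IsTensorOp α β T') (hH : HLim Ω U T T')
    (hs : ∀ i G H, inner ℝ (T i G) H = inner ℝ G (T i H))
    (hs' : ∀ G H, inner ℝ (T' G) H = inner ℝ G (T' H))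
    {φ : ι → WS Ω} {φ' : WS Ω} (hφ : Tendsto φ U (𝓝 φ')) {M : ℝ} (hM0 : 0 ≤ M)
    (hφM : ∀ i, ‖φ i‖ ≤ M) {g : ι → L2Bd Ω} {g' : L2Bd Ω} (hg : WeakLim (U : Filter ι) g g')
    {M' : ℝ} (hM0' : 0 ≤ M') (hgM : ∀ i, ‖g i‖ ≤ M') {u v : ι → WS Ω} {u' v' : WS Ω}
    (hu : ∀ i, IsDir (T i) (φ i) (u i)) (hu' : IsDir T' φ' u')
    (hv : ∀ i, IsNeu hΩ (T i) (g i) (v i)) (hv' : IsNeu hΩ T' g' v') :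
    Tendsto (fun i => inner ℝ (T i (gradL (u i) - gradL (v i))) (gradL (u i) - gradL (v i))) U
      (𝓝 (inner ℝ (T' (gradL u' - gradL v')) (gradL u' - gradL v'))) := by
  obtain ⟨hfl, K, hK⟩ := IsDir.flux_weakLim hN hΩ hT hT' hH hφ hM0 hφM hu hu'
  obtain ⟨hvl, K', hK'⟩ := IsNeu.weakLim hN hΩ hT hT' hH hg hM0' hgM hv hv'
  rw [energy_eq hN hs' hu' hv']
  simp only [fun i => energy_eq hN (hs i) (hu i) (hv i)]
  refine ((hfl.inner_tendsto hK ((gradL.continuous.tendsto _).comp hφ)).sub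
    ((hg.inner_tendsto hgM (((tr Ω).continuous.tendsto _).comp hφ)).const_mul 2)).add
    (hg.inner_tendsto hgM (tendsto_tr hN hΩ hvl hK'))

end Limits

/-! ### The forward operators -/

section Forward

variable {N : ℕ} {Ω : Set (E N)} {α β : ℝ}

lemma HConverges.hLim (hα : 0 < α) (hαβ : α ≤ β)
    {A : ℕ → E N → Matrix (Fin N) (Fin N) ℝ} {A' : E N → Matrix (Fin N) (Fin N) ℝ}
    (hA : ∀ n, MemTilde Ω α β (A n)) (hA' : MemTilde Ω α β A') (hH : HConverges Ω A A') :
    HLim Ω atTop (fun n => tens Ω (A n)) (tens Ω A') := by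
  intro F u u' hu hF hu' hF'
  obtain ⟨F₀, hF₀⟩ : ∃ F₀ : StrongDual ℝ (W12 Ω), ∀ ψ, F₀ (eqv Ω ψ) = F ψ :=
    ⟨F.comp (eqv Ω).symm.toContinuousLinearEquiv.toContinuousLinearMap, fun _ => rfl⟩
  have hsol : ∀ {B : E N → Matrix (Fin N) (Fin N) ℝ}, MemTilde Ω α β B → ∀ {w : WS Ω},
      w ∈ W0 Ω → (∀ ψ ∈ W0 Ω, inner ℝ (tens Ω B (gradL w)) (gradL ψ) = F ψ) →
      IsDirichletSol Ω B F₀ 0 (eqv Ω w) := fun {B} hB {w} hw h => by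
    refine ⟨by rw [sub_zero]; exact hw, fun ψ hψ => ?_⟩
    have h1 := h ((eqv Ω).symm ψ) hψ
    rw [hB.form_eq hα hαβ]
    exact h1.trans (hF₀ ((eqv Ω).symm ψ)).symm
  obtain ⟨h1, h2⟩ := hH F₀ (fun n => ⟨eqv Ω (u n), hu n⟩) ⟨eqv Ω u', hu'⟩
    (fun n => hsol (hA n) (hu n) (hF n)) (hsol hA' hu' hF')
  constructor
  · intro y
    obtain ⟨l, hl⟩ : ∃ l : StrongDual ℝ (W012 Ω), ∀ (w : WS Ω) (hw : w ∈ W0 Ω),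
        l ⟨eqv Ω w, hw⟩ = inner ℝ w y :=
      ⟨((innerSL ℝ y).comp (eqv Ω).symm.toContinuousLinearEquiv.toContinuousLinearMap).comp
        (W012 Ω).subtypeL, fun w _ => real_inner_comm w y⟩
    have h3 : Tendsto (fun n => inner ℝ (u n) y) atTop (𝓝 (l ⟨eqv Ω u', hu'⟩)) :=
      (h1 l).congr fun n => hl (u n) (hu n)
    rwa [hl u' hu'] at h3
  · intro H
    have h3 := h2 H
    rw [hA'.integral_eq hα hαβ] at h3
    simp only [fun n => (hA n).integral_eq hα hαβ] at h3
    exact h3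

lemma isNeumannSol_iff (hN : 0 < N) (hΩ : IsBoundedLipschitzDomain Ω) (hα : 0 < α) (hαβ : α ≤ β)
    {A : E N → Matrix (Fin N) (Fin N) ℝ} (hA : MemTilde Ω α β A) (g : L2Star Ω) (v : WS Ω) :
    IsNeumannSol Ω A (toDual g) (eqv Ω v) ↔ IsNeu hΩ (tens Ω A) (g : L2Bd Ω) v := by
  constructor
  · rintro ⟨h1, h2⟩
    refine ⟨(mem_WMean hN hΩ).2 h1, fun ψ => ?_⟩
    have h3 := h2 (eqv Ω ψ)
    rw [hA.form_eq hα hαβ] at h3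
    exact h3
  · rintro ⟨h1, h2⟩
    refine ⟨(mem_WMean hN hΩ).1 h1, fun ψ => ?_⟩
    rw [hA.form_eq hα hαβ]
    exact h2 ((eqv Ω).symm ψ)

lemma isDirichletSol_iff (hα : 0 < α) (hαβ : α ≤ β)
    {A : E N → Matrix (Fin N) (Fin N) ℝ} (hA : MemTilde Ω α β A) (φ u : WS Ω) :
    IsDirichletSol Ω A 0 (eqv Ω φ) (eqv Ω u) ↔ IsDir (tens Ω A) φ u := by
  constructor
  · rintro ⟨h1, h2⟩
    refine ⟨h1, fun ψ hψ => ?_⟩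
    have h3 := h2 (eqv Ω ψ) hψ
    rw [hA.form_eq hα hαβ] at h3
    exact h3
  · rintro ⟨h1, h2⟩
    refine ⟨h1, fun ψ hψ => ?_⟩
    rw [hA.form_eq hα hαβ]
    exact h2 ((eqv Ω).symm ψ) hψ

lemma isNDMap_apply (hN : 0 < N) (hΩ : IsBoundedLipschitzDomain Ω) (hα : 0 < α) (hαβ : α ≤ β)
    {A : E N → Matrix (Fin N) (Fin N) ℝ} (hA : MemTilde Ω α β A)
    {T : L2Star Ω →L[ℝ] L2Star Ω} (hT : IsNDMap Ω A T) {g : L2Star Ω} {v : WS Ω}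
    (hv : IsNeu hΩ (tens Ω A) (g : L2Bd Ω) v) : (T g : L2Bd Ω) = tr Ω v := by
  obtain ⟨w, hw, hTw⟩ := hT g
  have hw' : IsNeu hΩ (tens Ω A) (g : L2Bd Ω) ((eqv Ω).symm w) :=
    (isNeumannSol_iff hN hΩ hα hαβ hA g ((eqv Ω).symm w)).1 hw
  rw [hv.unique hN (hA.isTensorOp hΩ hα hαβ) hw', ← hTw]
  rfl

theorem existsUnique_isNDMap (hN : 0 < N) (hΩ : IsBoundedLipschitzDomain Ω) (hα : 0 < α)
    (hαβ : α ≤ β) {A : E N → Matrix (Fin N) (Fin N) ℝ} (hA : MemTilde Ω α β A) :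
    ∃! T, IsNDMap Ω A T := by
  obtain ⟨S, hS⟩ := exists_neu hN hΩ (hA.isTensorOp hΩ hα hαβ)
  have hmem : ∀ g : L2Star Ω, tr Ω (S g) ∈ L2Star Ω := fun g =>
    (mem_WMean hN hΩ).1 (hS g g.2).mean
  refine ⟨((tr Ω).comp (S.comp (L2Star Ω).subtypeL)).codRestrict (L2Star Ω) hmem,
    fun g => ⟨eqv Ω (S g), (isNeumannSol_iff hN hΩ hα hαβ hA g _).2 (hS g g.2), rfl⟩,
    fun T hT => ?_⟩
  ext1 g
  exact Subtype.ext (isNDMap_apply hN hΩ hα hαβ hA hT (hS g g.2))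

lemma isNDMap_ND (hN : 0 < N) (hΩ : IsBoundedLipschitzDomain Ω) (hα : 0 < α)
    (hαβ : α ≤ β) {A : E N → Matrix (Fin N) (Fin N) ℝ} (hA : MemTilde Ω α β A) :
    IsNDMap Ω A (ND Ω A) := by
  have h := (existsUnique_isNDMap hN hΩ hα hαβ hA).exists
  rw [ND, dif_pos h]
  exact h.choose_spec

/-- Norm convergence of the Neumann-to-Dirichlet maps: both `N-D(A_n) g_n` and `N-D(A') g_n`
converge strongly to `N-D(A') g` when `g_n ⇀ g`, by compactness of the trace operator. -/
theorem tendsto_ND (hN : 0 < N) (hΩ : IsBoundedLipschitzDomain Ω) (hα : 0 < α)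
    (hαβ : α ≤ β) {A : ℕ → E N → Matrix (Fin N) (Fin N) ℝ} {A' : E N → Matrix (Fin N) (Fin N) ℝ}
    (hA : ∀ n, MemTilde Ω α β (A n)) (hA' : MemTilde Ω α β A') (hH : HConverges Ω A A') :
    Tendsto (fun n => ‖ND Ω (A n) - ND Ω A'‖) atTop (𝓝 0) := by
  rw [tendsto_iff_ultrafilter]
  intro U hU
  have hT := fun n => (hA n).isTensorOp hΩ hα hαβ
  have hT' := hA'.isTensorOp hΩ hα hαβ
  choose g hg1 hg using fun n : ℕ =>
    exists_le_norm_apply_add (ND Ω (A n) - ND Ω A') (ε := 1 / ((n : ℝ) + 1)) (by positivity)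
  have hgb : ∀ n, ‖(g n : L2Bd Ω)‖ ≤ 1 := hg1
  obtain ⟨g', hg'⟩ := WeakLim.exists_of_bounded U hgb
  have hmem := hg'.mem_closed (isClosed_L2Star hN hΩ) fun n => (g n).2
  choose S hS using fun n => exists_neu hN hΩ (hT n)
  obtain ⟨S', hS'⟩ := exists_neu hN hΩ hT'
  obtain ⟨hw, M, hM⟩ := IsNeu.weakLim hN hΩ hT hT' ((hH.hLim hα hαβ hA hA').mono hU) hg' zero_le_one
    hgb (fun n => hS n (g n) (g n).2) (hS' g' hmem)
  have h1 := tendsto_tr hN hΩ hw hM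
  have h2 : Tendsto (fun n => tr Ω (S' (g n))) U (𝓝 (tr Ω (S' g'))) :=
    tendsto_tr hN hΩ (hg'.map S') (M := ‖S'‖ * 1) fun n =>
      (S'.le_opNorm _).trans (by gcongr; exact hgb n)
  have h3 := (h1.sub h2).norm.add (tendsto_one_div_add_atTop_nhds_zero_nat.mono_left hU)
  rw [sub_self, norm_zero, zero_add] at h3
  refine squeeze_zero (fun n => ContinuousLinearMap.opNorm_nonneg _) (fun n => ?_) h3
  refine (hg n).trans (le_of_eq ?_)
  congr 1
  have e1 := isNDMap_apply hN hΩ hα hαβ (hA n) (isNDMap_ND hN hΩ hα hαβ (hA n)) (hS n (g n) (g n).2)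
  have e2 := isNDMap_apply hN hΩ hα hαβ hA' (isNDMap_ND hN hΩ hα hαβ hA') (hS' (g n) (g n).2)
  rw [← e1, ← e2]
  rfl

/-- The `H`-limit of symmetric tensors is symmetric. -/
theorem isSymmTensor_limit (hN : 0 < N) (hΩ : IsBoundedLipschitzDomain Ω) (hα : 0 < α)
    (hαβ : α ≤ β) {A : ℕ → E N → Matrix (Fin N) (Fin N) ℝ} {A' : E N → Matrix (Fin N) (Fin N) ℝ}
    (hA : ∀ n, MemTilde Ω α β (A n)) (hA' : MemTilde Ω α β A') (hH : HConverges Ω A A')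
    (hs : ∀ n, IsSymmTensor Ω (A n)) : IsSymmTensor Ω A' := by
  have hT := fun n => (hA n).isTensorOp hΩ hα hαβ
  have hcoef : ∀ i j, ∀ᵐ x ∂volume.restrict Ω, A' x i j - A' x j i = 0 := fun i j => by
    have hentry : ∀ (x : E N) (i j : Fin N), inner ℝ
        (act (A' x) (EuclideanSpace.single j (1 : ℝ))) (EuclideanSpace.single i (1 : ℝ)) =
          A' x i j := fun x i j => by
      rw [EuclideanSpace.inner_single_right, act]
      simp
    have hint : ∀ i j, Integrable (fun x => A' x i j) (volume.restrict Ω) := fun i j => by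
      have := finite_restrict hΩ.isBounded
      refine Integrable.of_bound (hA'.aemeasurable i j).aestronglyMeasurable β ?_
      filter_upwards [(hA'.isBddField hα hαβ).bdd] with x hx
      rw [← hentry]
      refine (norm_inner_le_norm _ _).trans ?_
      rw [PiLp.norm_single, norm_one, mul_one]
      refine ((actC (A' x)).le_of_opNorm_le hx _).trans ?_
      rw [PiLp.norm_single, norm_one, mul_one]
    refine ae_eq_zero_of_test hΩ.isOpen ((hint i j).sub (hint j i)) fun ζ hζ => ?_
    obtain ⟨y, hy, hyg⟩ := exists_W0_linear hN hΩ hζ (EuclideanSpace.single i (1 : ℝ))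
    obtain ⟨z, hz, hzg⟩ := exists_W0_linear hN hΩ hζ (EuclideanSpace.single j (1 : ℝ))
    have hsym := (hH.hLim hα hαβ hA hA').symm_limit hN hΩ hT
      (fun n => (hA n).tens_symm hα hαβ (hs n)) hζ hy hz
    rw [← sub_eq_zero, MeasureTheory.L2.inner_def, MeasureTheory.L2.inner_def,
      ← integral_sub (L2.integrable_inner _ _) (L2.integrable_inner _ _)] at hsym
    rw [← hsym]
    refine integral_congr_ae ?_
    filter_upwards [hyg, hzg, mulF_coeFn hΩ hζ.smooth (gradL y), mulF_coeFn hΩ hζ.smooth (gradL z),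
      hA'.tens_coeFn hα hαβ (gradL y), hA'.tens_coeFn hα hαβ (gradL z)] with x b1 b2 b3 b4 b5 b6
    rw [b3, b4, b5, b6, real_inner_smul_right, real_inner_smul_right]
    by_cases hx : ζ x = 0
    · rw [hx]; ring
    · rw [b1 hx, b2 hx, hentry, hentry]; ring
  have hall := ae_all_iff.2 fun i => ae_all_iff.2 fun j => hcoef i j
  filter_upwards [hall] with x hx
  ext i j
  rw [Matrix.transpose_apply]
  linarith [hx i j]

end Forward

/-! ### Convergence of the norms of `KN₁` -/

section KernelOperator

variable {N : ℕ} {Ω : Set (E N)} {α β : ℝ}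

/-- The inclusion `L²_*(∂Ω) ⊆ W^{-1/2,2}_*(∂Ω)` as a bounded linear operator. -/
def toDualL (Ω : Set (E N)) : L2Star Ω →L[ℝ] WmBdStar Ω :=
  LinearMap.mkContinuous
    { toFun := toDual
      map_add' := fun g g' => Subtype.ext (ContinuousLinearMap.ext fun h =>
        inner_add_left (g : L2Bd Ω) (g' : L2Bd Ω) (bdIncl Ω h))
      map_smul' := fun c g => Subtype.ext (ContinuousLinearMap.ext fun h =>
        real_inner_smul_left (g : L2Bd Ω) (bdIncl Ω h) c) }
    ‖bdIncl Ω‖ fun g => by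
      refine ContinuousLinearMap.opNorm_le_bound (σ₁₂ := RingHom.id ℝ)
        (show StrongDual ℝ (W12Bd Ω) from (toDual g).1) (by positivity) fun h => ?_
      calc ‖inner ℝ (g : L2Bd Ω) (bdIncl Ω h)‖ ≤ ‖(g : L2Bd Ω)‖ * ‖bdIncl Ω h‖ :=
            norm_inner_le_norm _ _
        _ ≤ ‖(g : L2Bd Ω)‖ * (‖bdIncl Ω‖ * ‖h‖) := by
            gcongr
            exact (bdIncl Ω).le_opNorm h
        _ = ‖bdIncl Ω‖ * ‖g‖ * ‖h‖ := by rw [← mul_assoc, mul_comm ‖(g : L2Bd Ω)‖]; rfl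

lemma exists_toBd_eq (h : W12Bd Ω) (hh : ‖h‖ ≤ 1) : ∃ ψ : WS Ω, toBd (eqv Ω ψ) = h ∧ ‖ψ‖ ≤ 2 := by
  obtain ⟨ψ, hψ, hn⟩ := Submodule.Quotient.norm_mk_lt (S := (trace Ω).ker) h one_pos
  exact ⟨(eqv Ω).symm ψ, hψ, by
    rw [LinearIsometryEquiv.norm_map]
    have : ‖ψ‖ < ‖h‖ + 1 := hn
    linarith⟩

/-- The inclusion `L²_*(∂Ω) ⊆ W^{-1/2,2}_*(∂Ω)` is compact, as the adjoint of the trace operator. -/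
lemma tendsto_toDualL (hN : 0 < N) (hΩ : IsBoundedLipschitzDomain Ω) {U : Ultrafilter ℕ}
    (hU : (U : Filter ℕ) ≤ atTop) {g : ℕ → L2Star Ω} {g' : L2Star Ω}
    (hg : WeakLim (U : Filter ℕ) (fun n => (g n : L2Bd Ω)) g') {M : ℝ} (hM : ∀ n, ‖g n‖ ≤ M) :
    Tendsto (fun n => toDualL Ω (g n)) U (𝓝 (toDualL Ω g')) := by
  rw [tendsto_iff_norm_sub_tendsto_zero]
  choose h hh1 hh using fun n : ℕ => exists_le_norm_apply_add
    (show StrongDual ℝ (W12Bd Ω) from (toDual (g n - g')).1) (ε := 1 / ((n : ℝ) + 1))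
    (by positivity)
  choose ψ hψ hψ2 using fun n => exists_toBd_eq (h n) (hh1 n)
  obtain ⟨ψ', hψ'⟩ := WeakLim.exists_of_bounded U hψ2
  have htr := tendsto_tr hN hΩ hψ' hψ2
  have hgM : ∀ n, ‖(g n : L2Bd Ω) - (g' : L2Bd Ω)‖ ≤ M + ‖g'‖ := fun n =>
    (norm_sub_le _ _).trans (add_le_add (hM n) le_rfl)
  have h1 := ((hg.sub (WeakLim.const _ (g' : L2Bd Ω))).inner_tendsto hgM htr).norm
  rw [sub_self, inner_zero_left, norm_zero] at h1
  have h2 := h1.add (tendsto_one_div_add_atTop_nhds_zero_nat.mono_left hU)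
  rw [zero_add] at h2
  refine squeeze_zero (fun n => norm_nonneg _) (fun n => ?_) h2
  rw [← map_sub]
  refine (hh n).trans (le_of_eq ?_)
  rw [← hψ n]
  rfl

/-- Every element of `W^{1/2,2}(∂Ω)` is the trace of a function depending linearly and continuously
on it. -/
lemma exists_lift (hN : 0 < N) (hΩ : IsBoundedLipschitzDomain Ω) :
    ∃ L : W12Bd Ω →L[ℝ] WS Ω, ∀ h, toBd (eqv Ω (L h)) = h := by
  obtain ⟨P, hP⟩ : ∃ P : W12 Ω →L[ℝ] WS Ω, P = ((W0 Ω)ᗮ.starProjection).comp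
    (eqv Ω).symm.toContinuousLinearEquiv.toContinuousLinearMap := ⟨_, rfl⟩
  have hker : (trace Ω).ker ≤ P.ker := fun u hu => by
    have h1 : (eqv Ω).symm u ∈ W0 Ω := mem_W0_of_tr_eq_zero hN hΩ hu
    rw [hP]
    exact Submodule.starProjection_orthogonal_apply_eq_zero h1
  refine ⟨(trace Ω).ker.liftQL P hker, fun h => ?_⟩
  obtain ⟨u, rfl⟩ := Submodule.Quotient.mk_surjective _ h
  refine (Submodule.Quotient.eq _).2 ?_
  have h1 : P u = (eqv Ω).symm u - (W0 Ω).starProjection ((eqv Ω).symm u) := by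
    rw [hP]
    exact Submodule.starProjection_orthogonal_val _
  have h2 : (W0 Ω).starProjection ((eqv Ω).symm u) ∈ W0 Ω := Submodule.starProjection_apply_mem _ _
  have h3 : tr Ω (P u - (eqv Ω).symm u) = 0 := by
    rw [h1, sub_sub_cancel_left, map_neg, tr_eq_zero_of_mem_W0 hN hΩ h2, neg_zero]
  exact h3

lemma sub_mem_W0_of_toBd_eq (hN : 0 < N) (hΩ : IsBoundedLipschitzDomain Ω) {φ φ' : WS Ω}
    (h : toBd (eqv Ω φ) = toBd (eqv Ω φ')) : φ - φ' ∈ W0 Ω :=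
  mem_W0_of_tr_eq_zero hN hΩ ((Submodule.Quotient.eq (trace Ω).ker).1 h)

lemma isKN1Map_apply (hN : 0 < N) (hΩ : IsBoundedLipschitzDomain Ω) (hα : 0 < α) (hαβ : α ≤ β)
    {A : E N → Matrix (Fin N) (Fin N) ℝ} (hA : MemTilde Ω α β A) (hs : IsSymmTensor Ω A)
    {Λ : WmBdStar Ω →L[ℝ] W12BdStar Ω} {K : L2Star Ω →L[ℝ] L2Vec Ω} (hK : IsKN1Map Ω Λ A K)
    {g : L2Star Ω} {φ u v : WS Ω} (hφ : toBd (eqv Ω φ) = (Λ (toDual g) : W12Bd Ω))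
    (hu : IsDir (tens Ω A) φ u) (hv : IsNeu hΩ (tens Ω A) (g : L2Bd Ω) v) :
    K g = sqrtTens Ω A (gradL u - gradL v) := by
  have hT := hA.isTensorOp hΩ hα hαβ
  obtain ⟨φ₁, u₁, v₁, h1, h2, h3, h4⟩ := hK g
  have hu' : IsDir (tens Ω A) ((eqv Ω).symm φ₁) ((eqv Ω).symm u₁) :=
    (isDirichletSol_iff hα hαβ hA ((eqv Ω).symm φ₁) ((eqv Ω).symm u₁)).1 h2
  have hv' : IsNeu hΩ (tens Ω A) (g : L2Bd Ω) ((eqv Ω).symm v₁) :=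
    (isNeumannSol_iff hN hΩ hα hαβ hA g ((eqv Ω).symm v₁)).1 h3
  have hφφ : φ - (eqv Ω).symm φ₁ ∈ W0 Ω := sub_mem_W0_of_toBd_eq hN hΩ (hφ.trans h1.symm)
  have eu := hu.unique hN hΩ hT hu' hφφ
  have ev := hv.unique hN hT hv'
  have gu : gradL u = grad u₁ := by rw [eu]; rfl
  have gv : gradL v = grad v₁ := by rw [ev]; rfl
  rw [gu, gv]
  refine Lp.ext (h4.trans ?_)
  filter_upwards [hA.sqrtTens_coeFn hα hαβ hs (grad u₁ - grad v₁),
    Lp.coeFn_sub (grad u₁) (grad v₁)] with x b1 b2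
  rw [b1, b2, Pi.sub_apply]

theorem existsUnique_isKN1Map (hN : 0 < N) (hΩ : IsBoundedLipschitzDomain Ω) (hα : 0 < α)
    (hαβ : α ≤ β) {A : E N → Matrix (Fin N) (Fin N) ℝ} (hA : MemTilde Ω α β A)
    (hs : IsSymmTensor Ω A) (Λ : WmBdStar Ω →L[ℝ] W12BdStar Ω) : ∃! K, IsKN1Map Ω Λ A K := by
  have hT := hA.isTensorOp hΩ hα hαβ
  obtain ⟨S, hS⟩ := exists_neu hN hΩ hT
  obtain ⟨D, hD⟩ := exists_dir hN hΩ hT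
  obtain ⟨L, hL⟩ := exists_lift hN hΩ
  obtain ⟨P, hP⟩ : ∃ P : L2Star Ω →L[ℝ] WS Ω, ∀ g, P g = L (Λ (toDual g) : W12Bd Ω) :=
    ⟨L.comp ((W12BdStar Ω).subtypeL.comp (Λ.comp (toDualL Ω))), fun _ => rfl⟩
  obtain ⟨K, hK⟩ : ∃ K : L2Star Ω →L[ℝ] L2Vec Ω, ∀ g : L2Star Ω,
      K g = sqrtTens Ω A (gradL (D (P g)) - gradL (S (g : L2Bd Ω))) :=
    ⟨(sqrtTens Ω A).comp ((gradL.comp (D.comp P)) - gradL.comp (S.comp (L2Star Ω).subtypeL)),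
      fun _ => rfl⟩
  have hφ : ∀ g, toBd (eqv Ω (P g)) = (Λ (toDual g) : W12Bd Ω) := fun g => by rw [hP, hL]
  refine ⟨K, fun g => ⟨eqv Ω (P g), eqv Ω (D (P g)), eqv Ω (S (g : L2Bd Ω)), hφ g,
    (isDirichletSol_iff hα hαβ hA _ _).2 (hD _),
    (isNeumannSol_iff hN hΩ hα hαβ hA g _).2 (hS g g.2), ?_⟩, fun K' hK' => ?_⟩
  · rw [hK, grad_eqv, grad_eqv]
    filter_upwards [hA.sqrtTens_coeFn hα hαβ hs (gradL (D (P g)) - gradL (S (g : L2Bd Ω))),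
      Lp.coeFn_sub (gradL (D (P g))) (gradL (S (g : L2Bd Ω)))] with x b1 b2
    rw [b1, b2, Pi.sub_apply]
  · ext1 g
    rw [hK]
    exact isKN1Map_apply hN hΩ hα hαβ hA hs hK' (hφ g) (hD _) (hS g g.2)

lemma isKN1Map_KN1 (hN : 0 < N) (hΩ : IsBoundedLipschitzDomain Ω) (hα : 0 < α)
    (hαβ : α ≤ β) {A : E N → Matrix (Fin N) (Fin N) ℝ} (hA : MemTilde Ω α β A)
    (hs : IsSymmTensor Ω A) (Λ : WmBdStar Ω →L[ℝ] W12BdStar Ω) :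
    IsKN1Map Ω Λ A (KN1 Ω Λ A) := by
  have h := (existsUnique_isKN1Map hN hΩ hα hαβ hA hs Λ).exists
  rw [KN1, dif_pos h]
  exact h.choose_spec

/-- `‖KN₁(A_n) g_n‖ → ‖KN₁(A') g‖` when `g_n ⇀ g`. -/
lemma tendsto_norm_KN1_apply (hN : 0 < N) (hΩ : IsBoundedLipschitzDomain Ω) (hα : 0 < α)
    (hαβ : α ≤ β) {A : ℕ → E N → Matrix (Fin N) (Fin N) ℝ} {A' : E N → Matrix (Fin N) (Fin N) ℝ}
    (hA : ∀ n, MemTilde Ω α β (A n)) (hA' : MemTilde Ω α β A') (hH : HConverges Ω A A')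
    (hs : ∀ n, IsSymmTensor Ω (A n)) (hs' : IsSymmTensor Ω A')
    (Λ : WmBdStar Ω →L[ℝ] W12BdStar Ω) {U : Ultrafilter ℕ} (hU : (U : Filter ℕ) ≤ atTop)
    {g : ℕ → L2Star Ω} {g' : L2Star Ω}
    (hg : WeakLim (U : Filter ℕ) (fun n => (g n : L2Bd Ω)) g') {M : ℝ} (hM0 : 0 ≤ M)
    (hM : ∀ n, ‖g n‖ ≤ M) :
    Tendsto (fun n => ‖KN1 Ω Λ (A n) (g n)‖) U (𝓝 ‖KN1 Ω Λ A' g'‖) := by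
  have hT := fun n => (hA n).isTensorOp hΩ hα hαβ
  have hT' := hA'.isTensorOp hΩ hα hαβ
  choose S hS using fun n => exists_neu hN hΩ (hT n)
  obtain ⟨S', hS'⟩ := exists_neu hN hΩ hT'
  choose D hD using fun n => exists_dir hN hΩ (hT n)
  obtain ⟨D', hD'⟩ := exists_dir hN hΩ hT'
  obtain ⟨L, hL⟩ := exists_lift hN hΩ
  obtain ⟨P, hP⟩ : ∃ P : WmBdStar Ω →L[ℝ] WS Ω, ∀ l, P l = L (Λ l : W12Bd Ω) :=
    ⟨L.comp ((W12BdStar Ω).subtypeL.comp Λ), fun _ => rfl⟩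
  have hφ : ∀ g : L2Star Ω, toBd (eqv Ω (P (toDualL Ω g))) = (Λ (toDual g) : W12Bd Ω) := fun g => by
    rw [hP, hL]; rfl
  have hPlim : Tendsto (fun n => P (toDualL Ω (g n))) U (𝓝 (P (toDualL Ω g'))) :=
    (P.continuous.tendsto _).comp (tendsto_toDualL hN hΩ hU hg hM)
  have hPM : ∀ n, ‖P (toDualL Ω (g n))‖ ≤ ‖P‖ * (‖toDualL Ω‖ * M) := fun n => by
    refine (P.le_opNorm _).trans ?_
    gcongr
    exact ((toDualL Ω).le_opNorm _).trans (by gcongr; exact hM n)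
  have hlim := energy_tendsto hN hΩ hT hT' ((hH.hLim hα hαβ hA hA').mono hU)
    (fun n => (hA n).tens_symm hα hαβ (hs n)) (hA'.tens_symm hα hαβ hs') hPlim (by positivity) hPM
    hg hM0 hM (fun n => hD n _) (hD' _) (fun n => hS n _ (g n).2) (hS' _ g'.2)
  have e1 : ∀ n, ‖KN1 Ω Λ (A n) (g n)‖ ^ 2 = _ := fun n => by
    rw [isKN1Map_apply hN hΩ hα hαβ (hA n) (hs n) (isKN1Map_KN1 hN hΩ hα hαβ (hA n) (hs n) Λ)
      (hφ (g n)) (hD n _) (hS n _ (g n).2), (hA n).norm_sqrtTens_sq hα hαβ (hs n)]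
  have e2 : ‖KN1 Ω Λ A' g'‖ ^ 2 =
      inner ℝ (tens Ω A' (gradL (D' (P (toDualL Ω g'))) - gradL (S' (g' : L2Bd Ω))))
        (gradL (D' (P (toDualL Ω g'))) - gradL (S' (g' : L2Bd Ω))) := by
    rw [isKN1Map_apply hN hΩ hα hαβ hA' hs' (isKN1Map_KN1 hN hΩ hα hαβ hA' hs' Λ)
      (hφ g') (hD' _) (hS' _ g'.2), hA'.norm_sqrtTens_sq hα hαβ hs']
  rw [← e2] at hlim
  have h2 := (hlim.congr fun n => (e1 n).symm).sqrt
  simpa only [Real.sqrt_sq (norm_nonneg _)] using h2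

/-- Convergence of the norms of `KN₁`: testing with a fixed datum bounds the limit from below, and
nearly maximizing data, which converge weakly, bound it from above. -/
theorem tendsto_norm_KN1 (hN : 0 < N) (hΩ : IsBoundedLipschitzDomain Ω) (hα : 0 < α)
    (hαβ : α ≤ β) {A : ℕ → E N → Matrix (Fin N) (Fin N) ℝ} {A' : E N → Matrix (Fin N) (Fin N) ℝ}
    (hA : ∀ n, MemTilde Ω α β (A n)) (hA' : MemTilde Ω α β A') (hH : HConverges Ω A A')
    (hs : ∀ n, IsSymmTensor Ω (A n)) (hs' : IsSymmTensor Ω A')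
    (Λ : WmBdStar Ω →L[ℝ] W12BdStar Ω) :
    Tendsto (fun n => ‖KN1 Ω Λ (A n)‖) atTop (𝓝 ‖KN1 Ω Λ A'‖) := by
  rw [tendsto_iff_ultrafilter]
  intro U hU
  refine tendsto_order.2 ⟨fun a ha => ?_, fun a ha => ?_⟩
  · obtain ⟨g, hg1, hg⟩ := (KN1 Ω Λ A').exists_lt_apply_of_lt_opNorm ha
    have hlim := tendsto_norm_KN1_apply hN hΩ hα hαβ hA hA' hH hs hs' Λ hU (g := fun _ => g)
      (WeakLim.const _ (g : L2Bd Ω)) zero_le_one (fun _ => hg1.le)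
    filter_upwards [hlim.eventually_const_lt hg] with n hn
    exact hn.trans_le (((KN1 Ω Λ (A n)).le_opNorm g).trans
      (mul_le_of_le_one_right (ContinuousLinearMap.opNorm_nonneg _) hg1.le))
  · choose g hg1 hg using fun n : ℕ =>
      exists_le_norm_apply_add (KN1 Ω Λ (A n)) (ε := 1 / ((n : ℝ) + 1)) (by positivity)
    have hgb : ∀ n, ‖(g n : L2Bd Ω)‖ ≤ 1 := hg1
    obtain ⟨g', hg'⟩ := WeakLim.exists_of_bounded U hgb
    have hmem := hg'.mem_closed (isClosed_L2Star hN hΩ) fun n => (g n).2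
    have hg'1 : ‖(⟨g', hmem⟩ : L2Star Ω)‖ ≤ 1 := hg'.norm_le zero_le_one hgb
    have hlim := (tendsto_norm_KN1_apply hN hΩ hα hαβ hA hA' hH hs hs' Λ hU (g := g)
      (g' := ⟨g', hmem⟩) hg' zero_le_one hg1).add
      (tendsto_one_div_add_atTop_nhds_zero_nat.mono_left hU)
    rw [add_zero] at hlim
    have hle : ‖KN1 Ω Λ A' ⟨g', hmem⟩‖ < a :=
      (((KN1 Ω Λ A').le_opNorm _).trans
        (mul_le_of_le_one_right (ContinuousLinearMap.opNorm_nonneg _) hg'1)).trans_lt ha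
    filter_upwards [hlim.eventually_lt_const hle] with n hn
    exact (hg n).trans_lt hn

end KernelOperator

end HConv

end

theorem theorem3p2 {N : ℕ} (hN : 2 ≤ N) (Ω : Set (HConv.E N))
    (hΩ : HConv.IsBoundedLipschitzDomain Ω) (α β : ℝ) (hα : 0 < α) (hαβ : α ≤ β)
    (A : ℕ → HConv.E N → Matrix (Fin N) (Fin N) ℝ) (A' : HConv.E N → Matrix (Fin N) (Fin N) ℝ)
    (hA : ∀ n, HConv.MemTilde Ω α β (A n)) (hA' : HConv.MemTilde Ω α β A')
    (hH : HConv.HConverges Ω A A') :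
    -- the trace operator and the Neumann-to-Dirichlet maps are well defined
    (∃! T, HConv.IsTraceOperator Ω T) ∧
    (∀ B, HConv.MemTilde Ω α β B → ∃! T, HConv.IsNDMap Ω B T) ∧
    -- convergence of the Neumann-to-Dirichlet maps
    Tendsto (fun n => ‖HConv.ND Ω (A n) - HConv.ND Ω A'‖) atTop (𝓝 0) ∧
    -- the part on `KN₁`, for symmetric `A_n`
    ((∀ n, HConv.IsSymmTensor Ω (A n)) →
      HConv.IsSymmTensor Ω A' ∧
      ∀ Λ : HConv.WmBdStar Ω →L[ℝ] HConv.W12BdStar Ω,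
        (∀ B, HConv.MemTilde Ω α β B → HConv.IsSymmTensor Ω B →
          ∃! K, HConv.IsKN1Map Ω Λ B K) ∧
        Tendsto (fun n => ‖HConv.KN1 Ω Λ (A n)‖) atTop (𝓝 ‖HConv.KN1 Ω Λ A'‖)) := by
  have hN' : 0 < N := by omega
  refine ⟨HConv.existsUnique_isTraceOperator hN' hΩ,
    fun B hB => HConv.existsUnique_isNDMap hN' hΩ hα hαβ hB,
    HConv.tendsto_ND hN' hΩ hα hαβ hA hA' hH, fun hs => ?_⟩
  have hs' := HConv.isSymmTensor_limit hN' hΩ hα hαβ hA hA' hH hs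
  exact ⟨hs', fun Λ => ⟨fun B hB hBs => HConv.existsUnique_isKN1Map hN' hΩ hα hαβ hB hBs Λ,
    HConv.tendsto_norm_KN1 hN' hΩ hα hαβ hA hA' hH hs hs' Λ⟩⟩
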